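/- Let $d\in\{2,3\}$ and let $\Omega\subset\mathbb{R}^d$ be a bounded polygonal ($d=2$) or polyhedral ($d=3$) domain with Lipschitz boundary $\Gamma$, not necessarily convex. Write $(\cdot,\cdot)$ for the $L^2(\Omega)$ inner products, $Q=L^2_0(\Omega)=\{q\in L^2(\Omega):(q,1)=0\}$ and $Y_0=H^1_0(\Omega)^d=\{v\in H^1(\Omega)^d: v|_\Gamma=0\}$; the norm of $H^{1/2}(\Gamma)^d$ is the Sobolev--Slobodeckij norm $\big(\|g\|_{L^2(\Gamma)^d}^2+\int_\Gamma\int_\Gamma |g(x)-g(y)|^2|x-y|^{-d}\,ds_x\,ds_y\big)^{1/2}$. Let $\alpha>0$ and $c_1>0$. Then there is a constant $c>0$, depending only on $\Omega$, $\alpha$ and $c_1$, such that the following holds. Let $Y_h\subset H^1(\Omega)^d$ and $Q_h\subset L^2_0(\Omega)$ be finite-dimensional subspaces, and set $Y_{0h}=\{v_h\in Y_h: v_h|_\Gamma=0\}$, $Y_h^\partial=\{v_h|_\Gamma: v_h\in Y_h\}$ and $\tilde Q_h=Q_h\oplus\mathcal{P}_0(\Omega)$, where $\mathcal{P}_0(\Omega)$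 is the space of constant functions on $\Omega$. Assume the discrete inf-sup condition $$\sup_{v_h\in Y_{0h}\setminus\{0\}}\frac{(\nabla\cdot v_h,q_h)}{\|\nabla v_h\|_{L^2(\Omega)^{d\times d}}}\ \ge\ \alpha\,\|q_h\|_{L^2(\Omega)}\qquad\forall q_h\in Q_h$$ and the discrete extension property $$\inf_{\varphi_h\in Y_h:\ \varphi_h|_\Gamma=g_h}\|\nabla\varphi_h\|_{L^2(\Omega)^{d\times d}}\ \le\ c_1\,\|g_h\|_{H^{1/2}(\Gamma)^d}\qquad\forall g_h\in Y_h^\partial .$$ Let $u\in H^{1/2}(\Gamma)^d$ and $u_h\in Y_h^\partial$ be arbitrary (neither $\int_\Gamma u\cdot n\,ds=0$ nor $\int_\Gamma u_h\cdot n\,ds=0$ is required). Let $(y,p)\in H^1(\Omega)^d\times Q$ be the weak solution of the Stokes problem with boundary datum $u$, that is, $y|_\Gamma=u$ and $$(\nabla y,\nabla v)-(\nabla\cdot v,p)=0\quad\forall v\in Y_0,\qquad (\nabla\cdot y,q)=0\quad\forall q\in Q,$$ and let $(y_h,p_h)\in Y_h\times Q_h$ be the discrete solution with boundary datum $u_h$,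 that is, $y_h|_\Gamma=u_h$ and $$(\nabla y_h,\nabla v_h)-(\nabla\cdot v_h,p_h)=0\quad\forall v_h\in Y_{0h},\qquad (\nabla\cdot y_h,q_h)=0\quad\forall q_h\in Q_h .$$ Then, for all $v_h\in Y_h$ and all $\tilde q_h\in\tilde Q_h$, $$\|\nabla(y-y_h)\|_{L^2(\Omega)^{d\times d}}+\|p-p_h\|_{L^2(\Omega)}\ \le\ c\left(\|y-v_h\|_{H^1(\Omega)^d}+\|u-u_h\|_{H^{1/2}(\Gamma)^d}+\|p-\tilde q_h\|_{L^2(\Omega)}\right).$$ -/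

import Mathlib

open MeasureTheory Filter Topology
open scoped ENNReal NNReal ContDiff

namespace StokesFEM

noncomputable section

/-- The Euclidean space `ℝᵈ`. -/
abbrev Space (d : ℕ) : Type := EuclideanSpace ℝ (Fin d)

/-- The space of `d × d` matrices with the Frobenius inner product; the entry `(i, j)` of a gradient
is `∂ⱼ vᵢ`. -/
abbrev Mat (d : ℕ) : Type := EuclideanSpace ℝ (Fin d × Fin d)

/-! ### The domain -/

/-- `Ω` has a Lipschitz boundary: near every boundary point, in suitable orthogonal coordinates with
vertical direction `e`, the set `Ω` is the open region above the graph of a Lipschitz function of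
the remaining coordinates (the orthogonal projection of `z` onto the complement of `e`
is `z - ⟪e, z⟫ e`). -/
def HasLipschitzBoundary {d : ℕ} (Ω : Set (Space d)) : Prop :=
  ∀ x ∈ frontier Ω, ∃ (U : Set (Space d)) (e : Space d) (γ : Space d → ℝ) (K : ℝ≥0),
    IsOpen U ∧ x ∈ U ∧ ‖e‖ = 1 ∧ LipschitzWith K γ ∧
      ∀ z ∈ U, (z ∈ Ω ↔ γ (z - inner ℝ e z • e) < inner ℝ e z)

/-- The boundary of `Ω` is contained in the union of finitely many hyperplanes. -/
def HasFlatBoundary {d : ℕ} (Ω : Set (Space d)) : Prop :=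
  ∃ (N : ℕ) (a : Fin N → Space d) (b : Fin N → ℝ), (∀ i, a i ≠ 0) ∧
    frontier Ω ⊆ ⋃ i, {x | inner ℝ (a i) x = b i}

/-- Polygonal (`d = 2`) or polyhedral (`d = 3`) domains: bounded, open, connected sets with a
Lipschitz boundary that consists of pieces of finitely many hyperplanes. No convexity. -/
structure IsPolyhedralDomain {d : ℕ} (Ω : Set (Space d)) : Prop where
  isOpen : IsOpen Ω
  isConnected : IsConnected Ω
  isBounded : Bornology.IsBounded Ω
  lipschitz : HasLipschitzBoundary Ω
  flat : HasFlatBoundary Ω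

/-! ### Lebesgue and Sobolev spaces on the domain -/

/-- The Lebesgue measure on `Ω`. -/
abbrev vol {d : ℕ} (Ω : Set (Space d)) : Measure (Space d) := volume.restrict Ω

/-- `L²(Ω)`. -/
abbrev L2 {d : ℕ} (Ω : Set (Space d)) : Type := Lp ℝ 2 (vol Ω)

/-- `L²(Ω)ᵈ`. -/
abbrev L2Vec {d : ℕ} (Ω : Set (Space d)) : Type := Lp (Space d) 2 (vol Ω)

/-- `L²(Ω)ᵈˣᵈ`. -/
abbrev L2Mat {d : ℕ} (Ω : Set (Space d)) : Type := Lp (Mat d) 2 (vol Ω)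

/-- The partial derivative `∂ⱼ φ`. -/
def partialDeriv {d : ℕ} (j : Fin d) (φ : Space d → ℝ) (x : Space d) : ℝ :=
  fderiv ℝ φ x (EuclideanSpace.single j 1)

/-- Test functions, `φ ∈ C_c^∞(Ω)`. -/
structure IsTestFunction {d : ℕ} (Ω : Set (Space d)) (φ : Space d → ℝ) : Prop where
  smooth : ContDiff ℝ ∞ φ
  compact : HasCompactSupport φ
  subset : tsupport φ ⊆ Ω

/-- `G` is the weak gradient of `v` on `Ω`: `∫ vᵢ ∂ⱼφ = -∫ Gᵢⱼ φ` for all test functions. -/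
def IsWeakGradient {d : ℕ} (Ω : Set (Space d)) (v : L2Vec Ω) (G : L2Mat Ω) : Prop :=
  ∀ φ : Space d → ℝ, IsTestFunction Ω φ → ∀ i j : Fin d,
    ∫ x in Ω, v x i * partialDeriv j φ x = -∫ x in Ω, G x (i, j) * φ x

theorem continuous_partialDeriv {d : ℕ} {Ω : Set (Space d)} {φ : Space d → ℝ}
    (hφ : IsTestFunction Ω φ) (j : Fin d) : Continuous (partialDeriv j φ) :=
  (hφ.smooth.continuous_fderiv (by simp)).clm_apply continuous_const

theorem hasCompactSupport_partialDeriv {d : ℕ} {Ω : Set (Space d)} {φ : Space d → ℝ}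
    (hφ : IsTestFunction Ω φ) (j : Fin d) : HasCompactSupport (partialDeriv j φ) :=
  hφ.compact.fderiv_apply (𝕜 := ℝ) (EuclideanSpace.single j 1)

/-- Products of components of `L²` functions with continuous compactly supported functions are
integrable. -/
theorem integrable_coord_mul {d : ℕ} {ι : Type} [Fintype ι] {Ω : Set (Space d)}
    (f : Lp (EuclideanSpace ℝ ι) 2 (vol Ω)) (k : ι) {ψ : Space d → ℝ}
    (hψ : Continuous ψ) (hc : HasCompactSupport ψ) :
    Integrable (fun x => f x k * ψ x) (vol Ω) := by
  have h1 : MemLp (fun x => f x k) 2 (vol Ω) :=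
    (EuclideanSpace.proj (𝕜 := ℝ) k).comp_memLp' (Lp.memLp f)
  have h2 : MemLp ψ 2 (vol Ω) := (hψ.memLp_of_hasCompactSupport hc).restrict Ω
  exact h1.integrable_mul h2

/-- The Sobolev space `H¹(Ω)ᵈ`: pairs `(v, ∇v)` of a function in `L²(Ω)ᵈ` and its weak gradient in
`L²(Ω)ᵈˣᵈ`, with the norm `(‖v‖² + ‖∇v‖²)^(1/2)` inherited from the product. -/
def H1 {d : ℕ} (Ω : Set (Space d)) : Submodule ℝ (WithLp 2 (L2Vec Ω × L2Mat Ω)) where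
  carrier := {w | IsWeakGradient Ω w.fst w.snd}
  zero_mem' := by
    intro φ _ i j
    have h1 : ∫ x in Ω, (0 : L2Vec Ω) x i * partialDeriv j φ x = 0 := by
      rw [integral_congr_ae (g := fun _ => (0 : ℝ)) ?_]
      · simp
      · filter_upwards [Lp.coeFn_zero (Space d) 2 (vol Ω)] with x hx
        rw [hx]
        simp only [Pi.zero_apply, PiLp.zero_apply, zero_mul]
    have h2 : ∫ x in Ω, (0 : L2Mat Ω) x (i, j) * φ x = 0 := by
      rw [integral_congr_ae (g := fun _ => (0 : ℝ)) ?_]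
      · simp
      · filter_upwards [Lp.coeFn_zero (Mat d) 2 (vol Ω)] with x hx
        rw [hx]
        simp only [Pi.zero_apply, PiLp.zero_apply, zero_mul]
    exact h1.trans (by rw [← neg_zero, ← h2]; rfl)
  add_mem' := by
    intro a b ha hb φ hφ i j
    have hd := continuous_partialDeriv hφ j
    have hdc := hasCompactSupport_partialDeriv hφ j
    have hc := hφ.smooth.continuous
    have h1 : ∫ x in Ω, (a.fst + b.fst) x i * partialDeriv j φ x =
        (∫ x in Ω, a.fst x i * partialDeriv j φ x) +
          ∫ x in Ω, b.fst x i * partialDeriv j φ x := by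
      rw [← integral_add (integrable_coord_mul _ i hd hdc) (integrable_coord_mul _ i hd hdc)]
      refine integral_congr_ae ?_
      filter_upwards [Lp.coeFn_add a.fst b.fst] with x hx
      rw [hx]
      simp only [Pi.add_apply, PiLp.add_apply, add_mul]
    have h2 : ∫ x in Ω, (a.snd + b.snd) x (i, j) * φ x =
        (∫ x in Ω, a.snd x (i, j) * φ x) + ∫ x in Ω, b.snd x (i, j) * φ x := by
      rw [← integral_add (integrable_coord_mul _ _ hc hφ.compact)
        (integrable_coord_mul _ _ hc hφ.compact)]
      refine integral_congr_ae ?_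
      filter_upwards [Lp.coeFn_add a.snd b.snd] with x hx
      rw [hx]
      simp only [Pi.add_apply, PiLp.add_apply, add_mul]
    change ∫ x in Ω, (a.fst + b.fst) x i * partialDeriv j φ x =
      -∫ x in Ω, (a.snd + b.snd) x (i, j) * φ x
    rw [h1, h2, ha φ hφ i j, hb φ hφ i j]
    ring
  smul_mem' := by
    intro c a ha φ hφ i j
    have h1 : ∫ x in Ω, (c • a.fst) x i * partialDeriv j φ x =
        c * ∫ x in Ω, a.fst x i * partialDeriv j φ x := by
      rw [← integral_const_mul]
      refine integral_congr_ae ?_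
      filter_upwards [Lp.coeFn_smul c a.fst] with x hx
      rw [hx]
      simp only [Pi.smul_apply, PiLp.smul_apply, smul_eq_mul, mul_assoc]
    have h2 : ∫ x in Ω, (c • a.snd) x (i, j) * φ x =
        c * ∫ x in Ω, a.snd x (i, j) * φ x := by
      rw [← integral_const_mul]
      refine integral_congr_ae ?_
      filter_upwards [Lp.coeFn_smul c a.snd] with x hx
      rw [hx]
      simp only [Pi.smul_apply, PiLp.smul_apply, smul_eq_mul, mul_assoc]
    change ∫ x in Ω, (c • a.fst) x i * partialDeriv j φ x =
      -∫ x in Ω, (c • a.snd) x (i, j) * φ x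
    rw [h1, h2, ha φ hφ i j]
    ring

/-- The function underlying an element of `H¹(Ω)ᵈ`. -/
def val {d : ℕ} {Ω : Set (Space d)} (v : H1 Ω) : L2Vec Ω :=
  (v : WithLp 2 (L2Vec Ω × L2Mat Ω)).fst

/-- The weak gradient `∇v`. -/
def grad {d : ℕ} {Ω : Set (Space d)} (v : H1 Ω) : L2Mat Ω :=
  (v : WithLp 2 (L2Vec Ω × L2Mat Ω)).snd

/-- The trace of a matrix, `∑ᵢ Gᵢᵢ`. -/
def matTrace (d : ℕ) : Mat d →L[ℝ] ℝ := ∑ i : Fin d, EuclideanSpace.proj (i, i)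

/-- The divergence `∇·v`. -/
def divergence {d : ℕ} {Ω : Set (Space d)} (v : H1 Ω) : L2 Ω := (matTrace d).compLp (grad v)

/-- `Q = L²₀(Ω)`, the functions in `L²(Ω)` with mean value zero. -/
def L20 {d : ℕ} (Ω : Set (Space d)) : Set (L2 Ω) := {q | ∫ x in Ω, q x = 0}

/-! ### Boundary values -/

/-- The surface measure on `Γ = ∂Ω`: the `(d-1)`-dimensional Hausdorff measure. (In Mathlib's
normalization this is a positive constant, depending only on `d`, times the surface area.) -/
def surf {d : ℕ} (Ω : Set (Space d)) : Measure (Space d) :=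
  (Measure.hausdorffMeasure ((d : ℝ) - 1)).restrict (frontier Ω)

/-- `L²(Γ)ᵈ`. -/
abbrev L2Bdry {d : ℕ} (Ω : Set (Space d)) : Type := Lp (Space d) 2 (surf Ω)

/-- The classical gradient of a differentiable vector field. -/
def classicalGrad {d : ℕ} (φ : Space d → Space d) (x : Space d) : Mat d :=
  WithLp.toLp 2 fun ij => fderiv ℝ φ x (EuclideanSpace.single ij.2 1) ij.1

/-- `v|_Γ = g`: the trace operator is the continuous extension to `H¹(Ω)ᵈ` of the restriction
`φ ↦ φ|_Γ` of functions that are smooth up to the boundary. So `g` is the trace of `v` iff there are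
smooth `φₙ` with `φₙ → v` in `H¹(Ω)ᵈ` and `φₙ|_Γ → g` in `L²(Γ)ᵈ`. -/
def HasTrace {d : ℕ} {Ω : Set (Space d)} (v : H1 Ω) (g : L2Bdry Ω) : Prop :=
  ∃ φ : ℕ → Space d → Space d, (∀ n, ContDiff ℝ ∞ (φ n)) ∧
    Tendsto (fun n => eLpNorm (fun x => φ n x - val v x) 2 (vol Ω)) atTop (𝓝 0) ∧
    Tendsto (fun n => eLpNorm (fun x => classicalGrad (φ n) x - grad v x) 2 (vol Ω))
      atTop (𝓝 0) ∧
    Tendsto (fun n => eLpNorm (fun x => φ n x - g x) 2 (surf Ω)) atTop (𝓝 0)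

/-- The square of the Sobolev-Slobodeckij seminorm of `H^{1/2}(Γ)ᵈ`,
`∫_Γ ∫_Γ |g(x) - g(y)|² / |x - y|ᵈ`. -/
def slobodeckijSq {d : ℕ} {Ω : Set (Space d)} (g : L2Bdry Ω) : ℝ≥0∞ :=
  ∫⁻ x, ∫⁻ y, edist (g x) (g y) ^ 2 / edist x y ^ d ∂(surf Ω) ∂(surf Ω)

/-- The space `H^{1/2}(Γ)ᵈ`. -/
def HHalf {d : ℕ} (Ω : Set (Space d)) : Set (L2Bdry Ω) := {g | slobodeckijSq g < ⊤}

/-- The norm of `H^{1/2}(Γ)ᵈ`. -/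
def hHalfNorm {d : ℕ} {Ω : Set (Space d)} (g : L2Bdry Ω) : ℝ :=
  Real.sqrt (‖g‖ ^ 2 + (slobodeckijSq g).toReal)

/-! ### The Stokes problem and its discretization -/

/-- `(y, p) ∈ Y_* × Q` is a weak solution of the Stokes problem with boundary datum `u`, where
`Y_* = {v ∈ H¹(Ω)ᵈ : v|_Γ = u}`, `Y₀ = H¹₀(Ω)ᵈ = {v ∈ H¹(Ω)ᵈ : v|_Γ = 0}`. -/
structure IsWeakSolution {d : ℕ} {Ω : Set (Space d)} (u : L2Bdry Ω) (y : H1 Ω) (p : L2 Ω) :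
    Prop where
  boundary : HasTrace y u
  pressure : p ∈ L20 Ω
  momentum : ∀ v : H1 Ω, HasTrace v 0 →
    inner ℝ (grad y) (grad v) - inner ℝ (divergence v) p = 0
  mass : ∀ q ∈ L20 Ω, inner ℝ (divergence y) q = 0

/-- `Y_{0h} = {v_h ∈ Y_h : v_h|_Γ = 0}`. -/
def zeroSpace {d : ℕ} {Ω : Set (Space d)} (Yh : Submodule ℝ (H1 Ω)) : Set (H1 Ω) :=
  {v | v ∈ Yh ∧ HasTrace v 0}

/-- `Y_h^∂`, the traces of the functions in `Y_h`. -/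
def traceSpace {d : ℕ} {Ω : Set (Space d)} (Yh : Submodule ℝ (H1 Ω)) : Set (L2Bdry Ω) :=
  {g | ∃ v ∈ Yh, HasTrace v g}

/-- `Q̃_h = Q_h ⊕ P₀(Ω)`, where `P₀(Ω)` is the space of constant functions. -/
def augmentedSpace {d : ℕ} {Ω : Set (Space d)} (Qh : Submodule ℝ (L2 Ω)) : Set (L2 Ω) :=
  {q | ∃ r ∈ Qh, ∃ a : ℝ, ∀ᵐ x ∂(vol Ω), q x = r x + a}

/-- `(y_h, p_h) ∈ Y_{*h} × Q_h` is the discrete solution with discrete boundary datum `u_h`, where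
`Y_{*h} = {v_h ∈ Y_h : v_h|_Γ = u_h}`. -/
structure IsDiscreteSolution {d : ℕ} {Ω : Set (Space d)} (Yh : Submodule ℝ (H1 Ω))
    (Qh : Submodule ℝ (L2 Ω)) (uh : L2Bdry Ω) (yh : H1 Ω) (ph : L2 Ω) : Prop where
  mem : yh ∈ Yh
  boundary : HasTrace yh uh
  pressure : ph ∈ Qh
  momentum : ∀ v ∈ zeroSpace Yh,
    inner ℝ (grad yh) (grad v) - inner ℝ (divergence v) ph = 0
  mass : ∀ q ∈ Qh, inner ℝ (divergence yh) q = 0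

/-- The discrete inf-sup condition with constant `α`; the norm of `H¹₀(Ω)ᵈ` is `‖∇v‖`. -/
def DiscreteInfSup {d : ℕ} {Ω : Set (Space d)} (Yh : Submodule ℝ (H1 Ω))
    (Qh : Submodule ℝ (L2 Ω)) (α : ℝ) : Prop :=
  ∀ q ∈ Qh, α * ‖q‖ ≤
    sSup ((fun v : H1 Ω => inner ℝ (divergence v) q / ‖grad v‖) '' (zeroSpace Yh \ {0}))

/-- The discrete extension property with constant `c₁`. -/
def DiscreteExtension {d : ℕ} {Ω : Set (Space d)} (Yh : Submodule ℝ (H1 Ω)) (c₁ : ℝ) : Prop :=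
  ∀ g ∈ traceSpace Yh,
    sInf ((fun v : H1 Ω => ‖grad v‖) '' {v | v ∈ Yh ∧ HasTrace v g}) ≤ c₁ * hHalfNorm g

end

end StokesFEM

open StokesFEM

open StokesFEM

/-! The proof has a finite element part and an analytic part.

Finite element part. If `w ∈ Y_h` already has the boundary values `u_h`, then `y_h - w` is an
admissible discrete test function and the saddle point argument bounds the error by `‖∇(y - w)‖ + ‖p
- q‖` for every `q ∈ Q_h` (`norm_error_le`). The inf-sup condition and the difference of the
momentum equations control `p_h - q`. Testing with `y_h - w` controls `∇(y_h - w)`, because `∇·y`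
and `∇·y_h` are both orthogonal to `Q_h`. The flux of the data plays no role: only mean-zero
pressures are tested, so `∇·y` may be a nonzero constant. A general `v_h` is turned into such a `w`
by adding a discrete extension of `u_h - v_h|_Γ = (u - v_h|_Γ) - (u - u_h)`, where `u - v_h|_Γ` is
the trace of `y - v_h`. The constant part of the pressure approximation can be dropped, since `p`
and `Q_h` are orthogonal to constants.

Analytic part. What remains is the trace theorem from `H¹(Ω)ᵈ` to `H^{1/2}(Γ)ᵈ` on a Lipschitz
domain, including the existence of traces (`GraphCover.exists_hasTrace`,
`GraphCover.exists_hHalfNorm_trace_le`). Near the boundary `Ω` contains, over each boundary point, a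
truncated cone with directions in a fixed ball `W`. Two boundary points at horizontal distance `r`
are compared through common interior points at distance of order `r`, averaged over a ball
(`LocalGraph.volume_ball_mul_enorm_sub_sq_le`). In polar coordinates the kernel `|x - y|⁻ᵈ` and the
surface element `r^(d-2)` leave `∫ r⁻² |φ(x) - φ(x + r w)|² dr`. A Hardy inequality bounds this by
`∫ |∇φ(x + t w)|² dt` (`LocalGraph.exists_lintegral_quotient_le`), and integration over `x` and `t`
gives an integral over `Ω` with bounded Jacobian. The estimates are proved for smooth functions,
which are dense by a partition of unity and mollification with kernels shifted into `Ω`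
(`GraphCover.exists_smooth_approx`). They pass to the limit by Fatou's lemma. -/

/-! ### Local graph representations of the boundary -/

/-- A description of `Ω` in the open set `U` as the superlevel set `{0 < g}` of a Lipschitz function
`g` which increases with slope at least one along every direction in the ball
`closedBall (k • e) M`. -/
structure LocalGraph {d : ℕ} (Ω : Set (Space d)) where
  U : Set (Space d)
  e : Space d
  g : Space d → ℝ
  lip : ℝ≥0
  k : ℝ
  M : ℝ
  L : ℝ
  isOpen : IsOpen U
  norm_e : ‖e‖ = 1
  k_nonneg : 0 ≤ k
  L_nonneg : 0 ≤ L
  le_M : L / 2 + 1 ≤ M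
  lipschitz : LipschitzWith lip g
  mem_iff : ∀ z ∈ U, (z ∈ Ω ↔ 0 < g z)
  mono : ∀ w ∈ Metric.closedBall (k • e) M, ∀ (z : Space d) (t : ℝ), 0 ≤ t →
    g z + t ≤ g (z + t • w)
  one_le_inner : ∀ w ∈ Metric.closedBall (k • e) M, 1 ≤ inner ℝ e w
  norm_sub_le : ∀ x y, g x = 0 → g y = 0 →
    ‖x - y‖ ≤ L * ‖(x - y) - inner ℝ e (x - y) • e‖

theorem norm_sub_inner_smul_le {d : ℕ} {e : Space d} (he : ‖e‖ = 1) (z : Space d) :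
    ‖z - inner ℝ e z • e‖ ≤ ‖z‖ := by
  have h : ‖z - inner ℝ e z • e‖ ^ 2 = ‖z‖ ^ 2 - inner ℝ e z ^ 2 := by
    rw [norm_sub_sq_real, inner_smul_right, norm_smul, he, real_inner_comm]
    simp only [Real.norm_eq_abs, mul_one, sq_abs]
    ring
  nlinarith [norm_nonneg z, norm_nonneg (z - inner ℝ e z • e), sq_nonneg (inner ℝ e z)]

/-- The function `g` is the height above the graph, `⟪e, z⟫ - γ(z - ⟪e, z⟫ e)`. It increases along
every direction that is steep compared with the Lipschitz constant of `γ`, and on its zero set the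
vertical part of a difference is at most `κ` times the horizontal part, whence `L = 1 + κ`. -/
theorem StokesFEM.HasLipschitzBoundary.exists_localGraph {d : ℕ} {Ω : Set (Space d)}
    (h : HasLipschitzBoundary Ω) {x : Space d} (hx : x ∈ frontier Ω) :
    ∃ G : LocalGraph Ω, x ∈ G.U := by
  obtain ⟨U, e, γ, κ, hU, hxU, he, hγ, hmem⟩ := h x hx
  have hee : inner ℝ e e = (1 : ℝ) := by rw [real_inner_self_eq_norm_sq, he]; norm_num
  have hin : ∀ z : Space d, |inner ℝ e z| ≤ ‖z‖ := fun z => by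
    simpa [he] using abs_real_inner_le_norm e z
  have hγ' : ∀ a b : Space d, |γ a - γ b| ≤ κ * ‖a - b‖ := fun a b => by
    simpa [dist_eq_norm] using hγ.dist_le_mul a b
  have hκ : (0 : ℝ) ≤ κ := κ.2
  -- `M` is the smallest value allowed by `le_M`. In the ball of radius `M` around `k • e` the
  -- horizontal part of `w` is at most `M` and `⟪e, w⟫ ≥ k - M = 1 + κ M`, so `k` is chosen to make
  -- the slope `⟪e, w⟫ - κ M` at least one.
  set M : ℝ := (1 + κ) / 2 + 1 with hM
  set k : ℝ := 1 + (1 + κ) * M with hk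
  have hM0 : 0 ≤ M := by positivity
  have hk0 : 0 ≤ k := by positivity
  have hP : ∀ w ∈ Metric.closedBall (k • e) M, ‖w - inner ℝ e w • e‖ ≤ M := by
    intro w hw
    have h1 := norm_sub_inner_smul_le he (w - k • e)
    have h2 : w - k • e - inner ℝ e (w - k • e) • e = w - inner ℝ e w • e := by
      rw [inner_sub_right, inner_smul_right, hee]
      module
    rw [h2] at h1
    exact h1.trans (by simpa [dist_eq_norm] using hw)
  have hI : ∀ w ∈ Metric.closedBall (k • e) M, k - M ≤ inner ℝ e w := by
    intro w hw
    have h1 := hin (w - k • e)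
    rw [inner_sub_right, inner_smul_right, hee, mul_one] at h1
    have h2 : ‖w - k • e‖ ≤ M := by simpa [dist_eq_norm] using hw
    linarith [(abs_le.1 h1).1]
  refine ⟨⟨U, e, fun z => inner ℝ e z - γ (z - inner ℝ e z • e), 1 + κ, k, M, 1 + κ, hU, he, hk0,
    by positivity, le_rfl, ?_, ?_, ?_, ?_, ?_⟩, hxU⟩
  · refine LipschitzWith.of_dist_le_mul fun a b => ?_
    rw [Real.dist_eq, dist_eq_norm]
    have h1 := hin (a - b)
    have h2 := hγ' (a - inner ℝ e a • e) (b - inner ℝ e b • e)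
    have h3 : a - inner ℝ e a • e - (b - inner ℝ e b • e) =
        (a - b) - inner ℝ e (a - b) • e := by
      rw [inner_sub_right]; module
    rw [h3] at h2
    have h4 := mul_le_mul_of_nonneg_left (norm_sub_inner_smul_le he (a - b)) hκ
    rw [inner_sub_right] at h1
    push_cast
    rw [abs_le] at *
    constructor <;> linarith
  · intro z hz
    rw [hmem z hz, sub_pos]
  · intro w hw z t ht
    have h1 := hI w hw
    have h2 := hγ' (z + t • w - inner ℝ e (z + t • w) • e) (z - inner ℝ e z • e)
    have h3 : z + t • w - inner ℝ e (z + t • w) • e - (z - inner ℝ e z • e) =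
        t • (w - inner ℝ e w • e) := by
      rw [inner_add_right, inner_smul_right]; module
    rw [h3, norm_smul, Real.norm_of_nonneg ht] at h2
    have h4 : κ * (t * ‖w - inner ℝ e w • e‖) ≤ κ * (t * M) := by gcongr; exact hP w hw
    have h5 : t * (1 + κ * M) ≤ t * inner ℝ e w := by
      gcongr; rw [hk] at h1; linarith
    rw [inner_add_right, inner_smul_right] at *
    have := (abs_le.1 h2).2
    linarith
  · intro w hw
    have h1 := hI w hw
    rw [hk] at h1
    nlinarith [mul_nonneg hκ hM0]
  · intro a b ha hb
    have h2 := hγ' (a - inner ℝ e a • e) (b - inner ℝ e b • e)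
    have h3 : a - inner ℝ e a • e - (b - inner ℝ e b • e) =
        (a - b) - inner ℝ e (a - b) • e := by
      rw [inner_sub_right]; module
    rw [h3] at h2
    have h4 : inner ℝ e (a - b) = γ (a - inner ℝ e a • e) - γ (b - inner ℝ e b • e) := by
      rw [inner_sub_right]; linarith
    calc ‖a - b‖ = ‖((a - b) - inner ℝ e (a - b) • e) + inner ℝ e (a - b) • e‖ := by
          rw [sub_add_cancel]
      _ ≤ ‖(a - b) - inner ℝ e (a - b) • e‖ + ‖inner ℝ e (a - b) • e‖ := norm_add_le _ _
      _ ≤ ‖(a - b) - inner ℝ e (a - b) • e‖ + κ * ‖(a - b) - inner ℝ e (a - b) • e‖ := by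
          gcongr
          rw [← h4] at h2
          rwa [norm_smul, he, mul_one]
      _ = _ := by ring

/-! ### Admissible directions and the height of the boundary along them -/

namespace LocalGraph

variable {d : ℕ} {Ω : Set (Space d)} (G : LocalGraph Ω)

/-- The cone of admissible directions. -/
def W : Set (Space d) := Metric.closedBall (G.k • G.e) G.M

/-- The hyperplane over which the boundary is a graph. -/
noncomputable abbrev E : Submodule ℝ (Space d) := (Submodule.span ℝ {G.e})ᗮ

/-- The Haar measure on the hyperplane. -/
noncomputable def ν : Measure G.E := Measure.hausdorffMeasure ((d : ℝ) - 1)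

theorem one_le_M : 1 ≤ G.M := by linarith [G.le_M, G.L_nonneg]

theorem norm_le_of_mem_W {w : Space d} (hw : w ∈ G.W) : ‖w‖ ≤ G.k + G.M := by
  have h1 : ‖w - G.k • G.e‖ ≤ G.M := by simpa [W, dist_eq_norm] using hw
  have h2 : ‖G.k • G.e‖ = G.k := by
    rw [norm_smul, G.norm_e, mul_one, Real.norm_of_nonneg G.k_nonneg]
  calc ‖w‖ = ‖G.k • G.e + (w - G.k • G.e)‖ := by rw [add_sub_cancel]
    _ ≤ _ := (norm_add_le _ _).trans (by rw [h2]; gcongr)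

theorem center_mem_W : G.k • G.e ∈ G.W :=
  Metric.mem_closedBall_self (by linarith [G.one_le_M])

theorem continuous_g : Continuous G.g := G.lipschitz.continuous

theorem mem_E {z : Space d} : z ∈ G.E ↔ inner ℝ G.e z = 0 :=
  Submodule.mem_orthogonal_singleton_iff_inner_right

theorem e_ne_zero : G.e ≠ 0 := by
  intro h
  simpa [h] using G.norm_e

theorem finrank_E : Module.finrank ℝ G.E + 1 = d := by
  have h := Submodule.finrank_add_finrank_orthogonal (Submodule.span ℝ {G.e})
  rw [finrank_span_singleton G.e_ne_zero, finrank_euclideanSpace_fin, add_comm] at h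
  exact h

/-- The exponent `d - 1` is the dimension of the hyperplane, and Hausdorff measure of full dimension
is a Haar measure. -/
instance : (G.ν).IsAddHaarMeasure := by
  have h : ((d : ℝ) - 1) = (Module.finrank ℝ G.E : ℕ) := by
    have := congrArg (fun n : ℕ => (n : ℝ)) G.finrank_E
    push_cast at this
    linarith
  rw [ν, h]
  infer_instance

/-- The height over `z` of the boundary in the direction `w`. -/
theorem exists_height {w : Space d} (hw : w ∈ G.W) :
    ∃ τ : Space d → ℝ, LipschitzWith G.lip τ ∧ (∀ z, G.g (z + τ z • w) = 0) ∧
      ∀ z t, 0 < G.g (z + t • w) ↔ τ z < t := by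
  have hm : ∀ (z : Space d) (s t : ℝ), s ≤ t → G.g (z + s • w) + (t - s) ≤ G.g (z + t • w) := by
    intro z s t hst
    have := G.mono w hw (z + s • w) (t - s) (by linarith)
    rwa [add_assoc, ← add_smul, add_sub_cancel] at this
  have hex : ∀ z, ∃ t : ℝ, G.g (z + t • w) = 0 := by
    intro z
    have hc : Continuous fun t : ℝ => G.g (z + t • w) := G.continuous_g.comp (by fun_prop)
    have h0 : G.g (z + -|G.g z| • w) ≤ 0 := by
      have := hm z (-|G.g z|) 0 (by simp)
      simp only [zero_smul, add_zero] at this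
      linarith [le_abs_self (G.g z)]
    have h1 : 0 ≤ G.g (z + |G.g z| • w) := by
      have := hm z 0 (|G.g z|) (by simp)
      simp only [zero_smul, add_zero] at this
      linarith [neg_abs_le (G.g z)]
    exact mem_range_of_exists_le_of_exists_ge hc ⟨_, h0⟩ ⟨_, h1⟩
  choose τ hτ using hex
  -- If `τ z < τ z'`, then slope at least one forces `g ≤ -(τ z' - τ z)` at `z' + τ z • w`, whereas
  -- `g` vanishes at `z + τ z • w`. Hence `τ` inherits the Lipschitz constant of `g`.
  have key : ∀ z z', τ z' - τ z ≤ G.lip * dist z z' := by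
    intro z z'
    rcases le_total (τ z') (τ z) with h | h
    · have : 0 ≤ G.lip * dist z z' := by positivity
      linarith
    · have h1 := hm z' (τ z) (τ z') h
      have h2 := G.lipschitz.dist_le_mul (z' + τ z • w) (z + τ z • w)
      rw [hτ z, dist_add_right, Real.dist_eq, sub_zero, dist_comm] at h2
      rw [hτ z'] at h1
      linarith [neg_abs_le (G.g (z' + τ z • w))]
  refine ⟨τ, LipschitzWith.of_dist_le_mul fun z z' => ?_, hτ, fun z t => ⟨fun h => ?_, fun h => ?_⟩⟩
  · rw [Real.dist_eq, abs_le]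
    constructor
    · linarith [key z z']
    · have := key z' z
      rw [dist_comm] at this
      linarith
  · by_contra! h'
    have := hm z t (τ z) h'
    rw [hτ z] at this
    linarith
  · have := hm z (τ z) t h.le
    rw [hτ z] at this
    linarith

/-- A boundary point is not in the open set `Ω`, so `g ≤ 0` there, while `g < 0` would persist on a
neighbourhood and keep the point out of the closure. -/
theorem frontier_inter_subset (hΩ : IsOpen Ω) {z : Space d} (hz : z ∈ frontier Ω) (hU : z ∈ G.U) :
    G.g z = 0 := by
  rw [hΩ.frontier_eq] at hz
  have h1 : ¬ 0 < G.g z := fun h => hz.2 ((G.mem_iff z hU).2 h)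
  by_contra h2
  have h3 : G.g z < 0 := lt_of_le_of_ne (not_lt.1 h1) h2
  obtain ⟨y, ⟨hy1, hy2⟩, hy3⟩ := mem_closure_iff.1 hz.1 (G.U ∩ {z | G.g z < 0})
    (G.isOpen.inter (isOpen_lt G.continuous_g continuous_const)) ⟨hU, h3⟩
  have := (G.mem_iff y hy1).1 hy3
  simp only [Set.mem_ofPred_eq] at hy2
  linarith

end LocalGraph

/-! ### Surface measure and oblique coordinates -/

namespace LocalGraph

variable {d : ℕ} {Ω : Set (Space d)} (G : LocalGraph Ω)

/-- The projection onto the hyperplane along `w`. -/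
noncomputable def proj {w : Space d} (hw : w ∈ G.W) : Space d →L[ℝ] G.E :=
  (ContinuousLinearMap.id ℝ (Space d) -
    (innerSL ℝ G.e).smulRight ((inner ℝ G.e w)⁻¹ • w)).codRestrict G.E fun z => by
      have h : inner ℝ G.e w ≠ (0 : ℝ) := by linarith [G.one_le_inner w hw]
      rw [mem_E]
      simp [inner_sub_right, inner_smul_right, h]

theorem coe_proj {w : Space d} (hw : w ∈ G.W) (z : Space d) :
    (G.proj hw z : Space d) = z - (inner ℝ G.e z * (inner ℝ G.e w)⁻¹) • w := by
  simp [proj, mul_smul]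

theorem proj_add_smul {w : Space d} (hw : w ∈ G.W) (x : G.E) (t : ℝ) :
    G.proj hw (x + t • w) = x := by
  have h : inner ℝ G.e w ≠ (0 : ℝ) := by linarith [G.one_le_inner w hw]
  have hx := G.mem_E.1 x.2
  ext1
  rw [coe_proj, inner_add_right, inner_smul_right, hx, zero_add, mul_assoc, mul_inv_cancel₀ h,
    mul_one, add_sub_cancel_right]

/-- The factor between the surface measure and the measure on the hyperplane. -/
noncomputable def surfConst : ℝ≥0∞ :=
  (((1 + G.lip * (G.k + G.M).toNNReal : ℝ≥0) : ℝ≥0∞)) ^ ((d : ℝ) - 1)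

theorem dim_sub_one_nonneg (G : LocalGraph Ω) : (0 : ℝ) ≤ (d : ℝ) - 1 := by
  have := congrArg (fun n : ℕ => (n : ℝ)) G.finrank_E
  push_cast at this
  linarith [Nat.cast_nonneg (α := ℝ) (Module.finrank ℝ G.E)]

theorem surfConst_ne_top : G.surfConst ≠ ⊤ :=
  ENNReal.rpow_ne_top_of_nonneg G.dim_sub_one_nonneg ENNReal.coe_ne_top

theorem lipschitz_graph {w : Space d} (hw : w ∈ G.W) {τ : Space d → ℝ}
    (hτ : LipschitzWith G.lip τ) :
    LipschitzWith (1 + G.lip * (G.k + G.M).toNNReal) fun x : G.E => (x : Space d) + τ x • w := by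
  refine LipschitzWith.of_dist_le_mul fun x y => ?_
  have h1 := G.norm_le_of_mem_W hw
  have h2 := hτ.dist_le_mul x y
  have h3 : 0 ≤ G.k + G.M := (norm_nonneg w).trans h1
  rw [dist_eq_norm, Real.norm_eq_abs] at h2
  have h4 : (x : Space d) + τ x • w - (y + τ y • w) = (x - y : Space d) + (τ x - τ y) • w := by
    module
  rw [dist_eq_norm, h4]
  refine (norm_add_le _ _).trans ?_
  rw [norm_smul, Real.norm_eq_abs]
  push_cast
  rw [Real.coe_toNNReal _ h3]
  have h5 : dist (x : Space d) y = dist x y := rfl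
  rw [h5] at h2
  calc ‖(x - y : Space d)‖ + |τ x - τ y| * ‖w‖
      ≤ dist x y + G.lip * dist x y * (G.k + G.M) := by
        gcongr
        rw [← dist_eq_norm]; rfl
    _ = _ := by ring

/-- Strict monotonicity of `g` along `w` makes its zero set the graph of `τ` over the hyperplane. A
Lipschitz map enlarges Hausdorff measure by at most a power of its constant; only this upper bound
is needed, so no area formula enters. -/
theorem surface_le_map {w : Space d} (hw : w ∈ G.W) {τ : Space d → ℝ}
    (hτ : LipschitzWith G.lip τ) (hg : ∀ z, G.g (z + τ z • w) = 0)
    (hpos : ∀ z t, 0 < G.g (z + t • w) ↔ τ z < t) :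
    (Measure.hausdorffMeasure ((d : ℝ) - 1)).restrict {z | G.g z = 0} ≤
      G.surfConst • Measure.map (fun x : G.E => (x : Space d) + τ x • w) G.ν := by
  have hL := G.lipschitz_graph hw hτ
  refine Measure.le_iff.2 fun A hA => ?_
  rw [Measure.restrict_apply hA, Measure.smul_apply, Measure.map_apply hL.continuous.measurable hA]
  have hsub : A ∩ {z | G.g z = 0} ⊆ (fun x : G.E => (x : Space d) + τ x • w) ''
      ((fun x : G.E => (x : Space d) + τ x • w) ⁻¹' A) := by
    rintro z ⟨hzA, hz : G.g z = 0⟩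
    have key : (G.proj hw z : Space d) + τ (G.proj hw z) • w = z := by
      set s := inner ℝ G.e z * (inner ℝ G.e w)⁻¹ with hs
      have h1 : (G.proj hw z : Space d) + s • w = z := by rw [coe_proj, sub_add_cancel]
      have h2 : ¬ τ (G.proj hw z) < s := by
        rw [← hpos, h1, hz]; exact lt_irrefl _
      have h3 : ¬ s < τ (G.proj hw z) := by
        intro h
        have := G.mono w hw ((G.proj hw z : Space d) + s • w) (τ (G.proj hw z) - s) (by linarith)
        rw [add_assoc, ← add_smul, add_sub_cancel, hg, h1, hz] at this
        linarith
      rw [le_antisymm (not_lt.1 h3) (not_lt.1 h2)]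
      exact h1
    exact ⟨G.proj hw z, by simpa only [Set.mem_preimage, key] using hzA, key⟩
  refine (measure_mono hsub).trans ?_
  exact hL.hausdorffMeasure_image_le G.dim_sub_one_nonneg _

/-- Oblique coordinates over the hyperplane. -/
theorem exists_map_oblique :
    ∃ c : ℝ≥0∞, c ≠ 0 ∧ c ≠ ⊤ ∧ ∀ w ∈ G.W,
      Measure.map (fun x : G.E × ℝ => (x.1 : Space d) + x.2 • w) (G.ν.prod volume) =
        (ENNReal.ofReal (inner ℝ G.e w)⁻¹ * c) • (volume : Measure (Space d)) := by
  have hee : inner ℝ G.e G.e = (1 : ℝ) := by rw [real_inner_self_eq_norm_sq, G.norm_e]; norm_num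
  let Φ : (G.E × ℝ) ≃ₗ[ℝ] Space d :=
    { toFun := fun x => (x.1 : Space d) + x.2 • G.e
      map_add' := fun x y => by simp [add_smul]; abel
      map_smul' := fun c x => by simp [mul_smul]
      invFun := fun z => (⟨z - inner ℝ G.e z • G.e, by
        rw [mem_E, inner_sub_right, inner_smul_right, hee]; ring⟩, inner ℝ G.e z)
      left_inv := fun x => by
        have hx := G.mem_E.1 x.1.2
        ext1
        · ext1
          simp [inner_add_right, inner_smul_right, hx, G.norm_e]
        · simp [inner_add_right, inner_smul_right, hx, G.norm_e]
      right_inv := fun z => by simp }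
  let Ψ : (G.E × ℝ) ≃L[ℝ] Space d := Φ.toContinuousLinearEquiv
  have hΨ : ∀ x, Ψ x = (x.1 : Space d) + x.2 • G.e := fun x => rfl
  have hH : (Measure.map Ψ (G.ν.prod volume)).IsAddHaarMeasure := Ψ.isAddHaarMeasure_map _
  obtain ⟨c, hc, h0, hcm⟩ : ∃ c : ℝ≥0∞, c ≠ ⊤ ∧ c ≠ 0 ∧
      Measure.map Ψ (G.ν.prod volume) = c • (volume : Measure (Space d)) := by
    exact ⟨_, ENNReal.coe_ne_top, by simpa using (Measure.addHaarScalarFactor_pos_of_isAddHaarMeasure _ _).ne', Measure.isAddLeftInvariant_eq_smul (Measure.map Ψ (G.ν.prod volume)) volume⟩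
  refine ⟨c, h0, hc, fun w hw => ?_⟩
  have hpos : 1 ≤ inner ℝ G.e w := G.one_le_inner w hw
  -- The map `z ↦ z + ⟪e, z⟫ (w - e)` fixes the hyperplane and sends `e` to `w`. It carries the
  -- orthogonal coordinates, whose constant `c` does not involve `w`, to the oblique ones, and its
  -- determinant is `⟪e, w⟫`.
  set T : Space d →ₗ[ℝ] Space d :=
    LinearMap.transvection (innerSL ℝ G.e : Space d →L[ℝ] ℝ).toLinearMap (w - G.e) with hT
  have hdet : LinearMap.det T = inner ℝ G.e w := by
    rw [hT, LinearMap.transvection.det]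
    simp [inner_sub_right, G.norm_e]
  have hcomp : (fun x : G.E × ℝ => (x.1 : Space d) + x.2 • w) = T ∘ Ψ := by
    funext x
    have hx := G.mem_E.1 x.1.2
    simp only [Function.comp, hΨ, hT, LinearMap.transvection.apply]
    simp [inner_add_right, inner_smul_right, hx, G.norm_e]
    module
  have hTm : Measurable T := T.continuous_of_finiteDimensional.measurable
  rw [hcomp, ← Measure.map_map hTm Ψ.continuous.measurable, hcm, Measure.map_smul,
    Measure.map_linearMap_addHaar_eq_smul_addHaar _ (by rw [hdet]; linarith), hdet, smul_smul,
    abs_of_nonneg (by positivity), mul_comm]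

end LocalGraph

/-- Integration of radial functions in polar coordinates. -/
theorem lintegral_comp_norm_addHaar {E : Type*} [NormedAddCommGroup E] [NormedSpace ℝ E]
    [Nontrivial E] [MeasurableSpace E] [BorelSpace E] [FiniteDimensional ℝ E] (μ : Measure E)
    [μ.IsAddHaarMeasure] {f : ℝ → ℝ≥0∞} (hf : Measurable f) :
    ∫⁻ x, f ‖x‖ ∂μ = μ.toSphere Set.univ *
      ∫⁻ r in Set.Ioi (0 : ℝ), ENNReal.ofReal (r ^ (Module.finrank ℝ E - 1)) * f r := by
  have hmp := μ.measurePreserving_homeomorphUnitSphereProd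
  have h0 : ∫⁻ x, f ‖x‖ ∂μ = ∫⁻ x in ({0}ᶜ : Set E), f ‖x‖ ∂μ := by
    rw [restrict_compl_singleton]
  rw [h0, ← lintegral_subtype_comap (measurableSet_singleton _).compl]
  have h1 := hmp.lintegral_comp (f := fun p => f (p.2 : ℝ))
    (hf.comp (measurable_subtype_coe.comp measurable_snd))
  simp only [homeomorphUnitSphereProd_apply_snd_coe] at h1
  have h2 : ∫⁻ r, f (r : ℝ) ∂(Measure.volumeIoiPow (Module.finrank ℝ E - 1)) =
      ∫⁻ r in Set.Ioi (0 : ℝ), ENNReal.ofReal (r ^ (Module.finrank ℝ E - 1)) * f r := by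
    have h4 : Measurable fun r : Set.Ioi (0 : ℝ) =>
        ENNReal.ofReal ((r : ℝ) ^ (Module.finrank ℝ E - 1)) := by fun_prop
    have h5 : Measurable fun r : Set.Ioi (0 : ℝ) => f (r : ℝ) := hf.comp measurable_subtype_coe
    rw [Measure.volumeIoiPow, lintegral_withDensity_eq_lintegral_mul _ h4 h5,
      ← lintegral_subtype_comap measurableSet_Ioi]
    rfl
  have h3 : Measurable fun p : Metric.sphere (0 : E) 1 × Set.Ioi (0 : ℝ) => f (p.2 : ℝ) :=
    hf.comp (measurable_subtype_coe.comp measurable_snd)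
  rw [h1, lintegral_prod _ h3.aemeasurable]
  dsimp only
  rw [lintegral_const, h2, mul_comm]

/-! ### Integrals over the boundary along slices and in polar coordinates -/

namespace LocalGraph

variable {d : ℕ} {Ω : Set (Space d)} (G : LocalGraph Ω)

/-- The surface measure of the level set `{g = 0}`. -/
noncomputable def surface : Measure (Space d) :=
  (Measure.hausdorffMeasure ((d : ℝ) - 1)).restrict {z | G.g z = 0}

/-- Points `x + t • w` over the graph are oblique coordinates shifted by the height `τ`, and the
shift disappears once `t` runs over the whole line. The Jacobian `⟪e, w⟫⁻¹` is at most one, which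
makes `C` uniform in `w`, as needed for the later integration over all directions. -/
theorem exists_lintegral_slices_le :
    ∃ C : ℝ≥0∞, C ≠ ⊤ ∧ ∀ w ∈ G.W, ∀ F : Space d → ℝ≥0∞, Measurable F →
      ∫⁻ x, (∫⁻ t in Set.Ioi (0 : ℝ), F (x + t • w)) ∂G.surface ≤ C * ∫⁻ z, F z := by
  obtain ⟨c, -, hc, hmap⟩ := G.exists_map_oblique
  refine ⟨G.surfConst * c, ENNReal.mul_ne_top G.surfConst_ne_top hc, fun w hw F hF => ?_⟩
  obtain ⟨τ, hτ, hg, hpos⟩ := G.exists_height hw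
  have hm : Measurable fun x : Space d => ∫⁻ t in Set.Ioi (0 : ℝ), F (x + t • w) :=
    Measurable.lintegral_prod_right' (f := fun p : Space d × ℝ => F (p.1 + p.2 • w))
      (hF.comp (by fun_prop))
  have hL := G.lipschitz_graph hw hτ
  have hm2 : Measurable fun p : G.E × ℝ => (p.1 : Space d) + p.2 • w := by fun_prop
  calc ∫⁻ x, (∫⁻ t in Set.Ioi (0 : ℝ), F (x + t • w)) ∂G.surface
      ≤ ∫⁻ x, (∫⁻ t in Set.Ioi (0 : ℝ), F (x + t • w))
          ∂(G.surfConst • Measure.map (fun x : G.E => (x : Space d) + τ x • w) G.ν) :=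
        lintegral_mono' (G.surface_le_map hw hτ hg hpos) le_rfl
    _ = G.surfConst * ∫⁻ x : G.E, (∫⁻ t in Set.Ioi (0 : ℝ), F (x + τ x • w + t • w)) ∂G.ν := by
        rw [lintegral_smul_measure, lintegral_map hm hL.continuous.measurable, smul_eq_mul]
    _ ≤ G.surfConst * ∫⁻ x : G.E, (∫⁻ t : ℝ, F (x + t • w)) ∂G.ν := by
        gcongr 1
        refine lintegral_mono fun x => ?_
        refine (setLIntegral_le_lintegral _ _).trans_eq ?_
        rw [← lintegral_add_left_eq_self (fun t : ℝ => F (x + t • w)) (τ x)]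
        simp only [add_smul, add_assoc]
    _ = G.surfConst * ∫⁻ z, F z
          ∂(Measure.map (fun x : G.E × ℝ => (x.1 : Space d) + x.2 • w) (G.ν.prod volume)) := by
        rw [lintegral_map hF hm2,
          lintegral_prod (fun p : G.E × ℝ => F ((p.1 : Space d) + p.2 • w)) (hF.comp hm2).aemeasurable]
    _ = G.surfConst * (ENNReal.ofReal (inner ℝ G.e w)⁻¹ * c * ∫⁻ z, F z) := by
        rw [hmap w hw, lintegral_smul_measure, smul_eq_mul]
    _ ≤ G.surfConst * (1 * c * ∫⁻ z, F z) := by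
        gcongr
        rw [ENNReal.ofReal_le_one]
        exact inv_le_one_of_one_le₀ (G.one_le_inner w hw)
    _ = _ := by rw [one_mul, mul_assoc]

/-- Radial integrals over the boundary around one of its points, where the distance is measured in
the hyperplane. -/
theorem exists_lintegral_radial_le (hd : 2 ≤ d) :
    ∃ C : ℝ≥0∞, C ≠ ⊤ ∧ ∀ f : ℝ → ℝ≥0∞, Measurable f → ∀ x : Space d,
      ∫⁻ y, f ‖(y - x) - inner ℝ G.e (y - x) • G.e‖ ∂G.surface ≤
        C * ∫⁻ r in Set.Ioi (0 : ℝ), ENNReal.ofReal (r ^ (d - 2)) * f r := by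
  have hfr := G.finrank_E
  have : Nontrivial G.E := Module.nontrivial_of_finrank_pos (R := ℝ) (by omega)
  refine ⟨G.surfConst * G.ν.toSphere Set.univ,
    ENNReal.mul_ne_top G.surfConst_ne_top (measure_ne_top _ _), fun f hf x => ?_⟩
  -- The central direction is vertical, so the graph map over it leaves the horizontal coordinate
  -- unchanged and the integrand becomes radial on the hyperplane.
  have hw := G.center_mem_W
  obtain ⟨τ, hτ, hg, hpos⟩ := G.exists_height hw
  have hL := G.lipschitz_graph hw hτ
  have hee : inner ℝ G.e G.e = (1 : ℝ) := by rw [real_inner_self_eq_norm_sq, G.norm_e]; norm_num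
  let x' : G.E := ⟨x - inner ℝ G.e x • G.e, by
        rw [mem_E, inner_sub_right, inner_smul_right, hee]; ring⟩
  have hm : Measurable fun y => f ‖(y - x) - inner ℝ G.e (y - x) • G.e‖ := hf.comp (by fun_prop)
  calc ∫⁻ y, f ‖(y - x) - inner ℝ G.e (y - x) • G.e‖ ∂G.surface
      ≤ ∫⁻ y, f ‖(y - x) - inner ℝ G.e (y - x) • G.e‖
          ∂(G.surfConst • Measure.map (fun x : G.E => (x : Space d) + τ x • (G.k • G.e)) G.ν) :=
        lintegral_mono' (G.surface_le_map hw hτ hg hpos) le_rfl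
    _ = G.surfConst * ∫⁻ y : G.E, f ‖y - x'‖ ∂G.ν := by
        rw [lintegral_smul_measure, lintegral_map hm hL.continuous.measurable, smul_eq_mul]
        congr 2 with y
        congr 1
        have hy := G.mem_E.1 y.2
        have : ((y - x' : G.E) : Space d) = y - (x - inner ℝ G.e x • G.e) := rfl
        rw [Submodule.coe_norm, this]
        congr 1
        simp only [inner_sub_right, inner_add_right, inner_smul_right, hy, hee]
        module
    _ = G.surfConst * ∫⁻ y : G.E, f ‖y‖ ∂G.ν := by
        rw [lintegral_sub_right_eq_self (fun y : G.E => f ‖y‖) x']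
    _ = _ := by
        rw [lintegral_comp_norm_addHaar G.ν hf, mul_assoc]
        congr 5 with r
        congr 3
        omega

end LocalGraph

/-! ### Local trace inequalities -/

theorem enorm_sub_sq_le {E : Type*} [SeminormedAddCommGroup E] (a b c : E) :
    ‖a - b‖ₑ ^ 2 ≤ 2 * ‖a - c‖ₑ ^ 2 + 2 * ‖b - c‖ₑ ^ 2 := by
  have h1 : ‖a - b‖ₑ ≤ ‖a - c‖ₑ + ‖b - c‖ₑ := by
    rw [← edist_eq_enorm_sub, ← edist_eq_enorm_sub, ← edist_eq_enorm_sub, edist_comm b c]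
    exact edist_triangle _ _ _
  calc ‖a - b‖ₑ ^ 2 ≤ (‖a - c‖ₑ + ‖b - c‖ₑ) ^ 2 := by gcongr
    _ ≤ 2 ^ (2 - 1) * (‖a - c‖ₑ ^ 2 + ‖b - c‖ₑ ^ 2) := by
        simpa using ENNReal.rpow_add_le_mul_rpow_add_rpow ‖a - c‖ₑ ‖b - c‖ₑ (p := 2) (by norm_num) |>.trans
          (le_of_eq (by norm_num))
    _ = _ := by norm_num [mul_add]

/-- The integral `∫₀¹ s^(-1/2) ds`. -/
noncomputable def invSqrtIntegral : ℝ≥0∞ :=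
  ∫⁻ s in Set.Ioo (0 : ℝ) 1, ENNReal.ofReal (s ^ (-(1 / 2) : ℝ))

theorem invSqrtIntegral_ne_top : invSqrtIntegral ≠ ⊤ := by
  have h : IntegrableOn (fun s : ℝ => s ^ (-(1 / 2) : ℝ)) (Set.Ioo 0 1) := by
    rw [← integrableOn_Ioc_iff_integrableOn_Ioo, ← intervalIntegrable_iff_integrableOn_Ioc_of_le (by norm_num)]
    exact intervalIntegral.intervalIntegrable_rpow' (by norm_num)
  exact h.lintegral_lt_top.ne

/-- The Cauchy-Schwarz inequality with the weight `s^(1/2)`. -/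
theorem sq_lintegral_le_weighted {f : ℝ → ℝ≥0∞} (hf : Measurable f) :
    (∫⁻ s in Set.Ioo (0 : ℝ) 1, f s) ^ 2 ≤
      invSqrtIntegral * ∫⁻ s in Set.Ioo (0 : ℝ) 1, ENNReal.ofReal (s ^ (1 / 2 : ℝ)) * f s ^ 2 := by
  have h1 : ∫⁻ s in Set.Ioo (0 : ℝ) 1, f s = ∫⁻ s in Set.Ioo (0 : ℝ) 1,
      ((fun s : ℝ => ENNReal.ofReal (s ^ (-(1 / 4) : ℝ))) *
        fun s : ℝ => ENNReal.ofReal (s ^ (1 / 4 : ℝ)) * f s) s := by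
    refine setLIntegral_congr_fun measurableSet_Ioo fun s hs => ?_
    simp only [Pi.mul_apply]
    rw [← mul_assoc, ← ENNReal.ofReal_mul (by have := hs.1; positivity), ← Real.rpow_add hs.1]
    norm_num
  have h2 := ENNReal.lintegral_mul_le_Lp_mul_Lq (volume.restrict (Set.Ioo (0 : ℝ) 1))
    Real.HolderConjugate.two_two (f := fun s : ℝ => ENNReal.ofReal (s ^ (-(1 / 4) : ℝ)))
    (g := fun s : ℝ => ENNReal.ofReal (s ^ (1 / 4 : ℝ)) * f s)
    (by fun_prop) (by fun_prop)
  have h3 : ∀ a : ℝ≥0∞, (a ^ (1 / 2 : ℝ)) ^ 2 = a := fun a => by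
    rw [← ENNReal.rpow_natCast, ← ENNReal.rpow_mul]; norm_num
  rw [h1]
  refine (pow_le_pow_left₀ zero_le h2 2).trans_eq ?_
  rw [mul_pow, h3, h3, invSqrtIntegral]
  congr 1
  · refine setLIntegral_congr_fun measurableSet_Ioo fun s hs => ?_
    rw [ENNReal.ofReal_rpow_of_nonneg (by have := hs.1; positivity) (by norm_num),
      ← Real.rpow_mul hs.1.le]
    norm_num
  · refine setLIntegral_congr_fun measurableSet_Ioo fun s hs => ?_
    rw [ENNReal.mul_rpow_of_nonneg _ _ (by norm_num),
      ENNReal.ofReal_rpow_of_nonneg (by have := hs.1; positivity) (by norm_num),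
      ← Real.rpow_mul hs.1.le]
    norm_num

/-- The substitution `t = s r` has Jacobian `s⁻¹` and maps `(0, R)` into itself because `s < 1`. -/
theorem lintegral_Ioo_comp_mul_le {F : ℝ → ℝ≥0∞} (hF : Measurable F) {s R : ℝ}
    (hs : s ∈ Set.Ioo (0 : ℝ) 1) :
    ∫⁻ r in Set.Ioo 0 R, F (s * r) ≤ ENNReal.ofReal s⁻¹ * ∫⁻ t in Set.Ioo 0 R, F t := by
  have h0 : 0 < s := hs.1
  calc ∫⁻ r in Set.Ioo 0 R, F (s * r)
      ≤ ∫⁻ r, (Set.Ioo 0 R).indicator F (s * r) := by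
        rw [← lintegral_indicator measurableSet_Ioo]
        refine lintegral_mono fun r => ?_
        by_cases hr : r ∈ Set.Ioo 0 R
        · have : s * r ∈ Set.Ioo 0 R := ⟨mul_pos h0 hr.1, by nlinarith [hr.1, hr.2, hs.2]⟩
          simp [Set.indicator_of_mem hr, Set.indicator_of_mem this]
        · simp [Set.indicator_of_notMem hr]
    _ = ∫⁻ t, (Set.Ioo 0 R).indicator F t ∂(Measure.map (fun r => s * r) volume) := by
        rw [lintegral_map (hF.indicator measurableSet_Ioo) (by fun_prop)]
    _ = _ := by
        rw [Real.map_volume_mul_left h0.ne', lintegral_smul_measure, smul_eq_mul,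
          lintegral_indicator measurableSet_Ioo, abs_of_pos (by positivity)]

/-- This is the fundamental theorem of calculus on the segment from `x` to `x + v`. -/
theorem enorm_sub_le_lintegral_fderiv {E F : Type*} [NormedAddCommGroup E] [NormedSpace ℝ E]
    [NormedAddCommGroup F] [NormedSpace ℝ F] [CompleteSpace F] {φ : E → F} (hφ : ContDiff ℝ 1 φ)
    (x v : E) :
    ‖φ x - φ (x + v)‖ₑ ≤ ‖v‖ₑ * ∫⁻ s in Set.Ioo (0 : ℝ) 1, ‖fderiv ℝ φ (x + s • v)‖ₑ := by
  have hd : ∀ s : ℝ, HasDerivAt (fun s : ℝ => φ (x + s • v)) (fderiv ℝ φ (x + s • v) v) s := by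
    intro s
    have e1 : HasDerivAt (fun s : ℝ => x + s • v) v s := by
      simpa using ((hasDerivAt_id s).smul_const v).const_add x
    exact ((hφ.differentiable (by simp)) _).hasFDerivAt.comp_hasDerivAt s e1
  have hc : Continuous fun s : ℝ => fderiv ℝ φ (x + s • v) v :=
    ((hφ.continuous_fderiv (by simp)).comp (by fun_prop)).clm_apply continuous_const
  have h1 := intervalIntegral.integral_eq_sub_of_hasDerivAt (a := 0) (b := 1)
    (fun s _ => hd s) (hc.intervalIntegrable _ _)
  simp only [one_smul, zero_smul, add_zero] at h1
  rw [← edist_eq_enorm_sub, edist_comm, edist_eq_enorm_sub, ← h1,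
    intervalIntegral.integral_of_le (by norm_num)]
  refine (enorm_integral_le_lintegral_enorm _).trans ?_
  rw [setLIntegral_congr Ioo_ae_eq_Ioc.symm,
    ← lintegral_const_mul' _ _ enorm_ne_top]
  refine lintegral_mono fun s => ?_
  rw [mul_comm]
  exact ContinuousLinearMap.le_opENorm _ _

/-! ### Cones over boundary points and the Hardy inequality -/

namespace LocalGraph

variable {d : ℕ} {Ω : Set (Space d)} (G : LocalGraph Ω)

/-- A bounded set `B` of diameter less than `R` over whose boundary points the truncated cones of
height `R` lie in `Ω`. -/
structure Adapted (B : Set (Space d)) (R : ℝ) : Prop where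
  pos : 0 < R
  measurable : MeasurableSet B
  dist_lt : ∀ x ∈ B, ∀ y ∈ B, dist x y < R
  cone : ∀ x ∈ B, G.g x = 0 → ∀ w ∈ G.W, ∀ t ∈ Set.Ioo 0 R, x + t • w ∈ Ω

theorem exists_adapted {x₀ : Space d} (hx : x₀ ∈ G.U) :
    ∃ δ > 0, Metric.ball x₀ δ ⊆ G.U ∧ G.Adapted (Metric.ball x₀ δ) (2 * δ) := by
  obtain ⟨ρ, hρ, hball⟩ := Metric.isOpen_iff.1 G.isOpen x₀ hx
  have hN : 0 ≤ G.k + G.M := by linarith [G.k_nonneg, G.one_le_M]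
  -- A point of the cone of height `2δ` over the ball is at distance less than `δ + 2δ (k + M) = ρ`
  -- from `x₀`, so it stays in `U`.
  set δ : ℝ := ρ / (1 + 2 * (G.k + G.M)) with hδ
  have hδ0 : 0 < δ := by positivity
  have hδρ : δ * (1 + 2 * (G.k + G.M)) = ρ := by rw [hδ]; field_simp
  refine ⟨δ, hδ0, (Metric.ball_subset_ball (by nlinarith)).trans hball, by linarith,
    measurableSet_ball, fun x hx y hy => ?_, fun x hx hg w hw t ht => ?_⟩
  · have := dist_triangle_right x y x₀
    rw [Metric.mem_ball] at hx hy
    linarith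
  · have hU : x + t • w ∈ G.U := by
      refine hball ?_
      rw [Metric.mem_ball] at hx ⊢
      have h1 : dist (x + t • w) x ≤ t * (G.k + G.M) := by
        rw [dist_eq_norm, add_sub_cancel_left, norm_smul, Real.norm_of_nonneg ht.1.le]
        exact mul_le_mul_of_nonneg_left (G.norm_le_of_mem_W hw) ht.1.le
      have h2 : t * (G.k + G.M) ≤ 2 * δ * (G.k + G.M) :=
        mul_le_mul_of_nonneg_right ht.2.le hN
      have := dist_triangle (x + t • w) x x₀
      nlinarith
    rw [G.mem_iff _ hU]
    have := G.mono w hw x t ht.1.le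
    rw [hg] at this
    linarith [ht.1]

/-- The zero set is a Lipschitz graph, and the part of it in a bounded set lies over a bounded
subset of the hyperplane. -/
theorem surface_lt_top {B : Set (Space d)} (hB : Bornology.IsBounded B) : G.surface B < ⊤ := by
  have hw := G.center_mem_W
  obtain ⟨τ, hτ, hg, hpos⟩ := G.exists_height hw
  have hL := G.lipschitz_graph hw hτ
  obtain ⟨R, hR⟩ := hB.subset_closedBall 0
  refine (measure_mono hR).trans_lt ?_
  refine (G.surface_le_map hw hτ hg hpos (Metric.closedBall 0 R)).trans_lt ?_
  rw [Measure.smul_apply, smul_eq_mul,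
    Measure.map_apply hL.continuous.measurable measurableSet_closedBall]
  refine ENNReal.mul_lt_top G.surfConst_ne_top.lt_top ?_
  refine (measure_mono (t := Metric.closedBall 0 (‖G.proj hw‖ * R)) fun x hx => ?_).trans_lt
    measure_closedBall_lt_top
  rw [Set.mem_preimage, mem_closedBall_zero_iff] at hx
  rw [mem_closedBall_zero_iff, ← G.proj_add_smul hw x (τ x)]
  exact (ContinuousLinearMap.le_opNorm _ _).trans (by gcongr)

theorem Adapted.isBounded {G : LocalGraph Ω} {B : Set (Space d)} {R : ℝ} (h : G.Adapted B R) :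
    Bornology.IsBounded B :=
  Metric.isBounded_iff.2 ⟨R, fun _ hx _ hy => (h.dist_lt _ hx _ hy).le⟩

theorem ae_restrict_surface {B : Set (Space d)} (hB : MeasurableSet B) :
    ∀ᵐ x ∂(G.surface.restrict B), x ∈ B ∧ G.g x = 0 := by
  refine (ae_restrict_mem hB).and (ae_restrict_of_ae ?_)
  exact ae_restrict_mem (measurableSet_eq_fun G.continuous_g.measurable measurable_const)

/-- Integrals along the directions of the cone are bounded by integrals over `Ω`. -/
theorem Adapted.lintegral_slices_le {G : LocalGraph Ω} {B : Set (Space d)} {R : ℝ}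
    (hB : G.Adapted B R) (hΩ : MeasurableSet Ω) {C : ℝ≥0∞} {w : Space d} (hw : w ∈ G.W)
    (hC : ∀ F : Space d → ℝ≥0∞, Measurable F →
      ∫⁻ x, (∫⁻ t in Set.Ioi (0 : ℝ), F (x + t • w)) ∂G.surface ≤ C * ∫⁻ z, F z)
    {F : Space d → ℝ≥0∞} (hF : Measurable F) :
    ∫⁻ x, (∫⁻ t in Set.Ioo 0 R, F (x + t • w)) ∂(G.surface.restrict B) ≤
      C * ∫⁻ z in Ω, F z := by
  rw [← lintegral_indicator hΩ]
  refine le_trans ?_ (hC _ (hF.indicator hΩ))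
  refine le_trans ?_ (lintegral_mono' (Measure.restrict_le_self (s := B)) le_rfl)
  refine lintegral_mono_ae ?_
  filter_upwards [G.ae_restrict_surface hB.measurable] with x hx
  refine le_trans ?_ (lintegral_mono_set (show Set.Ioo 0 R ⊆ Set.Ioi 0 from
    Set.Ioo_subset_Ioi_self))
  refine setLIntegral_mono' measurableSet_Ioo fun t ht => ?_
  rw [Set.indicator_of_mem (hB.cone x hx.1 hx.2 w hw t ht)]

/-- The Hardy-type inequality for difference quotients at the boundary. -/
theorem exists_lintegral_quotient_le (hΩ : MeasurableSet Ω) :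
    ∃ C : ℝ≥0∞, C ≠ ⊤ ∧ ∀ B R, G.Adapted B R → ∀ φ : Space d → Space d, ContDiff ℝ 1 φ →
      ∀ w ∈ G.W,
      ∫⁻ x, (∫⁻ r in Set.Ioo 0 R, (ENNReal.ofReal r ^ 2)⁻¹ * ‖φ x - φ (x + r • w)‖ₑ ^ 2)
        ∂(G.surface.restrict B) ≤ C * ∫⁻ z in Ω, ‖fderiv ℝ φ z‖ₑ ^ 2 := by
  obtain ⟨C, hC, hslice⟩ := G.exists_lintegral_slices_le
  set N : ℝ≥0∞ := ENNReal.ofReal (G.k + G.M) with hN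
  refine ⟨N ^ 2 * (invSqrtIntegral * (invSqrtIntegral * C)), ?_, fun B R hB φ hφ w hw => ?_⟩
  · exact ENNReal.mul_ne_top (ENNReal.pow_ne_top ENNReal.ofReal_ne_top)
      (ENNReal.mul_ne_top invSqrtIntegral_ne_top (ENNReal.mul_ne_top invSqrtIntegral_ne_top hC))
  have hDm : Measurable fun z => ‖fderiv ℝ φ z‖ₑ :=
    (hφ.continuous_fderiv (by simp)).measurable.enorm
  have hwN : ‖w‖ₑ ≤ N := by
    rw [hN, ← ofReal_norm]
    exact ENNReal.ofReal_le_ofReal (G.norm_le_of_mem_W hw)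
  set F : Space d → ℝ≥0∞ := fun z => ‖fderiv ℝ φ z‖ₑ ^ 2 with hF
  have hFm : Measurable F := hDm.pow_const 2
  have hpt : ∀ x, ∫⁻ r in Set.Ioo 0 R, (ENNReal.ofReal r ^ 2)⁻¹ * ‖φ x - φ (x + r • w)‖ₑ ^ 2 ≤
      N ^ 2 * (invSqrtIntegral * (invSqrtIntegral * ∫⁻ t in Set.Ioo 0 R, F (x + t • w))) := by
    intro x
    have h1 : ∀ r ∈ Set.Ioo 0 R, (ENNReal.ofReal r ^ 2)⁻¹ * ‖φ x - φ (x + r • w)‖ₑ ^ 2 ≤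
        N ^ 2 * (invSqrtIntegral * ∫⁻ s in Set.Ioo (0 : ℝ) 1,
          ENNReal.ofReal (s ^ (1 / 2 : ℝ)) * F (x + (s * r) • w)) := by
      intro r hr
      have h2 := enorm_sub_le_lintegral_fderiv hφ x (r • w)
      have h3 := sq_lintegral_le_weighted (f := fun s => ‖fderiv ℝ φ (x + s • r • w)‖ₑ)
        (hDm.comp (by fun_prop))
      simp only [smul_smul] at h2 h3
      have hr0 : ENNReal.ofReal r ≠ 0 := by simpa using hr.1
      calc (ENNReal.ofReal r ^ 2)⁻¹ * ‖φ x - φ (x + r • w)‖ₑ ^ 2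
          ≤ (ENNReal.ofReal r ^ 2)⁻¹ * (ENNReal.ofReal r * N *
              ∫⁻ s in Set.Ioo (0 : ℝ) 1, ‖fderiv ℝ φ (x + (s * r) • w)‖ₑ) ^ 2 := by
            gcongr
            refine h2.trans ?_
            rw [enorm_smul, Real.enorm_of_nonneg hr.1.le]
            gcongr
        _ = N ^ 2 * (∫⁻ s in Set.Ioo (0 : ℝ) 1, ‖fderiv ℝ φ (x + (s * r) • w)‖ₑ) ^ 2 := by
            rw [mul_pow, mul_pow, mul_assoc, ← mul_assoc, ENNReal.inv_mul_cancel, one_mul]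
            · exact pow_ne_zero 2 hr0
            · exact ENNReal.pow_ne_top ENNReal.ofReal_ne_top
        _ ≤ _ := by gcongr
    have hm : Measurable fun p : ℝ × ℝ =>
        ENNReal.ofReal (p.2 ^ (1 / 2 : ℝ)) * F (x + (p.2 * p.1) • w) :=
      Measurable.mul (by fun_prop) (hFm.comp (by fun_prop))
    calc ∫⁻ r in Set.Ioo 0 R, (ENNReal.ofReal r ^ 2)⁻¹ * ‖φ x - φ (x + r • w)‖ₑ ^ 2
        ≤ ∫⁻ r in Set.Ioo 0 R, N ^ 2 * (invSqrtIntegral * ∫⁻ s in Set.Ioo (0 : ℝ) 1,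
          ENNReal.ofReal (s ^ (1 / 2 : ℝ)) * F (x + (s * r) • w)) :=
          setLIntegral_mono' measurableSet_Ioo h1
      _ = N ^ 2 * (invSqrtIntegral * ∫⁻ s in Set.Ioo (0 : ℝ) 1, ∫⁻ r in Set.Ioo 0 R,
          ENNReal.ofReal (s ^ (1 / 2 : ℝ)) * F (x + (s * r) • w)) := by
          rw [lintegral_const_mul' _ _ (ENNReal.pow_ne_top ENNReal.ofReal_ne_top),
            lintegral_const_mul' _ _ invSqrtIntegral_ne_top,
            lintegral_lintegral_swap hm.aemeasurable]
      -- Scaling costs `s⁻¹`, which the weight `s^(1/2)` reduces to the integrable `s^(-1/2)`.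
      -- Unweighted Cauchy–Schwarz would leave the divergent `∫ s⁻¹ ds`.
      _ ≤ N ^ 2 * (invSqrtIntegral * ∫⁻ s in Set.Ioo (0 : ℝ) 1,
          ENNReal.ofReal (s ^ (-(1 / 2) : ℝ)) * ∫⁻ t in Set.Ioo 0 R, F (x + t • w)) := by
          gcongr 2
          refine setLIntegral_mono' measurableSet_Ioo fun s hs => ?_
          rw [lintegral_const_mul' _ _ ENNReal.ofReal_ne_top]
          have h4 := lintegral_Ioo_comp_mul_le (F := fun t => F (x + t • w)) (R := R)
            (hFm.comp (by fun_prop)) hs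
          refine (mul_le_mul_right h4 _).trans_eq ?_
          have := hs.1
          rw [← mul_assoc, ← ENNReal.ofReal_mul (by positivity), ← Real.rpow_neg_one,
            ← Real.rpow_add hs.1]
          norm_num
      _ = _ := by
          rw [lintegral_mul_const _ (by fun_prop)]
          rfl
  have hm2 : Measurable fun x => ∫⁻ t in Set.Ioo 0 R, F (x + t • w) :=
    Measurable.lintegral_prod_right' (f := fun p : Space d × ℝ => F (p.1 + p.2 • w))
      (hFm.comp (by fun_prop))
  calc _ ≤ ∫⁻ x, N ^ 2 * (invSqrtIntegral * (invSqrtIntegral *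
          ∫⁻ t in Set.Ioo 0 R, F (x + t • w))) ∂(G.surface.restrict B) := lintegral_mono hpt
    _ = N ^ 2 * (invSqrtIntegral * (invSqrtIntegral *
          ∫⁻ x, (∫⁻ t in Set.Ioo 0 R, F (x + t • w)) ∂(G.surface.restrict B))) := by
        rw [lintegral_const_mul' _ _ (ENNReal.pow_ne_top ENNReal.ofReal_ne_top),
          lintegral_const_mul' _ _ invSqrtIntegral_ne_top,
          lintegral_const_mul' _ _ invSqrtIntegral_ne_top]
    _ ≤ N ^ 2 * (invSqrtIntegral * (invSqrtIntegral * (C * ∫⁻ z in Ω, F z))) := by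
        gcongr
        exact hB.lintegral_slices_le hΩ hw (hslice w hw) hFm
    _ = _ := by ring

end LocalGraph

/-! ### Trace inequalities for smooth functions near a boundary point -/

namespace LocalGraph

variable {d : ℕ} {Ω : Set (Space d)} (G : LocalGraph Ω)

/-- The local trace inequality in `L²`. -/
theorem exists_lintegral_sq_le (hΩ : MeasurableSet Ω) {B : Set (Space d)} {R : ℝ}
    (hB : G.Adapted B R) :
    ∃ C : ℝ≥0∞, C ≠ ⊤ ∧ ∀ φ : Space d → Space d, ContDiff ℝ 1 φ →
      ∫⁻ x, ‖φ x‖ₑ ^ 2 ∂(G.surface.restrict B) ≤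
        C * ((∫⁻ z in Ω, ‖φ z‖ₑ ^ 2) + ∫⁻ z in Ω, ‖fderiv ℝ φ z‖ₑ ^ 2) := by
  obtain ⟨C₁, hC₁, hslice⟩ := G.exists_lintegral_slices_le
  obtain ⟨C₂, hC₂, hquot⟩ := G.exists_lintegral_quotient_le hΩ
  have hw := G.center_mem_W
  set w := G.k • G.e
  have hR0 : ENNReal.ofReal R ≠ 0 := by simpa using hB.pos
  refine ⟨(ENNReal.ofReal R)⁻¹ * (2 * C₁ + 2 * (ENNReal.ofReal R ^ 2 * C₂)), ?_, fun φ hφ => ?_⟩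
  · refine ENNReal.mul_ne_top (ENNReal.inv_ne_top.2 hR0) (ENNReal.add_ne_top.2 ⟨?_, ?_⟩)
    · exact ENNReal.mul_ne_top (by norm_num) hC₁
    · exact ENNReal.mul_ne_top (by norm_num)
        (ENNReal.mul_ne_top (ENNReal.pow_ne_top ENNReal.ofReal_ne_top) hC₂)
  have hφm : Measurable φ := hφ.continuous.measurable
  -- The value `φ x` is compared with `φ (x + r • w)` and averaged over `r`. Since `r < R`, the
  -- factor `R² / r² ≥ 1` may be inserted to reach the Hardy quotient.
  have hpt : ∀ x, ENNReal.ofReal R * ‖φ x‖ₑ ^ 2 ≤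
      2 * (∫⁻ r in Set.Ioo 0 R, ‖φ (x + r • w)‖ₑ ^ 2) + 2 * (ENNReal.ofReal R ^ 2 *
        ∫⁻ r in Set.Ioo 0 R, (ENNReal.ofReal r ^ 2)⁻¹ * ‖φ x - φ (x + r • w)‖ₑ ^ 2) := by
    intro x
    have h1 : ENNReal.ofReal R * ‖φ x‖ₑ ^ 2 = ∫⁻ _ in Set.Ioo 0 R, ‖φ x‖ₑ ^ 2 := by
      rw [setLIntegral_const, Real.volume_Ioo, sub_zero, mul_comm]
    rw [h1, ← lintegral_const_mul' _ _ (by norm_num),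
      ← lintegral_const_mul' _ _ (ENNReal.pow_ne_top ENNReal.ofReal_ne_top),
      ← lintegral_const_mul' _ _ (by norm_num), ← lintegral_add_left (by fun_prop)]
    refine setLIntegral_mono' measurableSet_Ioo fun r hr => ?_
    have h2 := enorm_sub_sq_le (φ x) 0 (φ (x + r • w))
    rw [sub_zero, zero_sub, enorm_neg, add_comm] at h2
    refine h2.trans ?_
    gcongr
    have h3 : 1 ≤ ENNReal.ofReal R ^ 2 * (ENNReal.ofReal r ^ 2)⁻¹ := by
      rw [← div_eq_mul_inv, ENNReal.le_div_iff_mul_le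
        (Or.inl (pow_ne_zero 2 (by simpa using hr.1)))
        (Or.inl (ENNReal.pow_ne_top ENNReal.ofReal_ne_top)), one_mul]
      gcongr
      exact hr.2.le
    rw [← mul_assoc]
    exact le_mul_of_one_le_left zero_le h3
  have hm1 : Measurable fun x => ∫⁻ r in Set.Ioo 0 R, ‖φ (x + r • w)‖ₑ ^ 2 :=
    Measurable.lintegral_prod_right' (f := fun p : Space d × ℝ => ‖φ (p.1 + p.2 • w)‖ₑ ^ 2)
      (by fun_prop)
  have h4 : ENNReal.ofReal R * ∫⁻ x, ‖φ x‖ₑ ^ 2 ∂(G.surface.restrict B) ≤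
      2 * (C₁ * ∫⁻ z in Ω, ‖φ z‖ₑ ^ 2) +
        2 * (ENNReal.ofReal R ^ 2 * (C₂ * ∫⁻ z in Ω, ‖fderiv ℝ φ z‖ₑ ^ 2)) := by
    rw [← lintegral_const_mul' _ _ ENNReal.ofReal_ne_top]
    refine (lintegral_mono hpt).trans ?_
    rw [lintegral_add_left (hm1.const_mul 2), lintegral_const_mul' _ _ (by norm_num),
      lintegral_const_mul' _ _ (by norm_num),
      lintegral_const_mul' _ _ (ENNReal.pow_ne_top ENNReal.ofReal_ne_top)]
    gcongr
    · exact hB.lintegral_slices_le hΩ hw (hslice w hw) (F := fun z => ‖φ z‖ₑ ^ 2) (by fun_prop)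
    · exact hquot B R hB φ hφ w hw
  rw [mul_assoc, ← ENNReal.div_eq_inv_mul,
    ENNReal.le_div_iff_mul_le (Or.inl hR0) (Or.inl ENNReal.ofReal_ne_top), mul_comm]
  refine h4.trans ?_
  set a := ∫⁻ z in Ω, ‖φ z‖ₑ ^ 2
  set b := ∫⁻ z in Ω, ‖fderiv ℝ φ z‖ₑ ^ 2
  calc 2 * (C₁ * a) + 2 * (ENNReal.ofReal R ^ 2 * (C₂ * b))
      = 2 * C₁ * a + 2 * (ENNReal.ofReal R ^ 2 * C₂) * b := by ring
    _ ≤ (2 * C₁ + 2 * (ENNReal.ofReal R ^ 2 * C₂)) * a +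
        (2 * C₁ + 2 * (ENNReal.ofReal R ^ 2 * C₂)) * b := by
        gcongr
        · exact le_self_add
        · exact le_add_self
    _ = _ := by rw [mul_add]

theorem measurableSet_W : MeasurableSet G.W := Metric.isClosed_closedBall.measurableSet

/-- Differences of boundary values are controlled by averages of differences between boundary
and interior values. -/
theorem volume_ball_mul_enorm_sub_sq_le {φ : Space d → Space d} (hφ : Continuous φ)
    {x y : Space d} (hx : G.g x = 0) (hy : G.g y = 0) {r : ℝ} (hr : 0 < r)
    (hxy : ‖(x - y) - inner ℝ G.e (x - y) • G.e‖ = r) :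
    volume (Metric.ball (0 : Space d) 1) * ‖φ x - φ y‖ₑ ^ 2 ≤
      2 * (∫⁻ w in G.W, ‖φ x - φ (x + r • w)‖ₑ ^ 2) +
        2 * ∫⁻ w in G.W, ‖φ y - φ (y + r • w)‖ₑ ^ 2 := by
  -- A unit ball around `k • e + v` with `‖v‖ ≤ L / 2` lies in `W`; this is the purpose of `le_M`.
  have htr : ∀ (v : Space d) (u : Space d), ‖v‖ ≤ G.L / 2 →
      ∫⁻ b in Metric.ball (0 : Space d) 1,
        ‖φ u - φ (u + r • (G.k • G.e + v + b))‖ₑ ^ 2 ≤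
      ∫⁻ w in G.W, ‖φ u - φ (u + r • w)‖ₑ ^ 2 := by
    intro v u hv
    rw [← lintegral_indicator G.measurableSet_W,
      ← lintegral_add_left_eq_self (μ := (volume : Measure (Space d))) _ (G.k • G.e + v),
      ← lintegral_indicator measurableSet_ball]
    refine lintegral_mono fun b => ?_
    by_cases hb : b ∈ Metric.ball (0 : Space d) 1
    · rw [Set.indicator_of_mem hb, Set.indicator_of_mem]
      rw [mem_ball_zero_iff] at hb
      rw [W, Metric.mem_closedBall, dist_eq_norm, add_assoc, add_sub_cancel_left]
      refine (norm_add_le _ _).trans ?_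
      linarith [G.le_M]
    · rw [Set.indicator_of_notMem hb]
      exact zero_le
  have hv : ‖(1 / (2 * r)) • (y - x)‖ ≤ G.L / 2 := by
    have h1 := G.norm_sub_le x y hx hy
    rw [hxy] at h1
    rw [norm_smul, norm_sub_rev, Real.norm_of_nonneg (by positivity), div_mul_eq_mul_div, one_mul,
      div_le_iff₀ (by positivity)]
    linarith
  have hv' : ‖(1 / (2 * r)) • (x - y)‖ ≤ G.L / 2 := by
    rwa [← neg_sub, smul_neg, norm_neg]
  have hm : ∀ v : Space d, Measurable fun b : Space d =>
      ‖φ x - φ (x + r • (G.k • G.e + v + b))‖ₑ ^ 2 := fun v => by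
    have := hφ.measurable
    fun_prop
  calc volume (Metric.ball (0 : Space d) 1) * ‖φ x - φ y‖ₑ ^ 2
      = ∫⁻ _ in Metric.ball (0 : Space d) 1, ‖φ x - φ y‖ₑ ^ 2 := by
        rw [setLIntegral_const, mul_comm]
    _ ≤ ∫⁻ b in Metric.ball (0 : Space d) 1,
        (2 * ‖φ x - φ (x + r • (G.k • G.e + (1 / (2 * r)) • (y - x) + b))‖ₑ ^ 2 +
          2 * ‖φ y - φ (y + r • (G.k • G.e + (1 / (2 * r)) • (x - y) + b))‖ₑ ^ 2) := by
        refine lintegral_mono fun b => ?_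
        -- Both cones reach the same point: the midpoint of `x` and `y` displaced by `r • (k • e +
        -- b)`.
        have : x + r • (G.k • G.e + (1 / (2 * r)) • (y - x) + b) =
            y + r • (G.k • G.e + (1 / (2 * r)) • (x - y) + b) := by
          simp only [smul_add, smul_smul]
          have h2 : r * (1 / (2 * r)) = 1 / 2 := by field_simp
          rw [h2]
          module
        rw [this]
        exact enorm_sub_sq_le _ _ _
    _ ≤ _ := by
        rw [lintegral_add_left ((hm _).const_mul 2), lintegral_const_mul' _ _ (by norm_num),
          lintegral_const_mul' _ _ (by norm_num)]
        exact add_le_add (mul_le_mul_right (htr _ x hv) _) (mul_le_mul_right (htr _ y hv') _)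

set_option maxHeartbeats 1000000 in
/-- The local trace inequality in the Sobolev-Slobodeckij seminorm. -/
theorem exists_lintegral_slobodeckij_le (hd : 2 ≤ d) (hΩ : MeasurableSet Ω) {B : Set (Space d)}
    {R : ℝ} (hB : G.Adapted B R) :
    ∃ C : ℝ≥0∞, C ≠ ⊤ ∧ ∀ φ : Space d → Space d, ContDiff ℝ 1 φ →
      ∫⁻ x, (∫⁻ y, edist (φ x) (φ y) ^ 2 / edist x y ^ d ∂(G.surface.restrict B))
        ∂(G.surface.restrict B) ≤ C * ∫⁻ z in Ω, ‖fderiv ℝ φ z‖ₑ ^ 2 := by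
  obtain ⟨C₁, hC₁, hrad⟩ := G.exists_lintegral_radial_le hd
  obtain ⟨C₂, hC₂, hquot⟩ := G.exists_lintegral_quotient_le hΩ
  have hfin : IsFiniteMeasure (G.surface.restrict B) :=
    ⟨by rw [Measure.restrict_apply_univ]; exact G.surface_lt_top hB.isBounded⟩
  set σ := G.surface.restrict B with hσ
  set V : ℝ≥0∞ := volume (Metric.ball (0 : Space d) 1) with hV
  have hV0 : V ≠ 0 := (Metric.measure_ball_pos _ _ one_pos).ne'
  have hVt : V ≠ ⊤ := measure_ball_lt_top.ne
  have hWt : volume G.W ≠ ⊤ := measure_closedBall_lt_top.ne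
  refine ⟨V⁻¹ * (4 * (C₁ * (volume G.W * C₂))), ?_, fun φ hφ => ?_⟩
  · exact ENNReal.mul_ne_top (ENNReal.inv_ne_top.2 hV0) (ENNReal.mul_ne_top (by norm_num)
      (ENNReal.mul_ne_top hC₁ (ENNReal.mul_ne_top hWt hC₂)))
  have hφm : Measurable φ := hφ.continuous.measurable
  set D := ∫⁻ z in Ω, ‖fderiv ℝ φ z‖ₑ ^ 2 with hD
  let ρ : Space d → Space d → ℝ := fun x y => ‖(y - x) - inner ℝ G.e (y - x) • G.e‖
  have hρ : ∀ x y, ρ x y = ρ y x := fun x y => by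
    simp only [ρ]
    rw [← neg_sub x y, inner_neg_right, neg_smul, ← neg_sub', norm_neg]
  let A : Space d → ℝ → ℝ≥0∞ := fun x r => ∫⁻ w in G.W, ‖φ x - φ (x + r • w)‖ₑ ^ 2
  have hA : Measurable (Function.uncurry A) :=
    Measurable.lintegral_prod_right' (ν := volume.restrict G.W)
      (f := fun p : (Space d × ℝ) × Space d => ‖φ p.1.1 - φ (p.1.1 + p.1.2 • p.2)‖ₑ ^ 2)
      (by fun_prop)
  -- The kernel is replaced by one depending on the horizontal distance `r`, which is at most `‖x -
  -- y‖`. The cut-off at `R` loses nothing, because points of `B` are less than `R` apart.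
  let f : Space d → ℝ → ℝ≥0∞ := fun x r =>
    (Set.Ioo 0 R).indicator (fun r => (ENNReal.ofReal r ^ d)⁻¹ * A x r) r
  have hf : ∀ x, Measurable (f x) := fun x => by
    refine Measurable.indicator ?_ measurableSet_Ioo
    have hAx : Measurable (A x) := hA.of_uncurry_left
    exact Measurable.mul (by fun_prop) hAx
  have hfm : Measurable fun p : Space d × Space d => f p.1 (ρ p.1 p.2) := by
    have h1 : Measurable fun p : Space d × ℝ => f p.1 p.2 := by
      have : (fun p : Space d × ℝ => f p.1 p.2) = (Prod.snd ⁻¹' Set.Ioo 0 R).indicator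
          fun p : Space d × ℝ => (ENNReal.ofReal p.2 ^ d)⁻¹ * A p.1 p.2 := by
        ext p
        by_cases hp : p.2 ∈ Set.Ioo 0 R
        · simp [f, Set.indicator_of_mem hp, Set.indicator_of_mem (s := Prod.snd ⁻¹' Set.Ioo 0 R) hp]
        · simp [f, Set.indicator_of_notMem hp,
            Set.indicator_of_notMem (s := Prod.snd ⁻¹' Set.Ioo 0 R) hp]
      rw [this]
      exact Measurable.indicator (Measurable.mul (by fun_prop) hA) (measurable_snd measurableSet_Ioo)
    have h2 : Measurable fun p : Space d × Space d => (p.1, ρ p.1 p.2) := by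
      unfold ρ
      fun_prop
    exact h1.comp h2
  have hpt : ∀ x ∈ {x | x ∈ B ∧ G.g x = 0}, ∀ y ∈ {x | x ∈ B ∧ G.g x = 0},
      V * (edist (φ x) (φ y) ^ 2 / edist x y ^ d) ≤ 2 * f x (ρ x y) + 2 * f y (ρ y x) := by
    rintro x ⟨hxB, hx⟩ y ⟨hyB, hy⟩
    rcases eq_or_ne x y with rfl | hne
    · simp
    have hxy := G.norm_sub_le x y hx hy
    have hle : ρ y x ≤ ‖x - y‖ := norm_sub_inner_smul_le G.norm_e (x - y)
    have hpos : 0 < ρ y x := by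
      have h1 : 0 < ‖x - y‖ := norm_pos_iff.2 (sub_ne_zero.2 hne)
      by_contra h2
      have h3 : ρ y x = 0 := le_antisymm (not_lt.1 h2) (norm_nonneg _)
      simp only [ρ] at h3
      rw [h3, mul_zero] at hxy
      linarith
    have hlt : ρ y x < R := hle.trans_lt (by rw [← dist_eq_norm]; exact hB.dist_lt x hxB y hyB)
    have hmem : ρ y x ∈ Set.Ioo 0 R := ⟨hpos, hlt⟩
    have key := G.volume_ball_mul_enorm_sub_sq_le hφ.continuous hx hy hpos rfl
    have h4 : ENNReal.ofReal (ρ y x) ≤ edist x y := by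
      rw [edist_dist, dist_eq_norm]
      exact ENNReal.ofReal_le_ofReal hle
    rw [hρ x y]
    simp only [f, Set.indicator_of_mem hmem]
    calc V * (edist (φ x) (φ y) ^ 2 / edist x y ^ d)
        ≤ V * ((ENNReal.ofReal (ρ y x) ^ d)⁻¹ * ‖φ x - φ y‖ₑ ^ 2) := by
          rw [edist_eq_enorm_sub (φ x), ENNReal.div_eq_inv_mul]
          gcongr
      _ = (ENNReal.ofReal (ρ y x) ^ d)⁻¹ * (V * ‖φ x - φ y‖ₑ ^ 2) := by ring
      _ ≤ (ENNReal.ofReal (ρ y x) ^ d)⁻¹ * (2 * A x (ρ y x) + 2 * A y (ρ y x)) := by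
          gcongr
      _ = _ := by ring
  have hI : ∫⁻ x, (∫⁻ y, f x (ρ x y) ∂σ) ∂σ ≤ C₁ * (volume G.W * C₂) * D := by
    -- The polar factor `r^(d-2)` against `r⁻ᵈ` leaves exactly the Hardy weight `r⁻²`.
    have hx1 : ∀ x, ∫⁻ y, f x (ρ x y) ∂σ ≤
        C₁ * ∫⁻ r in Set.Ioo 0 R, (ENNReal.ofReal r ^ 2)⁻¹ * A x r := by
      intro x
      refine (lintegral_mono' Measure.restrict_le_self le_rfl).trans ((hrad (f x) (hf x) x).trans ?_)
      gcongr 1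
      rw [← lintegral_indicator measurableSet_Ioi, ← lintegral_indicator measurableSet_Ioo]
      refine lintegral_mono fun r => ?_
      by_cases hr : r ∈ Set.Ioo 0 R
      · rw [Set.indicator_of_mem (show r ∈ Set.Ioi 0 from hr.1), Set.indicator_of_mem hr]
        simp only [f, Set.indicator_of_mem hr]
        rw [← mul_assoc]
        gcongr
        have hr0 : ENNReal.ofReal r ≠ 0 := by simpa using hr.1
        obtain ⟨n, rfl⟩ := Nat.exists_eq_add_of_le' hd
        rw [Nat.add_sub_cancel, ENNReal.ofReal_pow hr.1.le, pow_add, ENNReal.mul_inv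
          (Or.inl (pow_ne_zero _ hr0)) (Or.inl (ENNReal.pow_ne_top ENNReal.ofReal_ne_top)),
          ← mul_assoc, ENNReal.mul_inv_cancel (pow_ne_zero _ hr0)
          (ENNReal.pow_ne_top ENNReal.ofReal_ne_top), one_mul]
      · rw [Set.indicator_of_notMem hr]
        have hfr : f x r = 0 := Set.indicator_of_notMem hr _
        simp [Set.indicator_apply, hfr]
    have hm3 : Measurable fun p : (Space d × ℝ) × Space d =>
        (ENNReal.ofReal p.1.2 ^ 2)⁻¹ * ‖φ p.1.1 - φ (p.1.1 + p.1.2 • p.2)‖ₑ ^ 2 := by fun_prop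
    -- The integration over directions is moved outside, so that the Hardy inequality applies to
    -- each fixed `w`.
    have hsw : ∀ x, ∫⁻ r in Set.Ioo 0 R, (ENNReal.ofReal r ^ 2)⁻¹ * A x r =
        ∫⁻ w in G.W, ∫⁻ r in Set.Ioo 0 R,
          (ENNReal.ofReal r ^ 2)⁻¹ * ‖φ x - φ (x + r • w)‖ₑ ^ 2 := by
      intro x
      rw [lintegral_lintegral_swap]
      · refine lintegral_congr fun r => ?_
        rw [← lintegral_const_mul _ (by fun_prop)]
      · exact (hm3.comp (by fun_prop :
          Measurable fun p : Space d × ℝ => ((x, p.2), p.1))).aemeasurable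
    have hm4 : Measurable fun p : Space d × Space d => ∫⁻ r in Set.Ioo 0 R,
          (ENNReal.ofReal r ^ 2)⁻¹ * ‖φ p.1 - φ (p.1 + r • p.2)‖ₑ ^ 2 :=
      Measurable.lintegral_prod_right' (f := fun q : (Space d × Space d) × ℝ =>
        (ENNReal.ofReal q.2 ^ 2)⁻¹ * ‖φ q.1.1 - φ (q.1.1 + q.2 • q.1.2)‖ₑ ^ 2) (by fun_prop)
    calc ∫⁻ x, (∫⁻ y, f x (ρ x y) ∂σ) ∂σ
        ≤ ∫⁻ x, C₁ * (∫⁻ w in G.W, ∫⁻ r in Set.Ioo 0 R,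
          (ENNReal.ofReal r ^ 2)⁻¹ * ‖φ x - φ (x + r • w)‖ₑ ^ 2) ∂σ :=
          lintegral_mono fun x => (hx1 x).trans_eq (by rw [hsw])
      _ = C₁ * ∫⁻ w in G.W, (∫⁻ x, (∫⁻ r in Set.Ioo 0 R,
          (ENNReal.ofReal r ^ 2)⁻¹ * ‖φ x - φ (x + r • w)‖ₑ ^ 2) ∂σ) := by
          rw [lintegral_const_mul' _ _ hC₁, lintegral_lintegral_swap hm4.aemeasurable]
      _ ≤ C₁ * ∫⁻ _ in G.W, C₂ * D := by
          gcongr 1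
          exact setLIntegral_mono' G.measurableSet_W fun w hw => hquot B R hB φ hφ w hw
      _ = _ := by
          rw [setLIntegral_const]; ring
  have hI' : ∫⁻ x, (∫⁻ y, f y (ρ y x) ∂σ) ∂σ ≤ C₁ * (volume G.W * C₂) * D := by
    rw [lintegral_lintegral_swap (f := fun x y => f y (ρ y x))
      (hfm.comp measurable_swap).aemeasurable]
    exact hI
  rw [mul_assoc, ← ENNReal.div_eq_inv_mul,
    ENNReal.le_div_iff_mul_le (Or.inl hV0) (Or.inl hVt), mul_comm]
  have hae := G.ae_restrict_surface hB.measurable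
  have hm5 : Measurable fun x => ∫⁻ y, f x (ρ x y) ∂σ :=
    Measurable.lintegral_prod_right' (f := fun p : Space d × Space d => f p.1 (ρ p.1 p.2)) hfm
  calc V * ∫⁻ x, (∫⁻ y, edist (φ x) (φ y) ^ 2 / edist x y ^ d ∂σ) ∂σ
      = ∫⁻ x, (∫⁻ y, V * (edist (φ x) (φ y) ^ 2 / edist x y ^ d) ∂σ) ∂σ := by
        rw [← lintegral_const_mul' _ _ hVt]
        exact lintegral_congr fun x => (lintegral_const_mul' _ _ hVt).symm
    _ ≤ ∫⁻ x, (∫⁻ y, (2 * f x (ρ x y) + 2 * f y (ρ y x)) ∂σ) ∂σ := by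
        refine lintegral_mono_ae ?_
        filter_upwards [hae] with x hx
        refine lintegral_mono_ae ?_
        filter_upwards [hae] with y hy
        exact hpt x hx y hy
    _ = 2 * (∫⁻ x, (∫⁻ y, f x (ρ x y) ∂σ) ∂σ) + 2 * ∫⁻ x, (∫⁻ y, f y (ρ y x) ∂σ) ∂σ := by
        rw [← lintegral_const_mul' _ _ (by norm_num), ← lintegral_const_mul' _ _ (by norm_num),
          ← lintegral_add_left (hm5.const_mul 2)]
        refine lintegral_congr fun x => ?_
        rw [lintegral_add_left, lintegral_const_mul' _ _ (by norm_num),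
          lintegral_const_mul' _ _ (by norm_num)]
        exact (hfm.comp (by fun_prop : Measurable fun y : Space d => (x, y))).const_mul 2
    _ ≤ 2 * (C₁ * (volume G.W * C₂) * D) + 2 * (C₁ * (volume G.W * C₂) * D) := by gcongr
    _ = _ := by ring

end LocalGraph

/-! ### Global trace inequalities for smooth functions -/

theorem LocalGraph.surf_restrict_le {d : ℕ} {Ω : Set (Space d)} (G : LocalGraph Ω) (hΩ : IsOpen Ω)
    {B : Set (Space d)} (hB : MeasurableSet B) (hBU : B ⊆ G.U) :
    (surf Ω).restrict B ≤ G.surface.restrict B := by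
  rw [surf, surface, Measure.restrict_restrict hB, Measure.restrict_restrict hB]
  refine Measure.restrict_mono_set _ fun x hx => ⟨hx.1, ?_⟩
  exact G.frontier_inter_subset hΩ hx.2 (hBU hx.1)

/-- A finite cover of the boundary by sets on which the boundary is a Lipschitz graph. -/
structure GraphCover {d : ℕ} (Ω : Set (Space d)) where
  ι : Type
  fintype : Fintype ι
  G : ι → LocalGraph Ω
  B : ι → Set (Space d)
  R : ι → ℝ
  isOpen : ∀ i, IsOpen (B i)
  subset : ∀ i, B i ⊆ (G i).U
  adapted : ∀ i, (G i).Adapted (B i) (R i)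
  cover : frontier Ω ⊆ ⋃ i, B i

attribute [instance] GraphCover.fintype

/-- The boundary of a bounded set is compact, so finitely many adapted balls suffice. -/
theorem StokesFEM.HasLipschitzBoundary.nonempty_graphCover {d : ℕ} {Ω : Set (Space d)}
    (h : HasLipschitzBoundary Ω) (hb : Bornology.IsBounded Ω) : Nonempty (GraphCover Ω) := by
  have hc : IsCompact (frontier Ω) :=
    Metric.isCompact_of_isClosed_isBounded isClosed_frontier
      (hb.closure.subset frontier_subset_closure)
  have hex : ∀ x : frontier Ω, ∃ G : LocalGraph Ω, ∃ δ > 0, Metric.ball (x : Space d) δ ⊆ G.U ∧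
      G.Adapted (Metric.ball x δ) (2 * δ) := by
    intro x
    obtain ⟨G, hG⟩ := h.exists_localGraph x.2
    exact ⟨G, G.exists_adapted hG⟩
  choose G δ hδ hU hA using hex
  obtain ⟨t, ht⟩ := hc.elim_finite_subcover (fun x : frontier Ω => Metric.ball (x : Space d) (δ x))
    (fun _ => Metric.isOpen_ball)
    (fun x hx => Set.mem_iUnion.2 ⟨⟨x, hx⟩, Metric.mem_ball_self (hδ _)⟩)
  let e := (Fintype.equivFin t).symm
  refine ⟨⟨Fin (Fintype.card t), inferInstance, fun i => G (e i), fun i => Metric.ball (e i).1 (δ (e i)),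
    fun i => 2 * δ (e i), fun _ => Metric.isOpen_ball, fun i => hU _, fun i => hA _, fun x hx => ?_⟩⟩
  obtain ⟨y, hy, hxy⟩ := Set.mem_iUnion₂.1 (ht hx)
  refine Set.mem_iUnion.2 ⟨e.symm ⟨y, hy⟩, ?_⟩
  simpa using hxy

namespace GraphCover

variable {d : ℕ} {Ω : Set (Space d)} (K : GraphCover Ω)

/-- Overlaps of the cover only increase the right-hand side, so an upper bound needs no partition of
unity. -/
theorem lintegral_surf_le_sum (hΩ : IsOpen Ω) (f : Space d → ℝ≥0∞) :
    ∫⁻ x, f x ∂(surf Ω) ≤ ∑ i, ∫⁻ x, f x ∂((K.G i).surface.restrict (K.B i)) := by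
  have h : surf Ω = (surf Ω).restrict (⋃ i, K.B i) := by
    rw [surf, Measure.restrict_restrict (MeasurableSet.iUnion fun i => (K.isOpen i).measurableSet),
      Set.inter_eq_right.2 K.cover]
  calc ∫⁻ x, f x ∂(surf Ω) = ∫⁻ x in ⋃ i, K.B i, f x ∂(surf Ω) := by rw [← h]
    _ ≤ ∑' i, ∫⁻ x in K.B i, f x ∂(surf Ω) := lintegral_iUnion_le _ _
    _ = ∑ i, ∫⁻ x in K.B i, f x ∂(surf Ω) := tsum_fintype _
    _ ≤ _ := Finset.sum_le_sum fun i _ => lintegral_mono'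
        ((K.G i).surf_restrict_le hΩ (K.isOpen i).measurableSet (K.subset i)) le_rfl

include K in
theorem isFiniteMeasure_surf (hΩ : IsOpen Ω) : IsFiniteMeasure (surf Ω) := by
  refine ⟨?_⟩
  have h := K.lintegral_surf_le_sum hΩ 1
  simp only [Pi.one_apply, lintegral_one] at h
  refine h.trans_lt (ENNReal.sum_lt_top.2 fun i _ => ?_)
  rw [Measure.restrict_apply_univ]
  exact (K.G i).surface_lt_top (K.adapted i).isBounded

/-- The square of the `H¹(Ω)`-norm of a smooth function. -/
noncomputable def _root_.energy {d : ℕ} (Ω : Set (Space d)) (φ : Space d → Space d) : ℝ≥0∞ :=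
  (∫⁻ z in Ω, ‖φ z‖ₑ ^ 2) + ∫⁻ z in Ω, ‖classicalGrad φ z‖ₑ ^ 2

/-- The operator norm is at most the Frobenius norm, by Cauchy–Schwarz in each row. -/
theorem _root_.norm_fderiv_le_norm_classicalGrad {d : ℕ} (φ : Space d → Space d)
    (z : Space d) :
    ‖fderiv ℝ φ z‖ ≤ ‖classicalGrad φ z‖ := by
  refine ContinuousLinearMap.opNorm_le_bound _ (norm_nonneg _) fun v => ?_
  have hv : v = ∑ j, v j • EuclideanSpace.single j (1 : ℝ) := by
    ext i
    simp [Finset.sum_apply, Pi.single_apply]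
  have h1 : ∀ i, fderiv ℝ φ z v i = ∑ j, classicalGrad φ z (i, j) * v j := by
    intro i
    conv_lhs => rw [hv]
    simp [map_sum, classicalGrad, mul_comm]
  have h2 : ‖fderiv ℝ φ z v‖ ^ 2 ≤ (‖classicalGrad φ z‖ * ‖v‖) ^ 2 := by
    rw [mul_pow, EuclideanSpace.norm_sq_eq, EuclideanSpace.norm_sq_eq (classicalGrad φ z),
      EuclideanSpace.norm_sq_eq v, Fintype.sum_prod_type, Finset.sum_mul]
    refine Finset.sum_le_sum fun i _ => ?_
    rw [h1]
    simp only [Real.norm_eq_abs, sq_abs]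
    exact Finset.sum_mul_sq_le_sq_mul_sq _ _ _
  exact le_of_sq_le_sq h2 (by positivity)

theorem _root_.lintegral_fderiv_le_energy {d : ℕ} (Ω : Set (Space d)) (φ : Space d → Space d) :
    ∫⁻ z in Ω, ‖fderiv ℝ φ z‖ₑ ^ 2 ≤
      ∫⁻ z in Ω, ‖classicalGrad φ z‖ₑ ^ 2 := by
  refine lintegral_mono fun z => ?_
  gcongr
  rw [enorm_le_iff_norm_le]
  exact norm_fderiv_le_norm_classicalGrad φ z

include K in
theorem exists_lintegral_sq_le (hΩ : IsOpen Ω) :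
    ∃ C : ℝ≥0∞, C ≠ ⊤ ∧ ∀ φ : Space d → Space d, ContDiff ℝ 1 φ →
      ∫⁻ x, ‖φ x‖ₑ ^ 2 ∂(surf Ω) ≤ C * energy Ω φ := by
  choose C hC hle using fun i => (K.G i).exists_lintegral_sq_le hΩ.measurableSet (K.adapted i)
  refine ⟨∑ i, C i, ENNReal.sum_ne_top.2 fun i _ => hC i, fun φ hφ => ?_⟩
  refine (K.lintegral_surf_le_sum hΩ _).trans ?_
  rw [Finset.sum_mul]
  refine Finset.sum_le_sum fun i _ => (hle i φ hφ).trans ?_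
  unfold energy
  gcongr C i * (_ + ?_)
  exact lintegral_fderiv_le_energy Ω φ

include K in
theorem exists_lebesgueNumber (hb : Bornology.IsBounded Ω) :
    ∃ ε > 0, ∀ x ∈ frontier Ω, ∀ y, dist x y < ε → ∃ i, x ∈ K.B i ∧ y ∈ K.B i := by
  have hc : IsCompact (frontier Ω) :=
    Metric.isCompact_of_isClosed_isBounded isClosed_frontier
      (hb.closure.subset frontier_subset_closure)
  obtain ⟨ε, hε, h⟩ := lebesgue_number_lemma_of_metric hc K.isOpen K.cover
  refine ⟨ε, hε, fun x hx y hxy => ?_⟩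
  obtain ⟨i, hi⟩ := h x hx
  exact ⟨i, hi (Metric.mem_ball_self hε), hi (by rwa [Metric.mem_ball, dist_comm])⟩

include K in
-- Pairs of boundary points closer than a Lebesgue number `ε` of the cover share a chart, where the
-- local inequality applies. For the other pairs the kernel is at most `ε⁻ᵈ`, and the `L²` trace
-- inequality together with the finite surface area suffices.
theorem exists_lintegral_slobodeckij_le (hd : 2 ≤ d) (hΩ : IsOpen Ω)
    (hb : Bornology.IsBounded Ω) :
    ∃ C : ℝ≥0∞, C ≠ ⊤ ∧ ∀ φ : Space d → Space d, ContDiff ℝ 1 φ →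
      ∫⁻ x, (∫⁻ y, edist (φ x) (φ y) ^ 2 / edist x y ^ d ∂(surf Ω)) ∂(surf Ω) ≤
        C * energy Ω φ := by
  have hfin := K.isFiniteMeasure_surf hΩ
  obtain ⟨C₁, hC₁, hsq⟩ := K.exists_lintegral_sq_le hΩ
  choose C hC hle using fun i =>
    (K.G i).exists_lintegral_slobodeckij_le hd hΩ.measurableSet (K.adapted i)
  obtain ⟨ε, hε, hleb⟩ := K.exists_lebesgueNumber hb
  set a : ℝ≥0∞ := (ENNReal.ofReal ε ^ d)⁻¹ * 2 with ha
  have ha_top : a ≠ ⊤ := ENNReal.mul_ne_top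
    (ENNReal.inv_ne_top.2 (pow_ne_zero _ (by simpa using hε))) (by norm_num)
  set S := surf Ω Set.univ with hS
  have hS_top : S ≠ ⊤ := measure_ne_top _ _
  refine ⟨∑ i, C i + 2 * (a * (S * C₁)), ?_, fun φ hφ => ?_⟩
  · refine ENNReal.add_ne_top.2 ⟨ENNReal.sum_ne_top.2 fun i _ => hC i, ?_⟩
    exact ENNReal.mul_ne_top (by norm_num)
      (ENNReal.mul_ne_top ha_top (ENNReal.mul_ne_top hS_top hC₁))
  have hφm : Measurable φ := hφ.continuous.measurable
  let f : Space d → Space d → ℝ≥0∞ := fun x y => edist (φ x) (φ y) ^ 2 / edist x y ^ d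
  have hf : Measurable fun p : Space d × Space d => f p.1 p.2 := by
    unfold f
    fun_prop
  have hmB : ∀ i, MeasurableSet (K.B i) := fun i => (K.isOpen i).measurableSet
  let F : K.ι → Space d → Space d → ℝ≥0∞ := fun i x y =>
    (K.B i).indicator (fun x => (K.B i).indicator (fun y => f x y) y) x
  have hF : ∀ i, Measurable fun p : Space d × Space d => F i p.1 p.2 := fun i => by
    have : (fun p : Space d × Space d => F i p.1 p.2) =
        (K.B i ×ˢ K.B i).indicator fun p => f p.1 p.2 := by
      ext p
      by_cases h1 : p.1 ∈ K.B i <;> by_cases h2 : p.2 ∈ K.B i <;>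
        simp [F, Set.indicator, h1, h2]
    rw [this]
    exact hf.indicator ((hmB i).prod (hmB i))
  have hpt : ∀ x ∈ frontier Ω, ∀ y ∈ frontier Ω,
      f x y ≤ ∑ i, F i x y + (a * ‖φ x‖ₑ ^ 2 + a * ‖φ y‖ₑ ^ 2) := by
    intro x hx y hy
    rcases lt_or_ge (dist x y) ε with h | h
    · obtain ⟨i, h1, h2⟩ := hleb x hx y h
      refine le_trans ?_ le_self_add
      refine le_trans (le_of_eq ?_)
        (Finset.single_le_sum (f := fun i => F i x y) (fun _ _ => zero_le) (Finset.mem_univ i))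
      simp [F, h1, h2]
    · refine le_trans ?_ le_add_self
      have h1 : ENNReal.ofReal ε ≤ edist x y := by
        rw [edist_dist]; exact ENNReal.ofReal_le_ofReal h
      have h2 := enorm_sub_sq_le (φ x) (φ y) 0
      rw [sub_zero, sub_zero] at h2
      calc f x y ≤ (ENNReal.ofReal ε ^ d)⁻¹ * (2 * ‖φ x‖ₑ ^ 2 + 2 * ‖φ y‖ₑ ^ 2) := by
            simp only [f]
            rw [ENNReal.div_eq_inv_mul, edist_eq_enorm_sub (φ x)]
            gcongr
        _ = _ := by rw [ha]; ring
  have hmem : ∀ᵐ x ∂(surf Ω), x ∈ frontier Ω := ae_restrict_mem isClosed_frontier.measurableSet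
  have hFi : ∀ i, ∫⁻ x, (∫⁻ y, F i x y ∂(surf Ω)) ∂(surf Ω) ≤
      C i * ∫⁻ z in Ω, ‖fderiv ℝ φ z‖ₑ ^ 2 := by
    intro i
    refine le_trans ?_ (hle i φ hφ)
    have h1 := (K.G i).surf_restrict_le hΩ (hmB i) (K.subset i)
    refine le_trans ?_ (lintegral_mono' h1 fun x => lintegral_mono' h1 le_rfl)
    rw [← lintegral_indicator (hmB i)]
    refine lintegral_mono fun x => ?_
    by_cases hx : x ∈ K.B i
    · simp only [F, Set.indicator_of_mem hx]
      rw [lintegral_indicator (hmB i)]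
    · simp [F, Set.indicator_of_notMem hx]
  have hsum : Measurable fun p : Space d × Space d => ∑ i, F i p.1 p.2 :=
    Finset.measurable_sum _ fun i _ => hF i
  calc ∫⁻ x, (∫⁻ y, f x y ∂(surf Ω)) ∂(surf Ω)
      ≤ ∫⁻ x, (∫⁻ y, (∑ i, F i x y + (a * ‖φ x‖ₑ ^ 2 + a * ‖φ y‖ₑ ^ 2)) ∂(surf Ω)) ∂(surf Ω) := by
        refine lintegral_mono_ae ?_
        filter_upwards [hmem] with x hx
        refine lintegral_mono_ae ?_
        filter_upwards [hmem] with y hy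
        exact hpt x hx y hy
    _ = ∫⁻ x, (∑ i, (∫⁻ y, F i x y ∂(surf Ω)) +
          (a * ‖φ x‖ₑ ^ 2 * S + a * ∫⁻ y, ‖φ y‖ₑ ^ 2 ∂(surf Ω))) ∂(surf Ω) := by
        refine lintegral_congr fun x => ?_
        have e1 : ∀ i, Measurable fun y => F i x y := fun i => (hF i).of_uncurry_left (x := x)
        rw [lintegral_add_left (Finset.measurable_sum _ fun i _ => e1 i),
          lintegral_finsetSum _ fun i _ => e1 i, lintegral_add_left measurable_const,
          lintegral_const, lintegral_const_mul' _ _ ha_top]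
    _ = ∑ i, (∫⁻ x, (∫⁻ y, F i x y ∂(surf Ω)) ∂(surf Ω)) +
          (a * (∫⁻ y, ‖φ y‖ₑ ^ 2 ∂(surf Ω)) * S + a * (∫⁻ y, ‖φ y‖ₑ ^ 2 ∂(surf Ω)) * S) := by
        have e2 : ∀ i, Measurable fun x => ∫⁻ y, F i x y ∂(surf Ω) := fun i =>
          Measurable.lintegral_prod_right' (f := fun p : Space d × Space d => F i p.1 p.2) (hF i)
        rw [lintegral_add_left (Finset.measurable_sum _ fun i _ => e2 i),
          lintegral_finsetSum _ fun i _ => e2 i, lintegral_add_right _ measurable_const,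
          lintegral_const, lintegral_mul_const' _ _ hS_top, lintegral_const_mul' _ _ ha_top]
    _ ≤ ∑ i, C i * energy Ω φ + (a * (C₁ * energy Ω φ) * S + a * (C₁ * energy Ω φ) * S) := by
        gcongr with i
        · refine (hFi i).trans ?_
          gcongr
          exact (lintegral_fderiv_le_energy Ω φ).trans le_add_self
        · exact hsq φ hφ
        · exact hsq φ hφ
    _ = _ := by rw [← Finset.sum_mul]; ring

end GraphCover

/-! ### Mollification in `L²` -/

/-- Translations act continuously on `L²`; this is used for zero extensions, which have no further
regularity. -/
theorem exists_eLpNorm_translate_le {d : ℕ} {E : Type*} [NormedAddCommGroup E]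
    {F : Space d → E} (hF : MemLp F 2 volume) {ε : ℝ≥0∞} (hε : 0 < ε) :
    ∃ δ > 0, ∀ s : Space d, ‖s‖ ≤ δ → eLpNorm (fun x => F (x - s) - F x) 2 volume ≤ ε := by
  let g : C(Space d, C(Space d, Space d)) :=
    (ContinuousMap.mk (fun p : Space d × Space d => p.2 - p.1) (by fun_prop)).curry
  have hg : ∀ s, MeasurePreserving (g s) (volume : Measure (Space d)) volume :=
    fun s => measurePreserving_sub_right volume s
  have h := (tendsto_const_nhds (x := hF.toLp F) (f := 𝓝 (0 : Space d))).compMeasurePreservingLp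
    (g.continuous.tendsto 0) hg (hg 0) (by norm_num)
  have h2 := (EMetric.tendsto_nhds.1 h ε hε)
  obtain ⟨δ, hδ, hball⟩ := Metric.eventually_nhds_iff.1 h2
  refine ⟨δ / 2, by positivity, fun s hs => ?_⟩
  have h3 := (hball (y := s) (by rw [dist_zero_right]; linarith)).le
  rw [Lp.toLp_compMeasurePreserving, Lp.toLp_compMeasurePreserving, Lp.edist_toLp_toLp] at h3
  refine le_trans (le_of_eq ?_) h3
  congr 1
  ext x
  simp [g]

/-- The Cauchy-Schwarz inequality with a weight. -/
theorem sq_lintegral_mul_le {α : Type*} [MeasurableSpace α] {μ : Measure α} {ρ g : α → ℝ≥0∞}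
    (hρ : Measurable ρ) (hg : Measurable g) :
    (∫⁻ s, ρ s * g s ∂μ) ^ 2 ≤ (∫⁻ s, ρ s ∂μ) * ∫⁻ s, ρ s * g s ^ 2 ∂μ := by
  have h0 : ∀ a : ℝ≥0∞, a ^ (1 / 2 : ℝ) * a ^ (1 / 2 : ℝ) = a := fun a => by
    rw [← ENNReal.rpow_add_of_nonneg _ _ (by norm_num) (by norm_num)]; norm_num
  have h1 := ENNReal.lintegral_mul_le_Lp_mul_Lq μ Real.HolderConjugate.two_two
    (f := fun s => ρ s ^ (1 / 2 : ℝ)) (g := fun s => ρ s ^ (1 / 2 : ℝ) * g s)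
    (by fun_prop) (by fun_prop)
  have h3 : ∀ a : ℝ≥0∞, (a ^ (1 / 2 : ℝ)) ^ 2 = a := fun a => by rw [sq, h0]
  have h4 : ∀ a : ℝ≥0∞, (a ^ (1 / 2 : ℝ)) ^ (2 : ℝ) = a := fun a => by
    rw [← ENNReal.rpow_mul]; norm_num
  simp only [Pi.mul_apply, ← mul_assoc, h0, ENNReal.mul_rpow_of_nonneg _ _ (zero_le_two (α := ℝ)),
    h4, ENNReal.rpow_two] at h1
  refine (pow_le_pow_left₀ zero_le h1 2).trans_eq ?_
  rw [mul_pow, h3, h3]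

/-- Convolution with a probability density supported in a ball whose translations move `F` by at
most `ε` moves `F` by at most `ε`. -/
theorem eLpNorm_convolution_sub_le {d : ℕ} {E : Type*} [NormedAddCommGroup E] [NormedSpace ℝ E]
    [CompleteSpace E] [MeasurableSpace E] [BorelSpace E] [SecondCountableTopology E]
    {F : Space d → E} (hFm : Measurable F) (hF : MemLp F 2 volume)
    {ε : ℝ≥0∞} {δ : ℝ} (hδ : ∀ s : Space d, ‖s‖ ≤ δ →
      eLpNorm (fun x => F (x - s) - F x) 2 volume ≤ ε)
    {ρ : Space d → ℝ} (hρc : Continuous ρ) (hρs : HasCompactSupport ρ) (hρ0 : ∀ s, 0 ≤ ρ s)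
    (hρ1 : ∫ s, ρ s = 1) (hsupp : ∀ s, ρ s ≠ 0 → ‖s‖ ≤ δ) :
    eLpNorm (fun x => convolution ρ F (ContinuousLinearMap.lsmul ℝ ℝ) volume x - F x) 2 volume ≤
      ε := by
  have hρi : Integrable ρ := hρc.integrable_of_hasCompactSupport hρs
  have hloc : LocallyIntegrable F volume := hF.locallyIntegrable (by norm_num)
  have hρ1' : ∫⁻ s, ‖ρ s‖ₑ = 1 := by
    have h1 : ∫⁻ s, ‖ρ s‖ₑ = ∫⁻ s, ENNReal.ofReal (ρ s) :=
      lintegral_congr fun s => Real.enorm_of_nonneg (hρ0 s)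
    rw [h1, ← ofReal_integral_eq_lintegral_ofReal hρi (ae_of_all _ hρ0), hρ1, ENNReal.ofReal_one]
  have hρm : Measurable fun s => ‖ρ s‖ₑ := hρc.measurable.enorm
  have hsq : ∀ f : Space d → E, eLpNorm f 2 volume ^ 2 = ∫⁻ x, ‖f x‖ₑ ^ 2 := fun f => by
    rw [eLpNorm_eq_lintegral_rpow_enorm_toReal (by norm_num) (by norm_num), ← ENNReal.rpow_natCast,
      ← ENNReal.rpow_mul]
    simp
  -- Since `ρ` has integral one, the difference is the `ρ`-average of `F (x - s) - F x`, and
  -- Cauchy–Schwarz moves the square inside the average.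
  have hpt : ∀ x, ‖convolution ρ F (ContinuousLinearMap.lsmul ℝ ℝ) volume x - F x‖ₑ ^ 2 ≤
      ∫⁻ s, ‖ρ s‖ₑ * ‖F (x - s) - F x‖ₑ ^ 2 := by
    intro x
    have hce : Integrable (fun s => ρ s • F (x - s)) volume :=
      (hρs.convolutionExists_left (ContinuousLinearMap.lsmul ℝ ℝ) hρc hloc) x
    have h1 : convolution ρ F (ContinuousLinearMap.lsmul ℝ ℝ) volume x - F x =
        ∫ s, ρ s • (F (x - s) - F x) := by
      simp only [smul_sub]
      rw [integral_sub hce (hρi.smul_const _), integral_smul_const, hρ1, one_smul]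
      rfl
    rw [h1]
    have h2 := sq_lintegral_mul_le (μ := (volume : Measure (Space d))) hρm
      (g := fun s => ‖F (x - s) - F x‖ₑ) (by fun_prop)
    rw [hρ1', one_mul] at h2
    refine le_trans ?_ h2
    gcongr
    refine (enorm_integral_le_lintegral_enorm _).trans_eq ?_
    simp only [enorm_smul]
  rw [← ENNReal.pow_le_pow_left_iff (n := 2) (by norm_num), hsq]
  have hm : Measurable fun p : Space d × Space d => ‖ρ p.2‖ₑ * ‖F (p.1 - p.2) - F p.1‖ₑ ^ 2 :=
    (hρm.comp measurable_snd).mul (by fun_prop)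
  calc ∫⁻ x, ‖convolution ρ F (ContinuousLinearMap.lsmul ℝ ℝ) volume x - F x‖ₑ ^ 2
      ≤ ∫⁻ x, ∫⁻ s, ‖ρ s‖ₑ * ‖F (x - s) - F x‖ₑ ^ 2 := lintegral_mono hpt
    _ = ∫⁻ s, ‖ρ s‖ₑ * eLpNorm (fun x => F (x - s) - F x) 2 volume ^ 2 := by
        rw [lintegral_lintegral_swap hm.aemeasurable]
        refine lintegral_congr fun s => ?_
        rw [hsq, lintegral_const_mul' _ _ enorm_ne_top]
    _ ≤ ∫⁻ s, ‖ρ s‖ₑ * ε ^ 2 := by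
        refine lintegral_mono fun s => ?_
        by_cases hs : ρ s = 0
        · simp [hs]
        · gcongr
          exact hδ s (hsupp s hs)
    _ = ε ^ 2 := by rw [lintegral_mul_const _ hρm, hρ1', one_mul]

/-- Placing a vector into the `j`-th column of a matrix. -/
noncomputable def columnEmbed {d : ℕ} (j : Fin d) : Space d →L[ℝ] Mat d :=
  LinearMap.toContinuousLinearMap
    { toFun := fun v => WithLp.toLp 2 fun ij => if ij.2 = j then v ij.1 else 0
      map_add' := fun v w => by
        ext ij
        by_cases h : ij.2 = j <;> simp [h]
      map_smul' := fun c v => by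
        ext ij
        by_cases h : ij.2 = j <;> simp [h] }

theorem columnEmbed_apply {d : ℕ} (j : Fin d) (v : Space d) (ij : Fin d × Fin d) :
    columnEmbed j v ij = if ij.2 = j then v ij.1 else 0 := rfl

/-- The product rule: the gradient of `χ v` for a field with value `v` and gradient `A`. -/
noncomputable def cutoffGrad {d : ℕ} (χ : Space d → ℝ) (z : Space d) (v : Space d) (A : Mat d) :
    Mat d :=
  χ z • A + ∑ j, partialDeriv j χ z • columnEmbed j v

theorem cutoffGrad_apply {d : ℕ} (χ : Space d → ℝ) (z : Space d) (v : Space d) (A : Mat d)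
    (i j : Fin d) : cutoffGrad χ z v A (i, j) = χ z * A (i, j) + partialDeriv j χ z * v i := by
  simp [cutoffGrad, columnEmbed_apply]

theorem continuous_partialDeriv_of_contDiff {d : ℕ} {χ : Space d → ℝ} (hχ : ContDiff ℝ ∞ χ)
    (j : Fin d) : Continuous (partialDeriv j χ) :=
  (hχ.continuous_fderiv (by simp)).clm_apply continuous_const

theorem hasCompactSupport_partialDeriv_of_hasCompactSupport {d : ℕ} {χ : Space d → ℝ}
    (hc : HasCompactSupport χ) (j : Fin d) : HasCompactSupport (partialDeriv j χ) :=
  hc.fderiv_apply (𝕜 := ℝ) (EuclideanSpace.single j 1)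

theorem memLp_smul_of_hasCompactSupport {d : ℕ} {E : Type*} [NormedAddCommGroup E]
    [NormedSpace ℝ E] {μ : Measure (Space d)} {f : Space d → E} (hf : MemLp f 2 μ)
    {χ : Space d → ℝ} (hχ : Continuous χ) (hc : HasCompactSupport χ) :
    MemLp (fun z => χ z • f z) 2 μ :=
  hf.smul (hχ.memLp_top_of_hasCompactSupport hc μ)

theorem classicalGrad_apply {d : ℕ} (φ : Space d → Space d) (x : Space d) (i j : Fin d) :
    classicalGrad φ x (i, j) = fderiv ℝ φ x (EuclideanSpace.single j 1) i := rfl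

theorem integral_coord {α : Type*} [MeasurableSpace α] {μ : Measure α} {κ : Type*} [Fintype κ]
    {g : α → EuclideanSpace ℝ κ} (hg : Integrable g μ) (k : κ) :
    (∫ x, g x ∂μ) k = ∫ x, g x k ∂μ :=
  ((EuclideanSpace.proj (𝕜 := ℝ) k).integral_comp_comm hg).symm

theorem integral_clm_coord {α : Type*} [MeasurableSpace α] {μ : Measure α} {d : ℕ}
    {g : α → Space d →L[ℝ] Space d} (hg : Integrable g μ) (e : Space d) (i : Fin d) :
    (∫ x, g x ∂μ) e i = ∫ x, g x e i ∂μ := by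
  rw [ContinuousLinearMap.integral_apply hg, integral_coord (hg.apply_continuousLinearMap e)]

theorem convolution_coord {d : ℕ} {κ : Type*} [Fintype κ] {ρ : Space d → ℝ} (hρ : Continuous ρ)
    (hρc : HasCompactSupport ρ) {F : Space d → EuclideanSpace ℝ κ}
    (hF : LocallyIntegrable F volume) (x : Space d) (k : κ) :
    convolution ρ F (ContinuousLinearMap.lsmul ℝ ℝ) volume x k = ∫ z, ρ (x - z) * F z k := by
  have hex := ((hρc.convolutionExists_left (ContinuousLinearMap.lsmul ℝ ℝ) hρ hF)
    x).integrable_swap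
  rw [convolution_eq_swap, integral_coord hex]
  rfl

/-- The derivative falls on the mollifier, so `F` only has to be locally integrable. -/
theorem fderiv_convolution_coord {d : ℕ} {ρ : Space d → ℝ} (hρ : ContDiff ℝ 1 ρ)
    (hρc : HasCompactSupport ρ) {F : Space d → Space d}
    (hF : LocallyIntegrable F volume) (x e : Space d) (i : Fin d) :
    fderiv ℝ (convolution ρ F (ContinuousLinearMap.lsmul ℝ ℝ) volume) x e i =
      ∫ z, fderiv ℝ ρ (x - z) e * F z i := by
  have hder := hρc.hasFDerivAt_convolution_left (ContinuousLinearMap.lsmul ℝ ℝ) hρ hF x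
  have hDc : Continuous (fderiv ℝ ρ) := hρ.continuous_fderiv (by simp)
  have hDs : HasCompactSupport (fderiv ℝ ρ) := hρc.fderiv (𝕜 := ℝ)
  have hex := ((hDs.convolutionExists_left
    ((ContinuousLinearMap.lsmul ℝ ℝ : ℝ →L[ℝ] Space d →L[ℝ] Space d).precompL (Space d)) hDc hF)
    x).integrable_swap
  rw [hder.fderiv, convolution_eq_swap, integral_clm_coord hex]
  rfl

/-- The gradient of a mollified cut-off Sobolev function is the mollified gradient, provided the
mollifier only uses values inside `Ω`. -/
theorem classicalGrad_convolution {d : ℕ} {Ω : Set (Space d)} (hΩ : MeasurableSet Ω) {v : L2Vec Ω}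
    {A : L2Mat Ω} (hvA : IsWeakGradient Ω v A) {χ : Space d → ℝ} (hχ : ContDiff ℝ ∞ χ)
    (hχc : HasCompactSupport χ) {ρ : Space d → ℝ} (hρ : ContDiff ℝ ∞ ρ) (hρc : HasCompactSupport ρ)
    {x : Space d} (hx : ∀ z ∈ tsupport χ, x - z ∈ tsupport ρ → z ∈ Ω) :
    classicalGrad (convolution ρ (Ω.indicator fun z => χ z • v z)
        (ContinuousLinearMap.lsmul ℝ ℝ) volume) x =
      convolution ρ (Ω.indicator fun z => cutoffGrad χ z (v z) (A z))
        (ContinuousLinearMap.lsmul ℝ ℝ) volume x := by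
  have hF : MemLp (Ω.indicator fun z => χ z • v z) 2 volume :=
    (memLp_indicator_iff_restrict hΩ).2
      (memLp_smul_of_hasCompactSupport (Lp.memLp v) hχ.continuous hχc)
  have hH : MemLp (Ω.indicator fun z => cutoffGrad χ z (v z) (A z)) 2 volume := by
    refine (memLp_indicator_iff_restrict hΩ).2 (MemLp.add
      (memLp_smul_of_hasCompactSupport (Lp.memLp A) hχ.continuous hχc) ?_)
    exact memLp_finsetSum _ fun j _ => memLp_smul_of_hasCompactSupport
      ((columnEmbed j).comp_memLp' (Lp.memLp v)) (continuous_partialDeriv_of_contDiff hχ j)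
      (hasCompactSupport_partialDeriv_of_hasCompactSupport hχc j)
  have hFl := hF.locallyIntegrable (by norm_num)
  have hHl := hH.locallyIntegrable (by norm_num)
  ext ij
  obtain ⟨i, j⟩ := ij
  rw [classicalGrad_apply, fderiv_convolution_coord (hρ.of_le (by simp)) hρc hFl,
    convolution_coord hρ.continuous hρc hHl]
  have h1 : ∫ z, fderiv ℝ ρ (x - z) (EuclideanSpace.single j 1) *
        (Ω.indicator fun z => χ z • v z) z i =
      ∫ z in Ω, v z i * (χ z * partialDeriv j ρ (x - z)) := by
    rw [← integral_indicator hΩ]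
    congr 1 with z
    by_cases hz : z ∈ Ω
    · simp only [Set.indicator_of_mem hz, partialDeriv, PiLp.smul_apply, smul_eq_mul]
      ring
    · simp [Set.indicator_of_notMem hz]
  have h2 : ∫ z, ρ (x - z) * (Ω.indicator fun z => cutoffGrad χ z (v z) (A z)) z (i, j) =
      ∫ z in Ω, (A z (i, j) * (ρ (x - z) * χ z) + v z i * (ρ (x - z) * partialDeriv j χ z)) := by
    rw [← integral_indicator hΩ]
    congr 1 with z
    by_cases hz : z ∈ Ω
    · simp only [Set.indicator_of_mem hz, cutoffGrad_apply]
      ring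
    · simp [Set.indicator_of_notMem hz]
  rw [h1, h2]
  -- The weak gradient is tested with `z ↦ ρ (x - z) χ(z)`. By `hx` its support lies in `Ω`, so no
  -- boundary term arises although the fields are extended by zero.
  set ζ : Space d → ℝ := fun z => ρ (x - z) * χ z with hζ
  have hsub : tsupport ζ ⊆ tsupport χ := tsupport_mul_subset_right
  have htest : IsTestFunction Ω ζ := by
    refine ⟨(hρ.comp (by fun_prop)).mul hχ, hχc.mul_left, fun z hz => hx z (hsub hz) ?_⟩
    have h3 : tsupport ζ ⊆ (fun z => x - z) ⁻¹' tsupport ρ := by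
      refine closure_minimal (fun y hy => ?_) ((isClosed_tsupport ρ).preimage (by fun_prop))
      exact subset_tsupport _ (left_ne_zero_of_mul hy)
    exact h3 hz
  have hpd : ∀ z, partialDeriv j ζ z =
      ρ (x - z) * partialDeriv j χ z - χ z * partialDeriv j ρ (x - z) := by
    intro z
    have e1 : HasFDerivAt (fun z => ρ (x - z)) (-(fderiv ℝ ρ (x - z))) z := by
      have := ((hρ.differentiable (by simp)) (x - z)).hasFDerivAt.comp z
        ((hasFDerivAt_id z).const_sub x)
      refine this.congr_fderiv ?_
      ext
      simp
    have e2 := e1.mul ((hχ.differentiable (by simp)) z).hasFDerivAt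
    have e3 : fderiv ℝ ζ z = ρ (x - z) • fderiv ℝ χ z + χ z • -fderiv ℝ ρ (x - z) := e2.fderiv
    simp only [partialDeriv, e3]
    simp
    ring
  have hw := hvA ζ htest i j
  have hρx : Continuous fun z => ρ (x - z) := hρ.continuous.comp (by fun_prop)
  have i1 : Integrable (fun z => v z i * (ρ (x - z) * partialDeriv j χ z)) (vol Ω) :=
    integrable_coord_mul v i (hρx.mul (continuous_partialDeriv_of_contDiff hχ j))
      (hasCompactSupport_partialDeriv_of_hasCompactSupport hχc j).mul_left
  have i2 : Integrable (fun z => v z i * (χ z * partialDeriv j ρ (x - z))) (vol Ω) :=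
    integrable_coord_mul v i (hχ.continuous.mul
      ((continuous_partialDeriv_of_contDiff hρ j).comp (by fun_prop))) hχc.mul_right
  have i3 : Integrable (fun z => A z (i, j) * (ρ (x - z) * χ z)) (vol Ω) :=
    integrable_coord_mul A (i, j) (hρx.mul hχ.continuous) hχc.mul_left
  simp only [hpd, mul_sub] at hw
  rw [integral_sub i1 i2] at hw
  rw [integral_add i3 i1]
  linarith

/-! ### Density of smooth functions in `H¹(Ω)ᵈ` -/

/-- The mollifier is centred at `-t c` instead of the origin. Its value at `x ∈ Ω` then uses only
points `x + t w` with `w ∈ closedBall c 1`, which `hcone` keeps in `Ω` wherever the cut-off function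
lives. Hence on all of `Ω`, up to the boundary, the gradient of the mollification is the mollified
gradient. -/
theorem exists_approx_cutoff {d : ℕ} {Ω : Set (Space d)} (hΩ : MeasurableSet Ω) {v : L2Vec Ω}
    {A : L2Mat Ω} (hvA : IsWeakGradient Ω v A) {χ : Space d → ℝ} (hχ : ContDiff ℝ ∞ χ)
    (hχc : HasCompactSupport χ) {c : Space d} {t₀ : ℝ} (ht₀ : 0 < t₀)
    (hcone : ∀ x ∈ Ω, ∀ t ∈ Set.Ioo 0 t₀, ∀ w ∈ Metric.closedBall c 1,
      x + t • w ∈ tsupport χ → x + t • w ∈ Ω) {ε : ℝ≥0∞} (hε : 0 < ε) :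
    ∃ φ : Space d → Space d, ContDiff ℝ ∞ φ ∧
      eLpNorm (fun x => φ x - χ x • v x) 2 (vol Ω) ≤ ε ∧
      eLpNorm (fun x => classicalGrad φ x - cutoffGrad χ x (v x) (A x)) 2 (vol Ω) ≤ ε := by
  set F : Space d → Space d := Ω.indicator fun z => χ z • v z with hFdef
  set H : Space d → Mat d := Ω.indicator fun z => cutoffGrad χ z (v z) (A z) with hHdef
  have hF : MemLp F 2 volume :=
    (memLp_indicator_iff_restrict hΩ).2
      (memLp_smul_of_hasCompactSupport (Lp.memLp v) hχ.continuous hχc)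
  have hH : MemLp H 2 volume := by
    refine (memLp_indicator_iff_restrict hΩ).2 (MemLp.add
      (memLp_smul_of_hasCompactSupport (Lp.memLp A) hχ.continuous hχc) ?_)
    exact memLp_finsetSum _ fun j _ => memLp_smul_of_hasCompactSupport
      ((columnEmbed j).comp_memLp' (Lp.memLp v)) (continuous_partialDeriv_of_contDiff hχ j)
      (hasCompactSupport_partialDeriv_of_hasCompactSupport hχc j)
  have hvm : Measurable v := (Lp.stronglyMeasurable v).measurable
  have hAm : Measurable A := (Lp.stronglyMeasurable A).measurable
  have hFm : Measurable F := (hχ.continuous.measurable.smul hvm).indicator hΩ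
  have hHm : Measurable H := by
    refine Measurable.indicator (Measurable.add (hχ.continuous.measurable.smul hAm) ?_) hΩ
    exact Finset.measurable_sum _ fun j _ =>
      (continuous_partialDeriv_of_contDiff hχ j).measurable.smul
        ((columnEmbed j).continuous.measurable.comp hvm)
  obtain ⟨δ₁, hδ₁, h₁⟩ := exists_eLpNorm_translate_le hF hε
  obtain ⟨δ₂, hδ₂, h₂⟩ := exists_eLpNorm_translate_le hH hε
  -- The kernel is supported at distance at most `t (1 + ‖c‖)` from the origin; this must not exceed
  -- the translation thresholds for `F` and `H`, and `t < t₀` is needed for the cone condition.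
  set t : ℝ := min (t₀ / 2) (min δ₁ δ₂ / (1 + ‖c‖)) with ht
  have hc0 : 0 < 1 + ‖c‖ := by positivity
  have ht0 : 0 < t := lt_min (by positivity) (div_pos (lt_min hδ₁ hδ₂) hc0)
  have ht1 : t < t₀ := (min_le_left _ _).trans_lt (by linarith)
  have htδ : t * (1 + ‖c‖) ≤ min δ₁ δ₂ := (le_div_iff₀ hc0).1 (min_le_right _ _)
  let b : ContDiffBump (-(t • c)) := ⟨t / 2, t, by positivity, by linarith⟩
  set ρ : Space d → ℝ := b.normed volume with hρdef
  have hρ : ContDiff ℝ ∞ ρ := b.contDiff_normed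
  have hρc : HasCompactSupport ρ := b.hasCompactSupport_normed
  have hρts : tsupport ρ = Metric.closedBall (-(t • c)) t := b.tsupport_normed_eq
  have hsupp : ∀ s, ρ s ≠ 0 → ‖s‖ ≤ min δ₁ δ₂ := by
    intro s hs
    have h3 : s ∈ tsupport ρ := subset_tsupport _ hs
    rw [hρts, Metric.mem_closedBall, dist_eq_norm, sub_neg_eq_add] at h3
    have h4 : ‖s‖ ≤ ‖s + t • c‖ + ‖t • c‖ := by
      simpa using norm_sub_le (s + t • c) (t • c)
    rw [norm_smul, Real.norm_of_nonneg ht0.le] at h4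
    linarith
  have hρ0 : ∀ s, 0 ≤ ρ s := fun s => b.nonneg_normed s
  have hρ1 : ∫ s, ρ s = 1 := b.integral_normed
  set φ : Space d → Space d :=
    convolution ρ F (ContinuousLinearMap.lsmul ℝ ℝ) volume with hφ
  have hgrad : ∀ x ∈ Ω, classicalGrad φ x =
      convolution ρ H (ContinuousLinearMap.lsmul ℝ ℝ) volume x := by
    intro x hx
    refine classicalGrad_convolution hΩ hvA hχ hχc hρ hρc fun z hz hxz => ?_
    rw [hρts, Metric.mem_closedBall, dist_eq_norm, sub_neg_eq_add] at hxz
    have h5 : x + t • (t⁻¹ • (z - x)) = z := by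
      rw [smul_smul, mul_inv_cancel₀ ht0.ne', one_smul, add_sub_cancel]
    rw [← h5] at hz ⊢
    refine hcone x hx t ⟨ht0, ht1⟩ _ ?_ hz
    have h6 : t⁻¹ • (z - x) - c = -(t⁻¹ • (x - z + t • c)) := by
      rw [smul_add, smul_smul, inv_mul_cancel₀ ht0.ne', one_smul, ← neg_sub z x]
      module
    rw [Metric.mem_closedBall, dist_eq_norm, h6, norm_neg, norm_smul, norm_inv,
      Real.norm_of_nonneg ht0.le, inv_mul_le_iff₀ ht0, mul_one]
    exact hxz
  refine ⟨φ, ?_, ?_, ?_⟩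
  · exact hρc.contDiff_convolution_left _ hρ (hF.locallyIntegrable (by norm_num))
  · refine le_trans ?_ (eLpNorm_convolution_sub_le hFm hF h₁ hρ.continuous hρc hρ0 hρ1
      fun s hs => (hsupp s hs).trans (min_le_left _ _))
    refine le_trans (le_of_eq (eLpNorm_congr_ae ?_)) (eLpNorm_mono_measure _ Measure.restrict_le_self)
    filter_upwards [ae_restrict_mem hΩ] with x hx
    simp only [hFdef, hφ, Set.indicator_of_mem hx]
  · refine le_trans ?_ (eLpNorm_convolution_sub_le hHm hH h₂ hρ.continuous hρc hρ0 hρ1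
      fun s hs => (hsupp s hs).trans (min_le_right _ _))
    refine le_trans (le_of_eq (eLpNorm_congr_ae ?_)) (eLpNorm_mono_measure _ Measure.restrict_le_self)
    filter_upwards [ae_restrict_mem hΩ] with x hx
    rw [hgrad x hx]
    simp only [hHdef, Set.indicator_of_mem hx]

/-- A smooth partition of unity on the closure of `Ω` whose members are supported in `Ω` or in the
sets of a cover of the boundary. -/
theorem GraphCover.exists_partition {d : ℕ} {Ω : Set (Space d)} (K : GraphCover Ω)
    (hΩ : IsOpen Ω) (hb : Bornology.IsBounded Ω) :
    ∃ χ : Option K.ι → Space d → ℝ, (∀ o, ContDiff ℝ ∞ (χ o)) ∧ (∀ o, HasCompactSupport (χ o)) ∧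
      tsupport (χ none) ⊆ Ω ∧ (∀ i, tsupport (χ (some i)) ⊆ K.B i) ∧
      ∀ x ∈ closure Ω, ∑ o, χ o x = 1 := by
  let U : Option K.ι → Set (Space d) := fun o => o.elim Ω K.B
  have hU : ∀ o, IsOpen (U o) := fun o => by
    cases o with
    | none => exact hΩ
    | some i => exact K.isOpen i
  have hUb : ∀ o, Bornology.IsBounded (U o) := fun o => by
    cases o with
    | none => exact hb
    | some i => exact (K.adapted i).isBounded
  have hcov : closure Ω ⊆ ⋃ o, U o := by
    intro x hx
    by_cases h : x ∈ Ω
    · exact Set.mem_iUnion.2 ⟨none, h⟩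
    · have hf : x ∈ frontier Ω := by
        rw [hΩ.frontier_eq]
        exact ⟨hx, h⟩
      obtain ⟨i, hi⟩ := Set.mem_iUnion.1 (K.cover hf)
      exact Set.mem_iUnion.2 ⟨some i, hi⟩
  obtain ⟨f, hf⟩ := SmoothPartitionOfUnity.exists_isSubordinate (modelWithCornersSelf ℝ (Space d))
    isClosed_closure U hU hcov
  refine ⟨fun o => f o, fun o => (f o).contMDiff.contDiff, fun o => ?_, hf none, fun i => hf (some i),
    fun x hx => ?_⟩
  · exact Metric.isCompact_of_isClosed_isBounded (isClosed_tsupport _) ((hUb o).subset (hf o))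
  · rw [← finsum_eq_sum_of_fintype]
    exact f.sum_eq_one hx

theorem continuous_classicalGrad {d : ℕ} {φ : Space d → Space d} (hφ : ContDiff ℝ ∞ φ) :
    Continuous (classicalGrad φ) := by
  have h1 : Continuous (fderiv ℝ φ) := hφ.continuous_fderiv (by simp)
  refine (PiLp.continuous_toLp 2 _).comp (continuous_pi fun ij => ?_)
  exact (EuclideanSpace.proj (𝕜 := ℝ) ij.1).continuous.comp (h1.clm_apply continuous_const)

theorem classicalGrad_sum {d : ℕ} {κ : Type*} (s : Finset κ) {φ : κ → Space d → Space d}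
    (hφ : ∀ o, Differentiable ℝ (φ o)) (x : Space d) :
    classicalGrad (fun x => ∑ o ∈ s, φ o x) x = ∑ o ∈ s, classicalGrad (φ o) x := by
  ext ij
  obtain ⟨i, j⟩ := ij
  rw [classicalGrad_apply, fderiv_fun_sum fun o _ => hφ o x]
  simp [classicalGrad_apply]

/-- A short step back from the compact support of `χ` stays in `U`. There `Ω` is `{0 < g}`, and `g`
increases along the directions of the cone. -/
theorem LocalGraph.exists_cone {d : ℕ} {Ω : Set (Space d)} (G : LocalGraph Ω) {χ : Space d → ℝ}
    (hχ : HasCompactSupport χ) (hsub : tsupport χ ⊆ G.U) :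
    ∃ t₀ : ℝ, 0 < t₀ ∧ ∀ x ∈ Ω, ∀ t ∈ Set.Ioo 0 t₀, ∀ w ∈ Metric.closedBall (G.k • G.e) 1,
      x + t • w ∈ tsupport χ → x + t • w ∈ Ω := by
  obtain ⟨η, hη, hball⟩ := hχ.isCompact.exists_thickening_subset_open G.isOpen hsub
  have hN : 0 < G.k + G.M := by linarith [G.k_nonneg, G.one_le_M]
  refine ⟨η / (G.k + G.M), by positivity, fun x hx t ht w hw hz => ?_⟩
  have hwW : w ∈ G.W := Metric.closedBall_subset_closedBall G.one_le_M hw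
  have hxU : x ∈ G.U := by
    refine hball (Metric.mem_thickening_iff.2 ⟨_, hz, ?_⟩)
    rw [dist_eq_norm, sub_add_cancel_left, norm_neg, norm_smul, Real.norm_of_nonneg ht.1.le]
    calc t * ‖w‖ ≤ t * (G.k + G.M) :=
          mul_le_mul_of_nonneg_left (G.norm_le_of_mem_W hwW) ht.1.le
      _ < η := (lt_div_iff₀ hN).1 ht.2
  rw [G.mem_iff _ (hsub hz)]
  have h1 := (G.mem_iff _ hxU).1 hx
  have h2 := G.mono w hwW x t ht.1.le
  linarith [ht.1]

/-- The function is split by the partition of unity, and each piece is mollified with a shift into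
`Ω` that suits its chart. -/
theorem GraphCover.exists_smooth_approx {d : ℕ} {Ω : Set (Space d)} (K : GraphCover Ω)
    (hΩ : IsOpen Ω) (hb : Bornology.IsBounded Ω) (v : H1 Ω) {ε : ℝ≥0∞} (hε : 0 < ε) :
    ∃ φ : Space d → Space d, ContDiff ℝ ∞ φ ∧
      eLpNorm (fun x => φ x - val v x) 2 (vol Ω) ≤ ε ∧
      eLpNorm (fun x => classicalGrad φ x - grad v x) 2 (vol Ω) ≤ ε := by
  obtain ⟨χ, hχ, hχc, hχ0, hχB, hχ1⟩ := K.exists_partition hΩ hb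
  set N : ℝ≥0∞ := (Fintype.card (Option K.ι) : ℝ≥0∞) with hN
  have hεN : 0 < ε / N := ENNReal.div_pos hε.ne' (ENNReal.natCast_ne_top _)
  have hex : ∀ o, ∃ φ : Space d → Space d, ContDiff ℝ ∞ φ ∧
      eLpNorm (fun x => φ x - χ o x • val v x) 2 (vol Ω) ≤ ε / N ∧
      eLpNorm (fun x => classicalGrad φ x - cutoffGrad (χ o) x (val v x) (grad v x)) 2 (vol Ω) ≤
        ε / N := by
    intro o
    cases o with
    | none =>
      -- The interior piece needs no shift: its support lies in `Ω`, so the cone condition is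
      -- trivial.
      exact exists_approx_cutoff (c := 0) hΩ.measurableSet v.2 (hχ _) (hχc _) one_pos
        (fun x _ t _ w _ hz => hχ0 hz) hεN
    | some i =>
      obtain ⟨t₀, ht₀, hcone⟩ := (K.G i).exists_cone (hχc (some i)) ((hχB i).trans (K.subset i))
      exact exists_approx_cutoff hΩ.measurableSet v.2 (hχ _) (hχc _) ht₀ hcone hεN
  choose φ hφ hφ1 hφ2 using hex
  have hvm : AEStronglyMeasurable (val v) (vol Ω) := Lp.aestronglyMeasurable _
  have hAm : AEStronglyMeasurable (grad v) (vol Ω) := Lp.aestronglyMeasurable _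
  have hcut : ∀ o, AEStronglyMeasurable (fun x => cutoffGrad (χ o) x (val v x) (grad v x))
      (vol Ω) := fun o => by
    refine ((hχ o).continuous.aestronglyMeasurable.smul hAm).add ?_
    refine Finset.aestronglyMeasurable_fun_sum _ fun j _ => ?_
    exact (continuous_partialDeriv_of_contDiff (hχ o) j).aestronglyMeasurable.smul
      ((columnEmbed j).continuous.comp_aestronglyMeasurable hvm)
  -- The partition sums to one near every point of the open set `Ω`, so the terms of `cutoffGrad`
  -- that contain derivatives of the cut-off functions cancel in the sum.
  have hpsum : ∀ x ∈ Ω, ∀ j, ∑ o, partialDeriv j (χ o) x = 0 := by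
    intro x hx j
    have h1 : (fun x => ∑ o, χ o x) =ᶠ[𝓝 x] fun _ => 1 := by
      filter_upwards [hΩ.mem_nhds hx] with y hy
      exact hχ1 y (subset_closure hy)
    have h2 : fderiv ℝ (fun x => ∑ o, χ o x) x = 0 := by
      rw [h1.fderiv_eq]; simp
    rw [fderiv_fun_sum fun o _ => (hχ o).differentiable (by simp) x] at h2
    have h3 := congrArg (fun L : Space d →L[ℝ] ℝ => L (EuclideanSpace.single j 1)) h2
    simpa [partialDeriv] using h3
  have hsumle : ∀ {E : Type} [NormedAddCommGroup E] (f : Option K.ι → Space d → E),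
      (∀ o, AEStronglyMeasurable (f o) (vol Ω)) → (∀ o, eLpNorm (f o) 2 (vol Ω) ≤ ε / N) →
      eLpNorm (∑ o, f o) 2 (vol Ω) ≤ ε := by
    intro E _ f hf hle
    refine (eLpNorm_sum_le (fun o _ => hf o) (by norm_num)).trans ?_
    refine (Finset.sum_le_sum fun o _ => hle o).trans ?_
    rw [Finset.sum_const, Finset.card_univ, nsmul_eq_mul]
    exact ENNReal.mul_div_le
  refine ⟨fun x => ∑ o, φ o x, ContDiff.sum fun o _ => hφ o, ?_, ?_⟩
  · refine le_trans (le_of_eq (eLpNorm_congr_ae ?_)) (hsumle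
      (fun o x => φ o x - χ o x • val v x) (fun o => (hφ o).continuous.aestronglyMeasurable.sub ((hχ o).continuous.aestronglyMeasurable.smul hvm))
      hφ1)
    filter_upwards [ae_restrict_mem hΩ.measurableSet] with x hx
    simp only [Finset.sum_apply]
    rw [Finset.sum_sub_distrib, ← Finset.sum_smul,
      hχ1 x (subset_closure hx), one_smul]
  · refine le_trans (le_of_eq (eLpNorm_congr_ae ?_)) (hsumle
      (fun o x => classicalGrad (φ o) x - cutoffGrad (χ o) x (val v x) (grad v x))
      (fun o => (continuous_classicalGrad (hφ o)).aestronglyMeasurable.sub (hcut o)) hφ2)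
    filter_upwards [ae_restrict_mem hΩ.measurableSet] with x hx
    simp only [Finset.sum_apply]
    rw [Finset.sum_sub_distrib,
      classicalGrad_sum _ fun o => (hφ o).differentiable (by simp)]
    congr 1
    simp only [cutoffGrad]
    rw [Finset.sum_add_distrib, ← Finset.sum_smul, hχ1 x (subset_closure hx), one_smul,
      Finset.sum_comm]
    simp [← Finset.sum_smul, hpsum x hx]

/-! ### The trace operator -/

theorem eLpNorm_two_sq {α E : Type*} [MeasurableSpace α] [NormedAddCommGroup E] (μ : Measure α)
    (f : α → E) : eLpNorm f 2 μ ^ 2 = ∫⁻ x, ‖f x‖ₑ ^ 2 ∂μ := by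
  rw [eLpNorm_eq_lintegral_rpow_enorm_toReal (by norm_num) (by norm_num), ← ENNReal.rpow_natCast,
    ← ENNReal.rpow_mul]
  simp

theorem energy_eq {d : ℕ} (Ω : Set (Space d)) (φ : Space d → Space d) :
    energy Ω φ = eLpNorm φ 2 (vol Ω) ^ 2 + eLpNorm (classicalGrad φ) 2 (vol Ω) ^ 2 := by
  rw [energy, eLpNorm_two_sq, eLpNorm_two_sq]

theorem classicalGrad_add_smul {d : ℕ} {φ ψ : Space d → Space d} (hφ : Differentiable ℝ φ)
    (hψ : Differentiable ℝ ψ) (c : ℝ) (x : Space d) :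
    classicalGrad (fun x => φ x + c • ψ x) x = classicalGrad φ x + c • classicalGrad ψ x := by
  ext ij
  obtain ⟨i, j⟩ := ij
  have h : HasFDerivAt (fun x => φ x + c • ψ x) (fderiv ℝ φ x + c • fderiv ℝ ψ x) x :=
    (hφ x).hasFDerivAt.add ((hψ x).hasFDerivAt.const_smul c)
  rw [classicalGrad_apply, h.fderiv]
  simp [classicalGrad_apply]

theorem tendsto_eLpNorm_add_smul {α E : Type*} [MeasurableSpace α] [NormedAddCommGroup E]
    [NormedSpace ℝ E] {μ : Measure α} {a b F : ℕ → α → E}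
    (ha : ∀ n, AEStronglyMeasurable (a n) μ) (hb : ∀ n, AEStronglyMeasurable (b n) μ)
    (ha0 : Tendsto (fun n => eLpNorm (a n) 2 μ) atTop (𝓝 0))
    (hb0 : Tendsto (fun n => eLpNorm (b n) 2 μ) atTop (𝓝 0)) (c : ℝ)
    (hF : ∀ n, F n =ᵐ[μ] fun x => a n x + c • b n x) :
    Tendsto (fun n => eLpNorm (F n) 2 μ) atTop (𝓝 0) := by
  have h1 : Tendsto (fun n => eLpNorm (a n) 2 μ + ‖c‖ₑ * eLpNorm (b n) 2 μ) atTop (𝓝 0) := by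
    have := ha0.add (ENNReal.Tendsto.const_mul hb0 (Or.inr (enorm_ne_top (x := c))))
    simpa using this
  refine tendsto_of_tendsto_of_tendsto_of_le_of_le tendsto_const_nhds h1 (fun _ => zero_le)
    fun n => ?_
  dsimp only
  rw [eLpNorm_congr_ae (hF n), ← eLpNorm_const_smul]
  exact eLpNorm_add_le (ha n) ((hb n).const_smul c) (by norm_num)

theorem hasTrace_add_smul {d : ℕ} {Ω : Set (Space d)} {v w : H1 Ω} {g h : L2Bdry Ω}
    (hv : HasTrace v g) (hw : HasTrace w h) (c : ℝ) : HasTrace (v + c • w) (g + c • h) := by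
  obtain ⟨φ, hφ, hφ1, hφ2, hφ3⟩ := hv
  obtain ⟨ψ, hψ, hψ1, hψ2, hψ3⟩ := hw
  refine ⟨fun n x => φ n x + c • ψ n x, fun n => (hφ n).add ((hψ n).const_smul c), ?_, ?_, ?_⟩
  · refine tendsto_eLpNorm_add_smul
      (fun n => (hφ n).continuous.aestronglyMeasurable.sub (Lp.aestronglyMeasurable _))
      (fun n => (hψ n).continuous.aestronglyMeasurable.sub (Lp.aestronglyMeasurable _))
      hφ1 hψ1 c fun n => ?_
    have e : val (v + c • w) = val v + c • val w := rfl
    rw [e]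
    filter_upwards [Lp.coeFn_add (val v) (c • val w), Lp.coeFn_smul c (val w)] with x h1 h2
    rw [h1, Pi.add_apply, h2, Pi.smul_apply, Pi.sub_apply, Pi.sub_apply, smul_sub]
    abel
  · refine tendsto_eLpNorm_add_smul
      (fun n => (continuous_classicalGrad (hφ n)).aestronglyMeasurable.sub
        (Lp.aestronglyMeasurable _))
      (fun n => (continuous_classicalGrad (hψ n)).aestronglyMeasurable.sub
        (Lp.aestronglyMeasurable _))
      hφ2 hψ2 c fun n => ?_
    have e : grad (v + c • w) = grad v + c • grad w := rfl
    rw [e]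
    filter_upwards [Lp.coeFn_add (grad v) (c • grad w), Lp.coeFn_smul c (grad w)] with x h1 h2
    rw [classicalGrad_add_smul ((hφ n).differentiable (by simp))
      ((hψ n).differentiable (by simp))]
    rw [h1, Pi.add_apply, h2, Pi.smul_apply, Pi.sub_apply, Pi.sub_apply, smul_sub]
    abel
  · refine tendsto_eLpNorm_add_smul
      (fun n => (hφ n).continuous.aestronglyMeasurable.sub (Lp.aestronglyMeasurable _))
      (fun n => (hψ n).continuous.aestronglyMeasurable.sub (Lp.aestronglyMeasurable _))
      hφ3 hψ3 c fun n => ?_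
    filter_upwards [Lp.coeFn_add g (c • h), Lp.coeFn_smul c h] with x h1 h2
    rw [h1, Pi.add_apply, h2, Pi.smul_apply, Pi.sub_apply, Pi.sub_apply, smul_sub]
    abel

theorem hasTrace_add {d : ℕ} {Ω : Set (Space d)} {v w : H1 Ω} {g h : L2Bdry Ω}
    (hv : HasTrace v g) (hw : HasTrace w h) : HasTrace (v + w) (g + h) := by
  simpa using hasTrace_add_smul hv hw 1

theorem hasTrace_sub {d : ℕ} {Ω : Set (Space d)} {v w : H1 Ω} {g h : L2Bdry Ω}
    (hv : HasTrace v g) (hw : HasTrace w h) : HasTrace (v - w) (g - h) := by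
  simpa [sub_eq_add_neg] using hasTrace_add_smul hv hw (-1)

/-! ### Existence and boundedness of traces -/

namespace GraphCover

variable {d : ℕ} {Ω : Set (Space d)} (K : GraphCover Ω)

include K in
-- Smooth approximations with errors `2⁻ⁿ` form a Cauchy sequence in `L²(Γ)ᵈ` by the trace
-- inequality for smooth functions, and the limit is a trace.
theorem exists_hasTrace (hΩ : IsOpen Ω) (hb : Bornology.IsBounded Ω) (v : H1 Ω) :
    ∃ g : L2Bdry Ω, HasTrace v g := by
  obtain ⟨C, hC, hsq⟩ := K.exists_lintegral_sq_le hΩ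
  have hε : ∀ n : ℕ, 0 < (1 : ℝ≥0∞) / 2 ^ n := fun n =>
    ENNReal.div_pos one_ne_zero (ENNReal.pow_ne_top (by norm_num))
  choose φ hφ h1 h2 using fun n => K.exists_smooth_approx hΩ hb v (hε n)
  have hεlim : Tendsto (fun n : ℕ => (1 : ℝ≥0∞) / 2 ^ n) atTop (𝓝 0) := by
    have := ENNReal.tendsto_pow_atTop_nhds_zero_of_lt_one (r := 2⁻¹)
      (ENNReal.inv_lt_one.2 (by norm_num))
    refine this.congr fun n => ?_
    rw [one_div, ENNReal.inv_pow]
  have hsq' : ∀ ψ : Space d → Space d, ContDiff ℝ ∞ ψ → eLpNorm ψ 2 (surf Ω) ^ 2 ≤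
      C * (eLpNorm ψ 2 (vol Ω) ^ 2 + eLpNorm (classicalGrad ψ) 2 (vol Ω) ^ 2) := fun ψ hψ => by
    rw [eLpNorm_two_sq, ← energy_eq]
    exact hsq ψ (hψ.of_le (by simp))
  have hm1 : ∀ n, AEStronglyMeasurable (fun x => φ n x - val v x) (vol Ω) := fun n =>
    (hφ n).continuous.aestronglyMeasurable.sub (Lp.aestronglyMeasurable _)
  have hm2 : ∀ n, AEStronglyMeasurable (fun x => classicalGrad (φ n) x - grad v x) (vol Ω) :=
    fun n => (continuous_classicalGrad (hφ n)).aestronglyMeasurable.sub (Lp.aestronglyMeasurable _)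
  have hmem : ∀ n, MemLp (φ n) 2 (surf Ω) := by
    intro n
    refine ⟨(hφ n).continuous.aestronglyMeasurable, ?_⟩
    have e1 : MemLp (φ n) 2 (vol Ω) := by
      have : MemLp (fun x => φ n x - val v x) 2 (vol Ω) :=
        ⟨hm1 n, (h1 n).trans_lt (ENNReal.div_lt_top (by norm_num) (by simp))⟩
      have e3 := this.add (Lp.memLp (val v))
      have e4 : (fun x => φ n x - val v x) + (val v : Space d → Space d) = φ n := by
        ext1 x; simp
      rwa [e4] at e3
    have e2 : MemLp (classicalGrad (φ n)) 2 (vol Ω) := by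
      have : MemLp (fun x => classicalGrad (φ n) x - grad v x) 2 (vol Ω) :=
        ⟨hm2 n, (h2 n).trans_lt (ENNReal.div_lt_top (by norm_num) (by simp))⟩
      have e3 := this.add (Lp.memLp (grad v))
      have e4 : (fun x => classicalGrad (φ n) x - grad v x) + (grad v : Space d → Mat d) =
          classicalGrad (φ n) := by
        ext1 x; simp
      rwa [e4] at e3
    have e5 := (hsq' (φ n) (hφ n)).trans_lt (ENNReal.mul_lt_top hC.lt_top (ENNReal.add_lt_top.2
      ⟨ENNReal.pow_lt_top e1.2, ENNReal.pow_lt_top e2.2⟩))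
    by_contra h
    rw [not_lt, top_le_iff] at h
    simp [h] at e5
  set T : ℕ → L2Bdry Ω := fun n => (hmem n).toLp (φ n) with hT
  -- The energy of a difference is at most `2 (2ε)² = 8ε²`; bounding `8C` by `(8C + 1)²` avoids a
  -- square root.
  have hdist : ∀ n, edist (T n) (T (n + 1)) ≤ (8 * C + 1) / 2 ^ n := by
    intro n
    set ε : ℝ≥0∞ := 1 / 2 ^ n with hεn
    have hmono : (1 : ℝ≥0∞) / 2 ^ (n + 1) ≤ ε := by
      rw [hεn]
      gcongr
      · norm_num
      · omega
    have hψ : ContDiff ℝ ∞ fun x => φ n x + (-1 : ℝ) • φ (n + 1) x :=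
      (hφ n).add ((hφ (n + 1)).const_smul _)
    have e1 : eLpNorm (fun x => φ n x + (-1 : ℝ) • φ (n + 1) x) 2 (vol Ω) ≤ 2 * ε := by
      have : (fun x => φ n x + (-1 : ℝ) • φ (n + 1) x) =
          (fun x => φ n x - val v x) - fun x => φ (n + 1) x - val v x := by
        ext1 x
        simp only [Pi.sub_apply]
        module
      rw [this, two_mul]
      exact (eLpNorm_sub_le (hm1 n) (hm1 (n + 1)) (by norm_num)).trans
        (add_le_add (h1 n) ((h1 (n + 1)).trans hmono))
    have e2 : eLpNorm (classicalGrad fun x => φ n x + (-1 : ℝ) • φ (n + 1) x) 2 (vol Ω) ≤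
        2 * ε := by
      have : (classicalGrad fun x => φ n x + (-1 : ℝ) • φ (n + 1) x) =
          (fun x => classicalGrad (φ n) x - grad v x) -
            fun x => classicalGrad (φ (n + 1)) x - grad v x := by
        ext1 x
        rw [classicalGrad_add_smul ((hφ n).differentiable (by simp))
          ((hφ (n + 1)).differentiable (by simp))]
        simp only [Pi.sub_apply]
        module
      rw [this, two_mul]
      exact (eLpNorm_sub_le (hm2 n) (hm2 (n + 1)) (by norm_num)).trans
        (add_le_add (h2 n) ((h2 (n + 1)).trans hmono))
    rw [hT, Lp.edist_toLp_toLp]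
    have e3 : φ n - φ (n + 1) = fun x => φ n x + (-1 : ℝ) • φ (n + 1) x := by
      ext1 x
      simp [sub_eq_add_neg]
    rw [e3, ← ENNReal.pow_le_pow_left_iff (n := 2) (by norm_num)]
    calc _ ≤ C * ((2 * ε) ^ 2 + (2 * ε) ^ 2) := (hsq' _ hψ).trans (by gcongr)
      _ = 8 * C * ε ^ 2 := by ring
      _ ≤ (8 * C + 1) ^ 2 * ε ^ 2 := by
          gcongr
          calc 8 * C ≤ 8 * C + 1 := le_self_add
            _ ≤ (8 * C + 1) ^ 2 := le_self_pow₀ le_add_self (by norm_num)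
      _ = ((8 * C + 1) / 2 ^ n) ^ 2 := by
          rw [hεn, ← mul_pow, mul_one_div]
  have hcau : CauchySeq T := cauchySeq_of_edist_le_geometric_two (8 * C + 1)
    (ENNReal.add_ne_top.2 ⟨ENNReal.mul_ne_top (by norm_num) hC, by norm_num⟩) hdist
  obtain ⟨g, hg⟩ := cauchySeq_tendsto_of_complete hcau
  refine ⟨g, φ, hφ, ?_, ?_, ?_⟩
  · exact tendsto_of_tendsto_of_tendsto_of_le_of_le tendsto_const_nhds hεlim
      (fun _ => zero_le) h1
  · exact tendsto_of_tendsto_of_tendsto_of_le_of_le tendsto_const_nhds hεlim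
      (fun _ => zero_le) h2
  · rw [Lp.tendsto_Lp_iff_tendsto_eLpNorm'] at hg
    refine hg.congr fun n => eLpNorm_congr_ae ?_
    filter_upwards [(hmem n).coeFn_toLp] with x hx
    simp only [Pi.sub_apply, hT, hx]

theorem _root_.norm_H1_sq {d : ℕ} {Ω : Set (Space d)} (v : H1 Ω) :
    ‖v‖ ^ 2 = ‖val v‖ ^ 2 + ‖grad v‖ ^ 2 :=
  WithLp.prod_norm_sq_eq_of_L2 (v : WithLp 2 (L2Vec Ω × L2Mat Ω))

theorem _root_.enorm_H1_sq {d : ℕ} {Ω : Set (Space d)} (v : H1 Ω) :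
    ‖v‖ₑ ^ 2 = ‖val v‖ₑ ^ 2 + ‖grad v‖ₑ ^ 2 := by
  simp only [← ofReal_norm, ← ENNReal.ofReal_pow (norm_nonneg _)]
  rw [norm_H1_sq, ENNReal.ofReal_add (by positivity) (by positivity)]

include K in
/-- The trace theorem: traces of `H¹(Ω)ᵈ`-functions are bounded in `H^{1/2}(Γ)ᵈ`. -/
theorem exists_enorm_trace_le (hd : 2 ≤ d) (hΩ : IsOpen Ω) (hb : Bornology.IsBounded Ω) :
    ∃ C : ℝ≥0∞, C ≠ ⊤ ∧ ∀ (v : H1 Ω) (g : L2Bdry Ω), HasTrace v g →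
      ‖g‖ₑ ^ 2 ≤ C * ‖v‖ₑ ^ 2 ∧ slobodeckijSq g ≤ C * ‖v‖ₑ ^ 2 := by
  have hfin := K.isFiniteMeasure_surf hΩ
  obtain ⟨C₁, hC₁, hsq⟩ := K.exists_lintegral_sq_le hΩ
  obtain ⟨C₂, hC₂, hslo⟩ := K.exists_lintegral_slobodeckij_le hd hΩ hb
  refine ⟨C₁ + C₂, ENNReal.add_ne_top.2 ⟨hC₁, hC₂⟩, fun v g hvg => ?_⟩
  obtain ⟨φ, hφ, hφ1, hφ2, hφ3⟩ := hvg
  have hE : Tendsto (fun n => (eLpNorm (fun x => φ n x - val v x) 2 (vol Ω) + ‖val v‖ₑ) ^ 2 +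
      (eLpNorm (fun x => classicalGrad (φ n) x - grad v x) 2 (vol Ω) + ‖grad v‖ₑ) ^ 2) atTop
      (𝓝 (‖v‖ₑ ^ 2)) := by
    rw [enorm_H1_sq]
    have e1 := ENNReal.Tendsto.pow (n := 2) (hφ1.add_const ‖val v‖ₑ)
    have e2 := ENNReal.Tendsto.pow (n := 2) (hφ2.add_const ‖grad v‖ₑ)
    simpa using e1.add e2
  have hEle : ∀ n, energy Ω (φ n) ≤
      (eLpNorm (fun x => φ n x - val v x) 2 (vol Ω) + ‖val v‖ₑ) ^ 2 +
      (eLpNorm (fun x => classicalGrad (φ n) x - grad v x) 2 (vol Ω) + ‖grad v‖ₑ) ^ 2 := by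
    intro n
    rw [energy_eq]
    gcongr
    · have : φ n = (fun x => φ n x - val v x) + (val v : Space d → Space d) := by
        ext1 x; simp
      conv_lhs => rw [this]
      rw [Lp.enorm_def]
      exact eLpNorm_add_le ((hφ n).continuous.aestronglyMeasurable.sub
        (Lp.aestronglyMeasurable _)) (Lp.aestronglyMeasurable _) one_le_two
    · have : classicalGrad (φ n) =
          (fun x => classicalGrad (φ n) x - grad v x) + (grad v : Space d → Mat d) := by
        ext1 x; simp
      conv_lhs => rw [this]
      rw [Lp.enorm_def]
      exact eLpNorm_add_le ((continuous_classicalGrad (hφ n)).aestronglyMeasurable.sub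
        (Lp.aestronglyMeasurable _)) (Lp.aestronglyMeasurable _) one_le_two
  -- Convergence in `L²(Γ)ᵈ` gives a subsequence converging almost everywhere, after which Fatou's
  -- lemma, applied twice for the double integral, transfers the smooth estimates to `g`.
  obtain ⟨ns, hns, hae⟩ := (tendstoInMeasure_of_tendsto_eLpNorm (μ := surf Ω) (p := 2)
    (by norm_num) (fun n => (hφ n).continuous.aestronglyMeasurable)
    (Lp.aestronglyMeasurable g) hφ3).exists_seq_tendsto_ae
  have hlim : ∀ {C : ℝ≥0∞}, C ≠ ⊤ → ∀ {I : ℕ → ℝ≥0∞}, (∀ n, I n ≤ C * energy Ω (φ n)) →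
      liminf (fun k => I (ns k)) atTop ≤ C * ‖v‖ₑ ^ 2 := by
    intro C hC I hI
    have h1 := (ENNReal.Tendsto.const_mul hE (Or.inr hC)).comp hns.tendsto_atTop
    rw [← h1.liminf_eq]
    refine liminf_le_liminf (Eventually.of_forall fun k => ?_)
    exact (hI _).trans (mul_le_mul_right (hEle _) _)
  constructor
  · have h1 : ‖g‖ₑ ^ 2 = ∫⁻ x, ‖g x‖ₑ ^ 2 ∂(surf Ω) := by
      rw [Lp.enorm_def, eLpNorm_two_sq]
    rw [h1, add_mul]
    refine le_trans ?_ le_self_add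
    refine le_trans ?_ (hlim hC₁ (I := fun n => ∫⁻ x, ‖φ n x‖ₑ ^ 2 ∂(surf Ω))
      fun n => hsq (φ n) ((hφ n).of_le (by simp)))
    refine le_trans ?_ (lintegral_liminf_le (μ := surf Ω)
      (f := fun k x => ‖φ (ns k) x‖ₑ ^ 2) fun k => (hφ (ns k)).continuous.measurable.enorm.pow_const 2)
    refine lintegral_mono_ae ?_
    filter_upwards [hae] with x hx
    rw [← (ENNReal.Tendsto.pow (n := 2) ((continuous_enorm.tendsto _).comp hx)).liminf_eq]
    rfl
  · rw [add_mul]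
    refine le_trans ?_ le_add_self
    have hm : ∀ k, Measurable fun p : Space d × Space d =>
        edist (φ (ns k) p.1) (φ (ns k) p.2) ^ 2 / edist p.1 p.2 ^ d := fun k => by
      have := (hφ (ns k)).continuous.measurable
      fun_prop
    have hm' : ∀ k x, Measurable fun y : Space d =>
        edist (φ (ns k) x) (φ (ns k) y) ^ 2 / edist x y ^ d := fun k x => by
      have := (hφ (ns k)).continuous.measurable
      fun_prop
    refine le_trans ?_ (hlim hC₂ (I := fun n => ∫⁻ x, (∫⁻ y,
      edist (φ n x) (φ n y) ^ 2 / edist x y ^ d ∂(surf Ω)) ∂(surf Ω))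
      fun n => hslo (φ n) ((hφ n).of_le (by simp)))
    refine le_trans ?_ (lintegral_liminf_le (μ := surf Ω)
      (f := fun k x => ∫⁻ y, edist (φ (ns k) x) (φ (ns k) y) ^ 2 / edist x y ^ d ∂(surf Ω))
      fun k => (hm k).lintegral_prod_right')
    refine lintegral_mono_ae ?_
    filter_upwards [hae] with x hx
    refine le_trans ?_ (lintegral_liminf_le (μ := surf Ω)
      (f := fun k y => edist (φ (ns k) x) (φ (ns k) y) ^ 2 / edist x y ^ d)
      fun k => hm' k x)
    refine lintegral_mono_ae ?_
    filter_upwards [hae] with y hy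
    -- On the diagonal the quotient is `0 / 0`, which is `0` in `ℝ≥0∞`.
    rcases eq_or_ne x y with rfl | hne
    · simp
    · have h3 : Tendsto (fun k => edist (φ (ns k) x) (φ (ns k) y) ^ 2 / edist x y ^ d) atTop
          (𝓝 (edist (g x) (g y) ^ 2 / edist x y ^ d)) :=
        ENNReal.Tendsto.div_const (ENNReal.Tendsto.pow (hx.edist hy))
          (Or.inr (pow_ne_zero _ (edist_pos.2 hne).ne'))
      exact h3.liminf_eq.symm.le

include K in
-- Membership in `HHalf Ω` belongs to the conclusion because `hHalfNorm` uses `toReal`, which would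
-- turn an infinite seminorm into zero.
theorem exists_hHalfNorm_trace_le (hd : 2 ≤ d) (hΩ : IsOpen Ω) (hb : Bornology.IsBounded Ω) :
    ∃ C : ℝ, 0 ≤ C ∧ ∀ (v : H1 Ω) (g : L2Bdry Ω), HasTrace v g →
      g ∈ HHalf Ω ∧ hHalfNorm g ≤ C * ‖v‖ := by
  obtain ⟨C, hC, h⟩ := K.exists_enorm_trace_le hd hΩ hb
  refine ⟨Real.sqrt (2 * C.toReal), Real.sqrt_nonneg _, fun v g hvg => ?_⟩
  obtain ⟨h1, h2⟩ := h v g hvg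
  have hfin : C * ‖v‖ₑ ^ 2 ≠ ⊤ := ENNReal.mul_ne_top hC (ENNReal.pow_ne_top enorm_ne_top)
  refine ⟨h2.trans_lt hfin.lt_top, ?_⟩
  have h3 := ENNReal.toReal_mono hfin h1
  have h4 := ENNReal.toReal_mono hfin h2
  simp only [ENNReal.toReal_mul, ENNReal.toReal_pow, toReal_enorm] at h3 h4
  rw [hHalfNorm, Real.sqrt_le_left (by positivity), mul_pow, Real.sq_sqrt (by positivity)]
  linarith

end GraphCover

/-! ### The Sobolev–Slobodeckij norm of a difference -/

theorem slobodeckijSq_sub_le {d : ℕ} {Ω : Set (Space d)} [SFinite (surf Ω)] (g h : L2Bdry Ω) :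
    slobodeckijSq (g - h) ≤ 2 * slobodeckijSq g + 2 * slobodeckijSq h := by
  have hm : ∀ f : L2Bdry Ω, Measurable fun q : Space d × Space d =>
      edist (f q.1) (f q.2) ^ 2 / edist q.1 q.2 ^ d := fun f => by
    have := (Lp.stronglyMeasurable f).measurable
    fun_prop
  have hm' : ∀ (f : L2Bdry Ω) (x : Space d), Measurable fun y : Space d =>
      edist (f x) (f y) ^ 2 / edist x y ^ d := fun f x => by
    have := (Lp.stronglyMeasurable f).measurable
    fun_prop
  have hpt : ∀ a b a' b' : Space d, edist (a - b) (a' - b') ^ 2 ≤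
      2 * edist a a' ^ 2 + 2 * edist b b' ^ 2 := fun a b a' b' => by
    simp only [edist_eq_enorm_sub]
    rw [sub_sub_sub_comm]
    simpa using enorm_sub_sq_le (a - a') (b - b') 0
  have hae := Lp.coeFn_sub g h
  rw [slobodeckijSq, slobodeckijSq, slobodeckijSq,
    ← lintegral_const_mul _ (hm g).lintegral_prod_right',
    ← lintegral_const_mul _ (hm h).lintegral_prod_right',
    ← lintegral_add_left ((hm g).lintegral_prod_right'.const_mul 2)]
  refine lintegral_mono_ae ?_
  filter_upwards [hae] with x hx
  rw [← lintegral_const_mul _ (hm' g x), ← lintegral_const_mul _ (hm' h x),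
    ← lintegral_add_left ((hm' g x).const_mul 2)]
  refine lintegral_mono_ae ?_
  filter_upwards [hae] with y hy
  rw [hx, hy, Pi.sub_apply, Pi.sub_apply, ← mul_div_assoc, ← mul_div_assoc, ← ENNReal.add_div]
  exact ENNReal.div_le_div_right (hpt _ _ _ _) _

theorem sub_mem_HHalf {d : ℕ} {Ω : Set (Space d)} [SFinite (surf Ω)] {g h : L2Bdry Ω}
    (hg : g ∈ HHalf Ω) (hh : h ∈ HHalf Ω) : g - h ∈ HHalf Ω :=
  (slobodeckijSq_sub_le g h).trans_lt (ENNReal.add_lt_top.2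
    ⟨ENNReal.mul_lt_top (by norm_num) hg, ENNReal.mul_lt_top (by norm_num) hh⟩)

/-- The pointwise bound `|a - b|² ≤ 2|a|² + 2|b|²` gives a quasi-triangle inequality, which is
enough here; both memberships exclude the default value of `toReal` at infinity. -/
theorem hHalfNorm_sub_le {d : ℕ} {Ω : Set (Space d)} [SFinite (surf Ω)] {g h : L2Bdry Ω}
    (hg : g ∈ HHalf Ω) (hh : h ∈ HHalf Ω) :
    hHalfNorm (g - h) ≤ 2 * (hHalfNorm g + hHalfNorm h) := by
  have hsq : ∀ f : L2Bdry Ω, hHalfNorm f ^ 2 = ‖f‖ ^ 2 + (slobodeckijSq f).toReal := fun f =>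
    Real.sq_sqrt (by positivity)
  have h0 : ∀ f : L2Bdry Ω, 0 ≤ hHalfNorm f := fun f => Real.sqrt_nonneg _
  have h1 : (slobodeckijSq (g - h)).toReal ≤
      2 * (slobodeckijSq g).toReal + 2 * (slobodeckijSq h).toReal := by
    have hg' : 2 * slobodeckijSq g ≠ ⊤ := (ENNReal.mul_lt_top (by norm_num) hg).ne
    have hh' : 2 * slobodeckijSq h ≠ ⊤ := (ENNReal.mul_lt_top (by norm_num) hh).ne
    have := ENNReal.toReal_mono (ENNReal.add_ne_top.2 ⟨hg', hh'⟩) (slobodeckijSq_sub_le g h)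
    rwa [ENNReal.toReal_add hg' hh', ENNReal.toReal_mul, ENNReal.toReal_mul,
      ENNReal.toReal_ofNat] at this
  have h2 : ‖g - h‖ ^ 2 ≤ 2 * ‖g‖ ^ 2 + 2 * ‖h‖ ^ 2 := by
    nlinarith [norm_sub_le g h, norm_nonneg (g - h), sq_nonneg (‖g‖ - ‖h‖)]
  refine le_of_sq_le_sq ?_ (by positivity [h0 g, h0 h])
  nlinarith [hsq (g - h), hsq g, hsq h, h0 g, h0 h, mul_nonneg (h0 g) (h0 h)]

/-! ### The finite element estimate -/

section FiniteElement

variable {d : ℕ} {Ω : Set (Space d)}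

theorem grad_sub (v w : H1 Ω) : grad (v - w) = grad v - grad w := rfl

theorem divergence_sub (v w : H1 Ω) : divergence (v - w) = divergence v - divergence w :=
  map_sub ((matTrace d).compLpL 2 (vol Ω)) (grad v) (grad w)

theorem norm_divergence_le (v : H1 Ω) : ‖divergence v‖ ≤ ‖matTrace d‖ * ‖grad v‖ :=
  ContinuousLinearMap.norm_compLp_le _ _

theorem norm_grad_le (v : H1 Ω) : ‖grad v‖ ≤ ‖v‖ := by
  nlinarith [norm_H1_sq v, norm_nonneg v, sq_nonneg ‖val v‖, norm_nonneg (grad v)]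

/-- Mean-zero functions are orthogonal to the constants, so a constant does not improve the
approximation of a mean-zero function by mean-zero functions. -/
theorem norm_sub_le_of_ae_eq_add_const [IsFiniteMeasure (vol Ω)] {p r q : L2 Ω} (hp : p ∈ L20 Ω)
    (hr : r ∈ L20 Ω) {a : ℝ} (hq : ∀ᵐ x ∂(vol Ω), q x = r x + a) : ‖p - r‖ ≤ ‖p - q‖ := by
  have hint : ∀ f : L2 Ω, Integrable f (vol Ω) := fun f => (Lp.memLp f).integrable one_le_two
  have h0 : inner ℝ (p - r) (r - q) = 0 := by
    rw [L2.inner_def]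
    have h1 : ∀ᵐ x ∂(vol Ω), inner ℝ ((p - r) x) ((r - q) x) = -a * (p x - r x) := by
      filter_upwards [hq, Lp.coeFn_sub p r, Lp.coeFn_sub r q] with x hx h1 h2
      rw [h1, h2, Pi.sub_apply, Pi.sub_apply, hx]
      simp
    rw [integral_congr_ae h1, integral_const_mul, integral_sub (hint p) (hint r), hp, hr]
    simp
  have h1 := norm_add_sq_eq_norm_sq_add_norm_sq_real h0
  rw [sub_add_sub_cancel] at h1
  nlinarith [norm_nonneg (p - q), norm_nonneg (p - r), mul_self_nonneg ‖r - q‖]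

theorem le_of_sq_le_add_mul {Z m T : ℝ} (hm : 0 ≤ m) (hT : 0 ≤ T)
    (h : Z ^ 2 ≤ T * m ^ 2 + T * m * Z) : Z ≤ (1 + T) * m := by
  by_contra! hlt
  nlinarith [mul_nonneg hT hm, mul_pos_of_neg_of_neg (sub_neg.2 hlt) (sub_neg.2 hlt),
    mul_nonneg hm hm]

/-- Here `X`, `S`, `Z` stand for `‖∇(y - y_h)‖`, `‖p_h - q‖`, `‖∇(y_h - w)‖`, and `a`, `P` for the
approximation errors. Eliminating `S` and `X` leaves a quadratic inequality for `Z` in terms of `a +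
P`; the summands of `T` are the coefficients of its four kinds of terms. -/
theorem add_le_of_stability {α M a P S X Z T : ℝ} (hα : 0 < α) (hM0 : 0 ≤ M) (ha0 : 0 ≤ a)
    (hP0 : 0 ≤ P) (hZ0 : 0 ≤ Z) (h1 : α * S ≤ X + M * P)
    (h2 : Z ^ 2 ≤ M * a * S + M * Z * P + a * Z) (h3 : X ≤ a + Z)
    (hT : T = 1 + M + M / α + M ^ 2 / α) :
    X + (P + S) ≤ (3 + T + (2 + T + M) / α) * (a + P) := by
  have hS' : S ≤ (X + M * P) / α := by rwa [le_div_iff₀' hα]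
  have hT0 : 0 ≤ T := by rw [hT]; positivity
  have hZle : Z ≤ (1 + T) * (a + P) := by
    refine le_of_sq_le_add_mul (by positivity) hT0 (h2.trans ?_)
    have e1 : M * a * S ≤ M * a * ((a + Z + M * P) / α) := by
      gcongr
      exact hS'.trans (by gcongr)
    have e2 : M * a * ((a + Z + M * P) / α) + M * Z * P + a * Z =
        M / α * (a ^ 2 + a * Z) + M ^ 2 / α * (a * P) + M * (Z * P) + a * Z := by
      field_simp
    have e3 : T * (a + P) ^ 2 + T * (a + P) * Z =
        M / α * ((a + P) ^ 2 + (a + P) * Z) + M ^ 2 / α * ((a + P) ^ 2 + (a + P) * Z) +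
        M * ((a + P) ^ 2 + (a + P) * Z) + ((a + P) ^ 2 + (a + P) * Z) := by
      rw [hT]; ring
    have haZ := mul_nonneg ha0 hZ0
    have hPZ := mul_nonneg hP0 hZ0
    have haP := mul_nonneg ha0 hP0
    have i1 : M / α * (a ^ 2 + a * Z) ≤ M / α * ((a + P) ^ 2 + (a + P) * Z) := by
      gcongr <;> linarith
    have i2 : M ^ 2 / α * (a * P) ≤ M ^ 2 / α * ((a + P) ^ 2 + (a + P) * Z) := by
      gcongr
      nlinarith [sq_nonneg a, sq_nonneg P]
    have i3 : M * (Z * P) ≤ M * ((a + P) ^ 2 + (a + P) * Z) := by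
      gcongr
      nlinarith [sq_nonneg (a + P)]
    have i4 : a * Z ≤ (a + P) ^ 2 + (a + P) * Z := by
      nlinarith [sq_nonneg (a + P)]
    linarith
  have hXle : X ≤ (2 + T) * (a + P) := by linarith
  have hSle : S ≤ (2 + T + M) / α * (a + P) := by
    refine hS'.trans ?_
    rw [div_mul_eq_mul_div]
    gcongr
    nlinarith [mul_nonneg hM0 ha0]
  linarith

/-- Quasi-optimality with respect to the discrete functions with the discrete boundary datum. -/
theorem norm_error_le {α : ℝ} (hα : 0 < α) {Yh : Submodule ℝ (H1 Ω)} {Qh : Submodule ℝ (L2 Ω)}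
    (hQ : ∀ q ∈ Qh, q ∈ L20 Ω) (his : DiscreteInfSup Yh Qh α) {u uh : L2Bdry Ω}
    {y yh w : H1 Ω} {p ph q : L2 Ω} (hy : IsWeakSolution u y p)
    (hyh : IsDiscreteSolution Yh Qh uh yh ph) (hw : w ∈ Yh) (hwt : HasTrace w uh) (hq : q ∈ Qh)
    {T : ℝ} (hT : T = 1 + ‖matTrace d‖ + ‖matTrace d‖ / α + ‖matTrace d‖ ^ 2 / α) :
    ‖grad (y - yh)‖ + ‖p - ph‖ ≤
      (3 + T + (2 + T + ‖matTrace d‖) / α) * (‖grad (y - w)‖ + ‖p - q‖) := by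
  set M := ‖matTrace d‖ with hM
  have hM0 : 0 ≤ M := norm_nonneg _
  have he : yh - w ∈ zeroSpace Yh :=
    ⟨Yh.sub_mem hyh.mem hw, by simpa using hasTrace_sub hyh.boundary hwt⟩
  have hs : ph - q ∈ Qh := Qh.sub_mem hyh.pressure hq
  -- Galerkin orthogonality: a discrete test function with zero trace is admissible in both momentum
  -- equations.
  have hdiv : ∀ v ∈ zeroSpace Yh, inner ℝ (divergence v) (ph - q) =
      inner ℝ (grad (yh - y)) (grad v) + inner ℝ (divergence v) (p - q) := fun v hv => by
    have h1 := hy.momentum v hv.2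
    have h2 := hyh.momentum v hv
    rw [grad_sub, inner_sub_left, inner_sub_right, inner_sub_right]
    linarith
  have hcs : ∀ (v : H1 Ω) (r : L2 Ω), inner ℝ (divergence v) r ≤ M * ‖grad v‖ * ‖r‖ := fun v r =>
    (real_inner_le_norm _ _).trans (by gcongr; exact norm_divergence_le v)
  have hX : ‖grad (yh - y)‖ = ‖grad (y - yh)‖ := by rw [grad_sub, grad_sub, norm_sub_rev]
  set X := ‖grad (y - yh)‖ with hXdef
  set a := ‖grad (y - w)‖ with ha
  set P := ‖p - q‖ with hP
  set S := ‖ph - q‖ with hS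
  set Z := ‖grad (yh - w)‖ with hZ
  have ha0 : 0 ≤ a := norm_nonneg _
  have hP0 : 0 ≤ P := norm_nonneg _
  have hZ0 : 0 ≤ Z := norm_nonneg _
  have h1 : α * S ≤ X + M * P := by
    -- The bound for the supremum needs a nonnegative right-hand side because the supremum of an
    -- empty set is `0`. Likewise a quotient with `‖∇v‖ = 0` is `0`, so no Poincaré inequality is
    -- required.
    refine (his _ hs).trans (Real.sSup_le ?_ (by positivity))
    rintro _ ⟨v, ⟨hv, -⟩, rfl⟩
    refine div_le_of_le_mul₀ (norm_nonneg _) (by positivity) ?_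
    rw [hdiv v hv]
    have := real_inner_le_norm (grad (yh - y)) (grad v)
    rw [hX] at this
    linarith [hcs v (p - q)]
  have h2 : Z ^ 2 ≤ M * a * S + M * Z * P + a * Z := by
    -- Both `∇·y_h` and `∇·y` are orthogonal to `p_h - q`, so `y_h` may be exchanged for `y`. This
    -- replaces the unknown `y_h - w` by the approximation error `y - w`.
    have e1 : inner ℝ (divergence (yh - w)) (ph - q) = inner ℝ (divergence (y - w)) (ph - q) := by
      rw [divergence_sub, divergence_sub, inner_sub_left, inner_sub_left, hyh.mass _ hs,
        hy.mass _ (hQ _ hs)]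
    have e2 := hdiv _ he
    have e3 : grad (yh - w) = grad (yh - y) + grad (y - w) := by
      rw [grad_sub, grad_sub, grad_sub, sub_add_sub_cancel]
    have e4 : Z ^ 2 = inner ℝ (grad (yh - y)) (grad (yh - w)) +
        inner ℝ (grad (y - w)) (grad (yh - w)) := by
      rw [← inner_add_left, ← e3, real_inner_self_eq_norm_sq]
    have e5 := hcs (y - w) (ph - q)
    have e6 := hcs (yh - w) (q - p)
    rw [← neg_sub p q, inner_neg_right, norm_neg] at e6
    have e7 := real_inner_le_norm (grad (y - w)) (grad (yh - w))
    linarith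
  have h3 : X ≤ a + Z := by
    have : grad (y - yh) = grad (y - w) - grad (yh - w) := by
      rw [grad_sub, grad_sub, grad_sub, sub_sub_sub_cancel_right]
    rw [hXdef, this]
    exact norm_sub_le _ _
  have h4 : ‖p - ph‖ ≤ P + S := by
    have : p - ph = (p - q) - (ph - q) := by rw [sub_sub_sub_cancel_right]
    rw [this]
    exact norm_sub_le _ _
  exact (add_le_add_right h4 X).trans (add_le_of_stability hα hM0 ha0 hP0 hZ0 h1 h2 h3 hT)

end FiniteElement

/-! ### The error estimate for arbitrary discrete functions -/

theorem mainTheorem1 {d : ℕ} (hd : d = 2 ∨ d = 3) {Ω : Set (Space d)}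
    (hΩ : IsPolyhedralDomain Ω) {α c₁ : ℝ} (hα : 0 < α) (hc₁ : 0 < c₁) :
    ∃ c : ℝ, 0 < c ∧
      ∀ (Yh : Submodule ℝ (H1 Ω)) (Qh : Submodule ℝ (L2 Ω)),
        FiniteDimensional ℝ Yh → FiniteDimensional ℝ Qh → (∀ q ∈ Qh, q ∈ L20 Ω) →
        DiscreteInfSup Yh Qh α → DiscreteExtension Yh c₁ →
        ∀ u ∈ HHalf Ω, ∀ uh ∈ traceSpace Yh,
        ∀ (y : H1 Ω) (p : L2 Ω), IsWeakSolution u y p →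
        ∀ (yh : H1 Ω) (ph : L2 Ω), IsDiscreteSolution Yh Qh uh yh ph →
        ∀ vh ∈ Yh, ∀ qh ∈ augmentedSpace Qh,
          ‖grad (y - yh)‖ + ‖p - ph‖ ≤
            c * (‖y - vh‖ + hHalfNorm (u - uh) + ‖p - qh‖) := by
  obtain ⟨K⟩ := hΩ.lipschitz.nonempty_graphCover hΩ.isBounded
  obtain ⟨C, hC, htrace⟩ := K.exists_hHalfNorm_trace_le (by omega) hΩ.isOpen hΩ.isBounded
  have hfin := K.isFiniteMeasure_surf hΩ.isOpen
  have hvol : IsFiniteMeasure (vol Ω) :=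
    ⟨by rw [Measure.restrict_apply_univ]; exact hΩ.isBounded.measure_lt_top⟩
  set T := 1 + ‖matTrace d‖ + ‖matTrace d‖ / α + ‖matTrace d‖ ^ 2 / α with hT
  set T' := 3 + T + (2 + T + ‖matTrace d‖) / α with hT'
  have hTpos : 0 < T := by positivity
  have hT'pos : 0 < T' := by positivity
  -- `T'` is the quasi-optimality constant. The bracket collects the direct approximation error and
  -- the correction of the boundary values: `c₁` from the extension, `2` from the quasi-triangle
  -- inequality, `C` from the trace theorem.
  refine ⟨T' * (1 + 2 * c₁ + 2 * c₁ * C), by positivity, ?_⟩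
  intro Yh Qh _ _ hQ his hext u hu uh huh y p hy yh ph hyh vh hvh qh ⟨r, hr, a, hra⟩
  obtain ⟨gh, hgh⟩ := K.exists_hasTrace hΩ.isOpen hΩ.isBounded vh
  obtain ⟨hmem, hle⟩ := htrace _ _ (hasTrace_sub hy.boundary hgh)
  have hmem' : u - uh ∈ HHalf Ω := sub_mem_HHalf hu (htrace _ _ hyh.boundary).1
  have hdiff : hHalfNorm (uh - gh) ≤ 2 * (C * ‖y - vh‖ + hHalfNorm (u - uh)) := by
    have := hHalfNorm_sub_le hmem hmem'
    rw [sub_sub_sub_cancel_left] at this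
    linarith
  have hne : HasTrace (yh - vh) (uh - gh) := hasTrace_sub hyh.boundary hgh
  have hnem : yh - vh ∈ Yh := Yh.sub_mem hyh.mem hvh
  set B := ‖y - vh‖ + hHalfNorm (u - uh) + ‖p - qh‖ with hB
  have hU0 : 0 ≤ hHalfNorm (u - uh) := Real.sqrt_nonneg _
  -- The infimum in the extension property is only approached, so the extension is chosen within `ε`
  -- of the bound and `ε` then tends to zero.
  suffices h : ∀ ε > 0, ‖grad (y - yh)‖ + ‖p - ph‖ ≤
      T' * (1 + 2 * c₁ + 2 * c₁ * C) * B + T' * ε by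
    refine le_of_forall_pos_le_add fun ε hε => ?_
    have := h (ε / T') (by positivity)
    rwa [mul_div_cancel₀ _ hT'pos.ne'] at this
  intro ε hε
  -- The set of extensions is nonempty because it contains `y_h - v_h`; otherwise the infimum would
  -- be the default value `0` and would yield no extension.
  obtain ⟨_, ⟨φ, ⟨hφ, hφt⟩, rfl⟩, hφle⟩ := exists_lt_of_csInf_lt
    (s := (fun v : H1 Ω => ‖grad v‖) '' {v | v ∈ Yh ∧ HasTrace v (uh - gh)})
    (Set.Nonempty.image _ ⟨_, hnem, hne⟩) (lt_of_le_of_lt (hext _ ⟨_, hnem, hne⟩)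
      (lt_add_of_pos_right _ hε))
  have hw : HasTrace (vh + φ) uh := by simpa using hasTrace_add hgh hφt
  have hgrad : ‖grad (y - (vh + φ))‖ ≤ ‖y - vh‖ + ‖grad φ‖ := by
    rw [← sub_sub, grad_sub]
    exact (norm_sub_le _ _).trans (by gcongr; exact norm_grad_le _)
  -- The constant component of the pressure approximation is discarded, leaving an element of `Q_h`.
  have hpr := norm_sub_le_of_ae_eq_add_const hy.pressure (hQ r hr) hra
  refine (norm_error_le hα hQ his hy hyh (Yh.add_mem hvh hφ) hw hr hT).trans ?_
  rw [mul_assoc, ← mul_add, ← hT']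
  refine mul_le_mul_of_nonneg_left ?_ hT'pos.le
  have hcd := mul_le_mul_of_nonneg_left hdiff hc₁.le
  dsimp only at hφle
  have hcC : 0 ≤ c₁ * C := by positivity
  have h1 : c₁ * C * ‖y - vh‖ ≤ c₁ * C * B := by gcongr; rw [hB]; linarith [norm_nonneg (p - qh)]
  have h2 : c₁ * hHalfNorm (u - uh) ≤ c₁ * B := by
    gcongr; rw [hB]; linarith [norm_nonneg (p - qh), norm_nonneg (y - vh)]
  nlinarith
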